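/- **Setting.** An $m$-player finite-horizon general-sum Markov game has states $\mathcal S=\{1,\dots,S\}$, action sets $\mathcal A_i=\{1,\dots,A_i\}$, $\mathcal A=\prod_{i=1}^m\mathcal A_i$, horizon $H$, a nominal kernel $P^0=\{P^0_h\}_{h=1}^H$ with $P^0_h:\mathcal S\times\mathcal A\to\Delta(\mathcal S)$, and rewards $r_{i,h}:\mathcal S\times\mathcal A\to[0,1]$ (with $S,A_i\ge 1$). For $R\in[0,1)$ let $\mathcal U^R(P^0)$ be the set of all kernels $P$ such that for all $h,s,\boldsymbol a$ there is $P'\in\Delta(\mathcal S)$ with $P_h(\cdot|s,\boldsymbol a)=(1-R)P^0_h(\cdot|s,\boldsymbol a)+RP'$. For a (possibly correlated) Markov policy $\pi:\mathcal S\times[H]\to\Delta(\mathcal A)$ put $V_{i,1}^{\pi,R}(s)=\inf_{P\in\mathcal U^R(P^0)}\mathbb E_{\pi,P}\big[\sum_{t=1}^H r_{i,t}(s_t,\boldsymbol a_t)\mid s_1=s\big]$ and $V_{i,1}^{\star,\pi_{-i},R}(s)=\max_{\pi_i':\mathcal S\times[H]\to\Delta(\mathcal A_i)}V_{i,1}^{\pi_i'\times\pi_{-i},R}(s)$,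 where $\pi_{-i}$ is the marginal of $\pi$ on the other players. The policy $\pi$ is an $\varepsilon$-robust coarse correlated equilibrium (CCE) if $$\mathsf{gap}_{\mathsf{CCE}}(\pi)=\max_{s\in\mathcal S}\max_{1\le i\le m}\big\{V_{i,1}^{\star,\pi_{-i},R}(s)-V_{i,1}^{\pi,R}(s)\big\}\le\varepsilon .$$ Write $M=\min\{H,1/R\}$ (so $M=H$ if $R=0$). **Algorithm (robust Q-FTRL).** Inputs: the number of rounds $K\ge2$, constants $c_\alpha,c_{\mathsf b}>0$, and $\delta\in(0,1)$. The step sizes are $$\alpha_k=\frac{c_\alpha\log K}{k-1+c_\alpha\log K},\qquad \eta_k=\sqrt{\frac{\log K}{\alpha_kM}},\qquad \alpha_k^K=\alpha_k\prod_{j=k+1}^K(1-\alpha_j).$$ Start from $\widehat V_{i,H+1}=0$. For $h=H,\dots,1$ put $Q^0_{i,h}=0$ and $\pi^1_{i,h}(a_i|s)=1/A_i$; for $k=1,\dots,K$, independently for all $i$, $s$, $a_i$ given the past, draw $a_j\sim\pi^k_{j,h}(\cdot|s)$ independently for $j\ne i$, form $\boldsymbol a$ from these and $a_i$, draw $s'\sim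 P^0_h(\cdot|s,\boldsymbol a)$, and set $$q^k_{i,h}(s,a_i)=r_{i,h}(s,\boldsymbol a)+(1-R)\widehat V_{i,h+1}(s')+R\min_{\mathcal S}\widehat V_{i,h+1},$$ $$Q^k_{i,h}=(1-\alpha_k)Q^{k-1}_{i,h}+\alpha_kq^k_{i,h},\qquad \pi^{k+1}_{i,h}(a_i|s)=\frac{\exp(\eta_{k+1}Q^k_{i,h}(s,a_i))}{\sum_{a\in\mathcal A_i}\exp(\eta_{k+1}Q^k_{i,h}(s,a))}.$$ After round $K$ set $$\widehat\pi_h(\boldsymbol a|s)=\sum_{k=1}^K\alpha_k^K\prod_{i=1}^m\pi^k_{i,h}(a_i|s),$$ $$\beta_{i,h}(s)=c_{\mathsf b}\sqrt{\frac{\log^3\frac{KS\sum_jA_j}{\delta}}{KM}}\ \sum_{k=1}^K\alpha_k^K\Big\{\mathsf{Var}_{\pi^k_{i,h}(\cdot|s)}\big(q^k_{i,h}(s,\cdot)\big)+M\Big\},$$ $$\widehat V_{i,h}(s)=\min\Big\{\sum_{k=1}^K\alpha_k^K\,\mathbb E_{a_i\sim\pi^k_{i,h}(\cdot|s)}\,q^k_{i,h}(s,a_i)+\beta_{i,h}(s),\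 H-h+1\Big\}.$$ The output is the correlated policy $\widehat\pi=\{\widehat\pi_h\}_{h=1}^H$; the total number of samples is $KHS\sum_{i=1}^mA_i$. **Theorem.** For all constants $c_\alpha,c_{\mathsf b}>0$ there is a constant $C>0$, depending on $c_\alpha,c_{\mathsf b}$ only, such that for every game as above and all $R\in[0,1)$, $\varepsilon\in(0,H]$, $\delta\in(0,1)$ and integers $K\ge2$ with $$KHS\sum_{i=1}^mA_i\ \ge\ \frac{C\,H^3S\sum_{i=1}^mA_i}{\varepsilon^2}\,\min\Big\{H,\frac1R\Big\}\,\log^3\Big(\frac{KS\sum_{i=1}^mA_i}{\delta}\Big),$$ with probability at least $1-\delta$ the policy $\widehat\pi$ returned by robust Q-FTRL is an $\varepsilon$-robust CCE, i.e. $\mathsf{gap}_{\mathsf{CCE}}(\widehat\pi)\le\varepsilon$. -/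

import Mathlib

open scoped BigOperators

noncomputable section

namespace RobustMG

/-! ### Finite probability -/

/-- The probability mass function of a point of the probability simplex. -/
def simplexPMF {α : Type} [Fintype α] (p : stdSimplex ℝ α) : PMF α :=
  PMF.ofFintype (fun a => ENNReal.ofReal (p a)) (by
    have h0 : ∀ a ∈ Finset.univ, 0 ≤ p a := fun a _ => p.2.1 a
    have h1 : ∑ a, p a = 1 := p.2.2
    rw [← ENNReal.ofReal_sum_of_nonneg h0, h1, ENNReal.ofReal_one])

/-- The joint law of independent draws `x i ∼ p i`. -/
def indepPMF {ι : Type} [Fintype ι] [DecidableEq ι] {α : ι → Type} [∀ i, Fintype (α i)]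
    (p : ∀ i, PMF (α i)) : PMF (∀ i, α i) :=
  PMF.ofFintype (fun x => ∏ i, p i (x i)) (by
    have h := Finset.prod_univ_sum (fun i => (Finset.univ : Finset (α i)))
      (fun i a => p i a)
    rw [Fintype.piFinset_univ] at h
    rw [← h]
    refine Finset.prod_eq_one fun i _ => ?_
    rw [← tsum_fintype (L := .unconditional _)]
    exact (p i).tsum_coe)

/-- The mean of `f` under the weights `p`. -/
def wMean {α : Type} [Fintype α] (p : α → ℝ) (f : α → ℝ) : ℝ := ∑ a, p a * f a

/-- The variance of `f` under the weights `p`. -/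
def wVar {α : Type} [Fintype α] (p : α → ℝ) (f : α → ℝ) : ℝ :=
  wMean p (fun a => f a ^ 2) - wMean p f ^ 2

/-- The distribution on `α` proportional to `exp (η * Q a)`. -/
def softmax {α : Type} [Fintype α] [Nonempty α] (η : ℝ) (Q : α → ℝ) : stdSimplex ℝ α :=
  ⟨fun a => Real.exp (η * Q a) / ∑ b, Real.exp (η * Q b), by
    have hpos : 0 < ∑ b, Real.exp (η * Q b) :=
      Finset.sum_pos (fun b _ => Real.exp_pos _) Finset.univ_nonempty
    refine ⟨fun a => div_nonneg (Real.exp_pos _).le hpos.le, ?_⟩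
    rw [← Finset.sum_div]
    exact div_self hpos.ne'⟩

/-! ### Markov games

States are `Fin S`, the actions of player `i` are `Fin (A i)`, and the steps `1, …, H` are
indexed by `Fin H` (so that `h : Fin H` stands for step `h + 1`). -/

/-- Joint actions. -/
abbrev JointAction {m : ℕ} (A : Fin m → ℕ) : Type := ∀ i, Fin (A i)

/-- Transition kernels of horizon `H`. -/
abbrev TransKernel {m : ℕ} (S H : ℕ) (A : Fin m → ℕ) : Type :=
  Fin H → Fin S → JointAction A → stdSimplex ℝ (Fin S)

/-- Real weights on joint actions, for every step and state. Such a family is a joint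
(possibly correlated) Markov policy if it satisfies `IsJointPolicy`. -/
abbrev JointWeights {m : ℕ} (S H : ℕ) (A : Fin m → ℕ) : Type :=
  Fin H → Fin S → JointAction A → ℝ

/-- The weights form a probability distribution on joint actions at every step and state. -/
def IsJointPolicy {m S H : ℕ} {A : Fin m → ℕ} (π : JointWeights S H A) : Prop :=
  ∀ h s, π h s ∈ stdSimplex ℝ (JointAction A)

/-- Markov policies of player `i`. -/
abbrev PlayerPolicy {m : ℕ} (S H : ℕ) (A : Fin m → ℕ) (i : Fin m) : Type :=
  Fin H → Fin S → stdSimplex ℝ (Fin (A i))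

/-- A finite-horizon general-sum Markov game with `m` players: nominal transition kernel and
rewards in `[0, 1]`. -/
structure Game (m S H : ℕ) (A : Fin m → ℕ) where
  P0 : TransKernel S H A
  r : Fin m → Fin H → Fin S → JointAction A → ℝ
  r_nonneg : ∀ i h s a, 0 ≤ r i h s a
  r_le_one : ∀ i h s a, r i h s a ≤ 1

section Values

variable {m S H : ℕ} {A : Fin m → ℕ}

/-- Probability of the trajectory with states `x 0, …, x H` and joint actions
`a 0, …, a (H - 1)`, given the initial state `x 0`. -/
def trajProb (π : JointWeights S H A) (P : TransKernel S H A)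
    (x : Fin (H + 1) → Fin S) (a : Fin H → JointAction A) : ℝ :=
  ∏ t : Fin H, π t (x t.castSucc) (a t) * P t (x t.castSucc) (a t) (x t.succ)

/-- Expected total reward from the first step on, for the reward functions `r`, the policy `π`
and the kernel `P`, when the initial state is `s`. -/
def value (r : Fin H → Fin S → JointAction A → ℝ) (π : JointWeights S H A)
    (P : TransKernel S H A) (s : Fin S) : ℝ :=
  ∑ x : Fin (H + 1) → Fin S, ∑ a : Fin H → JointAction A,
    if x 0 = s then trajProb π P x a * ∑ t : Fin H, r t (x t.castSucc) (a t) else 0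

/-- The `R`-contamination uncertainty set of a kernel, rectangular in step, state and joint
action. -/
def uncertaintySet (R : ℝ) (P0 : TransKernel S H A) : Set (TransKernel S H A) :=
  {P | ∀ h s a, ∃ P' : stdSimplex ℝ (Fin S), ∀ s',
    P h s a s' = (1 - R) * P0 h s a s' + R * P' s'}

/-- Robust value function of player `i` at the first step. -/
def robustValue (G : Game m S H A) (R : ℝ) (i : Fin m) (π : JointWeights S H A)
    (s : Fin S) : ℝ :=
  ⨅ P : uncertaintySet R G.P0, value (G.r i) π P s

/-- The policy `π'ᵢ × π₋ᵢ`: player `i` plays `π'ᵢ`, independently of the others, who play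
according to the marginal of `π`. -/
def deviate (i : Fin m) (π' : PlayerPolicy S H A i) (π : JointWeights S H A) :
    JointWeights S H A :=
  fun h s a => π' h s (a i) * ∑ b : Fin (A i), π h s (Function.update a i b)

/-- Optimal robust value of player `i` at the first step against `π₋ᵢ`. -/
def bestResponseValue (G : Game m S H A) (R : ℝ) (i : Fin m) (π : JointWeights S H A)
    (s : Fin S) : ℝ :=
  ⨆ π' : PlayerPolicy S H A i, robustValue G R i (deviate i π' π) s

/-- The gap of a joint policy. -/
def gapCCE (G : Game m S H A) (R : ℝ) (π : JointWeights S H A) : ℝ :=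
  ⨆ s : Fin S, ⨆ i : Fin m, (bestResponseValue G R i π s - robustValue G R i π s)

/-- `π` is a joint policy and an `ε`-robust coarse correlated equilibrium. -/
def IsRobustCCE (G : Game m S H A) (R ε : ℝ) (π : JointWeights S H A) : Prop :=
  IsJointPolicy π ∧ gapCCE G R π ≤ ε

end Values

/-! ### Robust Q-FTRL -/

/-- `min {H, 1 / R}`, with `1 / 0 = ∞`. -/
def effHorizon (H : ℕ) (R : ℝ) : ℝ := if R = 0 then (H : ℝ) else min (H : ℝ) (1 / R)

/-- `log (K S ∑ᵢ Aᵢ / δ)`. -/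
def logTerm {m : ℕ} (S : ℕ) (A : Fin m → ℕ) (K : ℕ) (δ : ℝ) : ℝ :=
  Real.log (K * S * (∑ i, (A i : ℝ)) / δ)

/-- The step sizes `α_k = c_α log K / (k - 1 + c_α log K)`, for `k ≥ 1`. -/
def stepα (cα : ℝ) (K k : ℕ) : ℝ :=
  cα * Real.log K / ((k : ℝ) - 1 + cα * Real.log K)

/-- The step sizes `η_k = sqrt (log K / (α_k min {H, 1 / R}))`, for `k ≥ 1`. -/
def stepη (cα : ℝ) (H : ℕ) (R : ℝ) (K k : ℕ) : ℝ :=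
  Real.sqrt (Real.log K / (stepα cα K k * effHorizon H R))

/-- The weights `α_k^K = α_k ∏_{j = k + 1}^K (1 - α_j)`. -/
def mixWeight (α : ℕ → ℝ) (K k : ℕ) : ℝ := α k * ∏ j ∈ Finset.Icc (k + 1) K, (1 - α j)

/-- The samples of one round at one step: for every player `i`, state `s` and own action `aᵢ`,
a joint action and a next state. -/
abbrev Draw {m : ℕ} (S : ℕ) (A : Fin m → ℕ) : Type :=
  ∀ i : Fin m, Fin S → Fin (A i) → JointAction A × Fin S

section Algorithm

variable {m S H : ℕ} {A : Fin m → ℕ}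

/-- Law of the sample of player `i` at `(s, aᵢ)`: the actions of the players `j ≠ i` are
independent with laws `p j s`, player `i` plays `aᵢ`, and the next state is drawn from the
nominal kernel. -/
def sampleLaw (G : Game m S H A) (h : Fin H) (p : ∀ j, Fin S → stdSimplex ℝ (Fin (A j)))
    (i : Fin m) (s : Fin S) (ai : Fin (A i)) : PMF (JointAction A × Fin S) :=
  (indepPMF (Function.update (fun j => simplexPMF (p j s)) i (PMF.pure ai))).bind fun a =>
    (simplexPMF (G.P0 h s a)).map fun s' => (a, s')

/-- Law of the samples of one round: independent over players, states and own actions. -/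
def drawLaw (G : Game m S H A) (h : Fin H) (p : ∀ j, Fin S → stdSimplex ℝ (Fin (A j))) :
    PMF (Draw S A) :=
  indepPMF fun i => indepPMF fun s => indepPMF fun ai => sampleLaw G h p i s ai

/-- The estimate `q_{i,h}^k = r_{i,h}^k + (1 - R) P_{i,h}^k V_i + R min V_i` computed from the
samples `d` of the round; `P_{i,h}^k(· | s, aᵢ)` is the point mass at the sampled state. -/
def qEst (G : Game m S H A) (R : ℝ) (h : Fin H) (V : Fin m → Fin S → ℝ) (d : Draw S A)
    (i : Fin m) (s : Fin S) (ai : Fin (A i)) : ℝ :=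
  G.r i h s (d i s ai).1 + (1 - R) * V i (d i s ai).2 + R * ⨅ s', V i s'

/-- The table `Q_{i,h}^k`, given the samples `D 0, …, D (k - 1)` of the rounds `1, …, k`. -/
def qTable (G : Game m S H A) (R : ℝ) (α : ℕ → ℝ) (h : Fin H) (V : Fin m → Fin S → ℝ) :
    (k : ℕ) → (Fin k → Draw S A) → ∀ i : Fin m, Fin S → Fin (A i) → ℝ
  | 0, _ => fun _ _ _ => 0
  | k + 1, D => fun i s ai =>
      (1 - α (k + 1)) * qTable G R α h V k (Fin.init D) i s ai
        + α (k + 1) * qEst G R h V (D (Fin.last k)) i s ai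

variable [∀ i, NeZero (A i)]

/-- The policies `π_{i,h}^{k+1}`, given the samples of the rounds `1, …, k`. For `k = 0` the
table vanishes and the policies are uniform. -/
def ftrlPolicy (G : Game m S H A) (R : ℝ) (α η : ℕ → ℝ) (h : Fin H)
    (V : Fin m → Fin S → ℝ) (k : ℕ) (D : Fin k → Draw S A) (i : Fin m) (s : Fin S) :
    stdSimplex ℝ (Fin (A i)) :=
  softmax (η (k + 1)) (qTable G R α h V k D i s)

/-- Law of the samples of the first `k` rounds at step `h`, given the value estimates `V` for
the next step. -/
def roundsLaw (G : Game m S H A) (R : ℝ) (α η : ℕ → ℝ) (h : Fin H)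
    (V : Fin m → Fin S → ℝ) : (k : ℕ) → PMF (Fin k → Draw S A)
  | 0 => PMF.pure Fin.elim0
  | k + 1 => (roundsLaw G R α η h V k).bind fun D =>
      (drawLaw G h (ftrlPolicy G R α η h V k D)).map fun d => Fin.snoc D d

/-- The policies used in round `k + 1`, given the samples of all `K` rounds. -/
def usedPolicy (G : Game m S H A) (R : ℝ) (α η : ℕ → ℝ) (h : Fin H)
    (V : Fin m → Fin S → ℝ) {K : ℕ} (D : Fin K → Draw S A) (k : Fin K) (i : Fin m)
    (s : Fin S) : stdSimplex ℝ (Fin (A i)) :=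
  ftrlPolicy G R α η h V k (Fin.take k k.isLt.le D) i s

/-- The correlated policy `∑ₖ α_k^K (π_{1,h}^k × ⋯ × π_{m,h}^k)` of step `h`. -/
def mixedPolicy (G : Game m S H A) (R : ℝ) (α η : ℕ → ℝ) (h : Fin H)
    (V : Fin m → Fin S → ℝ) {K : ℕ} (D : Fin K → Draw S A) (s : Fin S)
    (a : JointAction A) : ℝ :=
  ∑ k : Fin K, mixWeight α K (k + 1) * ∏ i, usedPolicy G R α η h V D k i s (a i)

/-- The bonus `β_{i,h}(s)`. -/
def bonus (G : Game m S H A) (R cb δ : ℝ) (α η : ℕ → ℝ) (h : Fin H)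
    (V : Fin m → Fin S → ℝ) {K : ℕ} (D : Fin K → Draw S A) (i : Fin m) (s : Fin S) : ℝ :=
  cb * Real.sqrt (logTerm S A K δ ^ 3 / (K * effHorizon H R)) *
    ∑ k : Fin K, mixWeight α K (k + 1) *
      (wVar (usedPolicy G R α η h V D k i s) (qEst G R h V (D k) i s) + effHorizon H R)

/-- The optimistic value estimate of step `h`, truncated at the number of remaining steps
(which is `H - h` for the zero-based index `h`). -/
def nextValue (G : Game m S H A) (R cb δ : ℝ) (α η : ℕ → ℝ) (h : Fin H)
    (V : Fin m → Fin S → ℝ) {K : ℕ} (D : Fin K → Draw S A) (i : Fin m) (s : Fin S) : ℝ :=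
  min ((∑ k : Fin K, mixWeight α K (k + 1) *
      wMean (usedPolicy G R α η h V D k i s) (qEst G R h V (D k) i s))
    + bonus G R cb δ α η h V D i s) ((H : ℝ) - (h : ℕ))

/-- Law of the value estimates and the policy after the last `n` steps have been processed,
from the final step backwards. -/
def backwardLaw (G : Game m S H A) (R cb δ : ℝ) (K : ℕ) (α η : ℕ → ℝ) :
    (n : ℕ) → n ≤ H → PMF ((Fin m → Fin S → ℝ) × JointWeights S H A)
  | 0, _ => PMF.pure (fun _ _ => 0, fun _ _ _ => 0)
  | n + 1, hn =>
      (backwardLaw G R cb δ K α η n (Nat.le_of_succ_le hn)).bind fun Vπ =>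
        let h : Fin H := ⟨H - (n + 1), Nat.sub_lt (Nat.lt_of_lt_of_le n.succ_pos hn) n.succ_pos⟩
        (roundsLaw G R α η h Vπ.1 K).map fun D =>
          (nextValue G R cb δ α η h Vπ.1 D,
            Function.update Vπ.2 h (mixedPolicy G R α η h Vπ.1 D))

/-- Law of the correlated policy returned by robust Q-FTRL with `K` rounds per step, step sizes
`α`, `η`, bonus constant `cb` and confidence parameter `δ`. -/
def robustQFTRL (G : Game m S H A) (R cb δ : ℝ) (K : ℕ) (α η : ℕ → ℝ) :
    PMF (JointWeights S H A) :=
  (backwardLaw G R cb δ K α η H le_rfl).map Prod.snd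

end Algorithm

end RobustMG

end

/-! The uncertainty set is rectangular, so a worst kernel puts its free mass `R` on a minimiser of
the continuation value. Robust values therefore obey a Bellman recursion with target `r + (1 - R)
V(s') + R min V` (`robustValue_eq`), and their span is at most `M` (`robustDP_span_le`). Going
backwards, the estimates `V` are shown to lie, up to a small error, below the robust value of the
output policy and above the robust value of every unilateral deviation. The gap is then at most
twice the error.

Let `ρ = sqrt (L ^ 3 / (K M))` be the `rate` and `l` a constant multiple of it. One step is
summarised by `StepCert`: the new estimate is at most mean plus `l` times variance of the target
under the mixed policy, and at least mean minus `l` times variance (truncated) under every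
deviation, up to `O(ρ M)`. Two facts yield it. The regret of follow the regularized leader, obtained
from the free energy as potential (`ftrl_regret`), is dominated by the bonus
(`Regime.regret_le_bonus`), so the estimate dominates the sampled payoff of each own action.
Exponential supermartingales (`pmfMean_roundsLaw_prod_le`) replace samples by conditional means at
the price of a variance term, and concavity of the variance passes from single rounds to the mixture
(`stepCert_of_goodEvent`).

Bounding each variance by `M ^ 2` would lose a factor `M`. Instead the invariant `BackwardInv`
carries a correction `3 l excess ^ 2`. By a one-step law of total variance (`sq_add_wVar_le`) the
change of this correction pays for the variance, so that `O(ρ M)` remains per step. In total this is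
`O(H ρ M) = O(H sqrt (M L ^ 3 / K))`, which the assumption on `K` makes smaller than `ε`.

The logarithm `L` does not contain `H`, so a union bound over the steps is too expensive. A step
where concentration fails still satisfies the certificate with slack `4 M`
(`stepCert_of_large_slack`). Failed steps are counted, the equilibrium property can fail only if `16
M` times the count exceeds `ε`, and Markov's inequality for the count finishes the proof
(`isRobustCCE_probability`). -/

noncomputable section

namespace RobustMG

/-! ### Means and variances for finite weights -/

section Weights

variable {α : Type} [Fintype α] {p : α → ℝ} {f g : α → ℝ}

theorem coe_mem_stdSimplex (p : stdSimplex ℝ α) : (⇑p : α → ℝ) ∈ stdSimplex ℝ α := p.2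

theorem wMean_add (p f g : α → ℝ) :
    wMean p (fun a => f a + g a) = wMean p f + wMean p g := by
  simp only [wMean, mul_add, Finset.sum_add_distrib]

theorem wMean_sub (p f g : α → ℝ) :
    wMean p (fun a => f a - g a) = wMean p f - wMean p g := by
  simp only [wMean, mul_sub, Finset.sum_sub_distrib]

theorem wMean_mul_left (p f : α → ℝ) (c : ℝ) :
    wMean p (fun a => c * f a) = c * wMean p f := by
  simp only [wMean, Finset.mul_sum]
  exact Finset.sum_congr rfl fun a _ => by ring

theorem wMean_const (hp : p ∈ stdSimplex ℝ α) (c : ℝ) : wMean p (fun _ => c) = c := by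
  simp only [wMean, ← Finset.sum_mul, hp.2, one_mul]

theorem wMean_mono (hp : p ∈ stdSimplex ℝ α) (h : ∀ a, f a ≤ g a) : wMean p f ≤ wMean p g :=
  Finset.sum_le_sum fun a _ => mul_le_mul_of_nonneg_left (h a) (hp.1 a)

theorem wMean_le (hp : p ∈ stdSimplex ℝ α) {c : ℝ} (h : ∀ a, f a ≤ c) : wMean p f ≤ c := by
  simpa only [wMean_const hp] using wMean_mono (g := fun _ => c) hp h

theorem le_wMean (hp : p ∈ stdSimplex ℝ α) {c : ℝ} (h : ∀ a, c ≤ f a) : c ≤ wMean p f := by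
  simpa only [wMean_const hp] using wMean_mono (f := fun _ => c) hp h

theorem wMean_sub_sq (hp : p ∈ stdSimplex ℝ α) (f : α → ℝ) (c : ℝ) :
    wMean p (fun a => (f a - c) ^ 2) = wVar p f + (wMean p f - c) ^ 2 := by
  have h : (fun a => (f a - c) ^ 2) = fun a => (f a ^ 2 - 2 * c * f a) + c ^ 2 := by
    funext a; ring
  rw [h, wMean_add, wMean_sub, wMean_mul_left, wMean_const hp, wVar]
  ring

theorem wVar_eq (hp : p ∈ stdSimplex ℝ α) (f : α → ℝ) :
    wVar p f = wMean p (fun a => (f a - wMean p f) ^ 2) := by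
  rw [wMean_sub_sq hp]; ring

theorem wVar_nonneg (hp : p ∈ stdSimplex ℝ α) (f : α → ℝ) : 0 ≤ wVar p f := by
  rw [wVar_eq hp]
  exact le_wMean hp fun a => sq_nonneg _

theorem wVar_le (hp : p ∈ stdSimplex ℝ α) (f : α → ℝ) (c : ℝ) :
    wVar p f ≤ wMean p (fun a => (f a - c) ^ 2) := by
  rw [wMean_sub_sq hp]
  nlinarith [sq_nonneg (wMean p f - c)]

theorem wVar_add_const (hp : p ∈ stdSimplex ℝ α) (f : α → ℝ) (c : ℝ) :
    wVar p (fun a => f a + c) = wVar p f := by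
  rw [wVar_eq hp, wVar_eq hp, wMean_add, wMean_const hp]
  congr 1
  funext a
  ring

theorem wVar_mul_left (p f : α → ℝ) (c : ℝ) : wVar p (fun a => c * f a) = c ^ 2 * wVar p f := by
  simp only [wVar, mul_pow, wMean_mul_left]
  ring

theorem wVar_add_le (hp : p ∈ stdSimplex ℝ α) (f g : α → ℝ) :
    wVar p (fun a => f a + g a) ≤ 2 * wVar p f + 2 * wVar p g := by
  rw [wVar_eq hp, wVar_eq hp f, wVar_eq hp g, ← wMean_mul_left, ← wMean_mul_left, ← wMean_add,
    wMean_add]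
  refine wMean_mono hp fun a => ?_
  nlinarith [sq_nonneg ((f a - wMean p f) - (g a - wMean p g))]

/-- The Bhatia–Davis inequality. -/
theorem wVar_le_mul (hp : p ∈ stdSimplex ℝ α) {lo hi : ℝ} (hlo : ∀ a, lo ≤ f a)
    (hhi : ∀ a, f a ≤ hi) : wVar p f ≤ (hi - wMean p f) * (wMean p f - lo) := by
  have h : 0 ≤ wMean p (fun a => (hi - f a) * (f a - lo)) :=
    le_wMean hp fun a => mul_nonneg (sub_nonneg.2 (hhi a)) (sub_nonneg.2 (hlo a))
  have h' : (fun a => (hi - f a) * (f a - lo)) =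
      fun a => ((hi + lo) * f a - f a ^ 2) - hi * lo := by
    funext a; ring
  rw [h', wMean_sub, wMean_sub, wMean_mul_left, wMean_const hp] at h
  rw [wVar]
  nlinarith

theorem wVar_le_sq (hp : p ∈ stdSimplex ℝ α) {lo hi : ℝ} (hlo : ∀ a, lo ≤ f a)
    (hhi : ∀ a, f a ≤ hi) : wVar p f ≤ (hi - lo) ^ 2 := by
  have h1 := wVar_le_mul hp hlo hhi
  have h2 := le_wMean hp hlo
  have h3 := wMean_le hp hhi
  nlinarith

/-- By Bhatia–Davis, `c` times the variance is at most `hi - wMean p f` times `c * (wMean p f - lo)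
≤ 1`. Thus a variance bonus with a small coefficient never pushes an estimate above the range of the
samples; this keeps the span of the value estimates under control. -/
theorem wMean_add_mul_wVar_le (hp : p ∈ stdSimplex ℝ α) {lo hi c : ℝ} (hlo : ∀ a, lo ≤ f a)
    (hhi : ∀ a, f a ≤ hi) (hc : 0 ≤ c) (hc1 : c * (hi - lo) ≤ 1) :
    wMean p f + c * wVar p f ≤ hi := by
  have h1 := wVar_le_mul hp hlo hhi
  have h2 := le_wMean hp hlo
  have h3 := wMean_le hp hhi
  have h4 : c * wVar p f ≤ (hi - wMean p f) * (c * (wMean p f - lo)) := by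
    calc c * wVar p f ≤ c * ((hi - wMean p f) * (wMean p f - lo)) :=
          mul_le_mul_of_nonneg_left h1 hc
      _ = _ := by ring
  have h5 : c * (wMean p f - lo) ≤ 1 := by nlinarith
  nlinarith

/-- Variances of ordered functions with small oscillation differ by a multiple of the difference
of the means. -/
theorem abs_wVar_sub_le (hp : p ∈ stdSimplex ℝ α) {B : ℝ} (hfg : ∀ a, f a ≤ g a)
    (hf : ∀ a b, f a - f b ≤ B) (hg : ∀ a b, g a - g b ≤ B) :
    |wVar p g - wVar p f| ≤ 2 * B * (wMean p g - wMean p f) := by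
  -- The difference of variances is linear in `g - f ≥ 0`, with a factor made of two centred
  -- functions, each bounded by the oscillation `B`.
  have key : wVar p g - wVar p f = wMean p (fun a =>
      (g a - f a) * ((g a - wMean p g) + (f a - wMean p f))) := by
    have h : (fun a => (g a - f a) * ((g a - wMean p g) + (f a - wMean p f))) =
        fun a => (g a ^ 2 - f a ^ 2) - (wMean p g + wMean p f) * (g a - f a) := by
      funext a; ring
    rw [h, wMean_sub, wMean_sub, wMean_mul_left, wMean_sub, wVar, wVar]
    ring
  have osc : ∀ {u : α → ℝ}, (∀ a b, u a - u b ≤ B) → ∀ a, |u a - wMean p u| ≤ B := by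
    intro u hu a
    have h1 : wMean p u ≤ u a + B := wMean_le hp fun b => by linarith [hu b a]
    have h2 : u a - B ≤ wMean p u := le_wMean hp fun b => by linarith [hu a b]
    exact abs_le.2 ⟨by linarith, by linarith⟩
  rw [key, ← wMean_sub, ← wMean_mul_left]
  refine abs_le.2 ⟨?_, ?_⟩
  · rw [neg_le_iff_add_nonneg', ← wMean_add]
    refine le_wMean hp fun a => ?_
    have h1 := (abs_le.1 (osc hf a)).1
    have h2 := (abs_le.1 (osc hg a)).1
    nlinarith [hfg a]
  · refine wMean_mono hp fun a => ?_
    have h1 := (abs_le.1 (osc hf a)).2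
    have h2 := (abs_le.1 (osc hg a)).2
    nlinarith [hfg a]

/-- Squaring a function with values in `[0, B]` multiplies the variance by at most `4 B ^ 2`. -/
theorem wVar_sq_le (hp : p ∈ stdSimplex ℝ α) {B : ℝ} (h0 : ∀ a, 0 ≤ f a) (hB : ∀ a, f a ≤ B) :
    wVar p (fun a => f a ^ 2) ≤ 4 * B ^ 2 * wVar p f := by
  refine (wVar_le hp _ (wMean p f ^ 2)).trans ?_
  rw [wVar_eq hp f, ← wMean_mul_left]
  refine wMean_mono hp fun a => ?_
  have h1 := le_wMean hp h0
  have h2 := wMean_le hp hB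
  have h3 : (f a + wMean p f) ^ 2 ≤ (2 * B) ^ 2 :=
    pow_le_pow_left₀ (by linarith [h0 a]) (by linarith [hB a]) 2
  calc (f a ^ 2 - wMean p f ^ 2) ^ 2 = (f a + wMean p f) ^ 2 * (f a - wMean p f) ^ 2 := by ring
    _ ≤ (2 * B) ^ 2 * (f a - wMean p f) ^ 2 := mul_le_mul_of_nonneg_right h3 (sq_nonneg _)
    _ = _ := by ring

theorem sq_wMean_le (hp : p ∈ stdSimplex ℝ α) (f : α → ℝ) :
    wMean p f ^ 2 ≤ wMean p (fun a => f a ^ 2) := by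
  have := wVar_nonneg hp f
  rw [wVar] at this
  linarith

theorem wMean_sum_weights {ι : Type} [Fintype ι] (w : ι → ℝ) (q : ι → α → ℝ) (f : α → ℝ) :
    wMean (fun a => ∑ k, w k * q k a) f = wMean w (fun k => wMean (q k) f) := by
  simp only [wMean, Finset.sum_mul, Finset.mul_sum]
  rw [Finset.sum_comm]
  exact Finset.sum_congr rfl fun k _ => Finset.sum_congr rfl fun a _ => by ring

theorem sum_weights_mem_stdSimplex {ι : Type} [Fintype ι] {w : ι → ℝ} {q : ι → α → ℝ}
    (hw : w ∈ stdSimplex ℝ ι) (hq : ∀ k, q k ∈ stdSimplex ℝ α) :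
    (fun a => ∑ k, w k * q k a) ∈ stdSimplex ℝ α := by
  refine ⟨fun a => Finset.sum_nonneg fun k _ => mul_nonneg (hw.1 k) ((hq k).1 a), ?_⟩
  rw [Finset.sum_comm]
  simp only [← Finset.mul_sum, (hq _).2, mul_one, hw.2]

/-- The variance is concave in the weights. -/
theorem wMean_wVar_le {ι : Type} [Fintype ι] {w : ι → ℝ} (hw : w ∈ stdSimplex ℝ ι)
    (q : ι → α → ℝ) (f : α → ℝ) :
    wMean w (fun k => wVar (q k) f) ≤ wVar (fun a => ∑ k, w k * q k a) f := by
  have h := sq_wMean_le hw (fun k => wMean (q k) f)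
  simp only [wVar, wMean_sum_weights] at h ⊢
  rw [wMean_sub]
  linarith

/-- No lower bound on `x` is required, so the exponential moment bounds below only need the exponent
bounded from above. -/
theorem exp_le_one_add_add_sq {x : ℝ} (hx : x ≤ 1) : Real.exp x ≤ 1 + x + x ^ 2 := by
  rcases le_or_gt (-1) x with h | h
  · have := abs_le.1 (Real.abs_exp_sub_one_sub_id_le (abs_le.2 ⟨h, hx⟩))
    linarith [this.2]
  · have : Real.exp x ≤ 1 := Real.exp_le_one_iff.2 (by linarith)
    nlinarith

theorem wMean_exp_le (hp : p ∈ stdSimplex ℝ α) (hf : ∀ a, f a ≤ 1) :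
    wMean p (fun a => Real.exp (f a)) ≤
      Real.exp (wMean p f + wMean p (fun a => f a ^ 2)) := by
  calc wMean p (fun a => Real.exp (f a)) ≤ wMean p (fun a => 1 + f a + f a ^ 2) :=
        wMean_mono hp fun a => exp_le_one_add_add_sq (hf a)
    _ = (wMean p f + wMean p (fun a => f a ^ 2)) + 1 := by
        rw [wMean_add, wMean_add, wMean_const hp]; ring
    _ ≤ _ := Real.add_one_le_exp _

/-- Bernstein's bound for the cumulant generating function. -/
theorem log_wMean_exp_le (hp : p ∈ stdSimplex ℝ α) {t : ℝ} {lo hi : ℝ} (ht : 0 ≤ t)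
    (hlo : ∀ a, lo ≤ f a) (hhi : ∀ a, f a ≤ hi) (h1 : t * (hi - lo) ≤ 1) :
    Real.log (wMean p (fun a => Real.exp (t * f a))) ≤ t * wMean p f + t ^ 2 * wVar p f := by
  have hx : ∀ a, t * (f a - wMean p f) ≤ 1 := fun a =>
    (mul_le_mul_of_nonneg_left (by linarith [hhi a, le_wMean hp hlo]) ht).trans h1
  have h := wMean_exp_le hp hx
  have e1 : (fun a => Real.exp (t * f a)) =
      fun a => Real.exp (t * wMean p f) * Real.exp (t * (f a - wMean p f)) := by
    funext a
    rw [← Real.exp_add]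
    ring_nf
  have hpos : 0 < wMean p (fun a => Real.exp (t * f a)) := by
    have : Real.exp (t * lo) ≤ wMean p (fun a => Real.exp (t * f a)) :=
      le_wMean hp fun a => Real.exp_le_exp.2 (mul_le_mul_of_nonneg_left (hlo a) ht)
    exact (Real.exp_pos _).trans_le this
  rw [Real.log_le_iff_le_exp hpos, e1, wMean_mul_left, Real.exp_add]
  refine mul_le_mul_of_nonneg_left (h.trans (Real.exp_le_exp.2 ?_)) (Real.exp_pos _).le
  simp only [mul_pow, wMean_mul_left, wMean_sub, wMean_const hp, wVar_eq hp f]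
  simp

end Weights

/-! ### Trajectory expectations -/

section Trajectories

variable {m S H : ℕ} {A : Fin m → ℕ}

/-- Expectation of a functional of the trajectory started at `s`. -/
def trajMean (π : JointWeights S H A) (P : TransKernel S H A) (s : Fin S)
    (F : (Fin (H + 1) → Fin S) → (Fin H → JointAction A) → ℝ) : ℝ :=
  ∑ x : Fin (H + 1) → Fin S, ∑ a : Fin H → JointAction A,
    if x 0 = s then trajProb π P x a * F x a else 0

/-- Arbitrary functionals of the trajectory are allowed because conditioning on the first state and
action turns the total reward into a functional that still contains the first reward. -/
theorem trajMean_succ (π : JointWeights S (H + 1) A) (P : TransKernel S (H + 1) A) (s : Fin S)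
    (F : (Fin (H + 2) → Fin S) → (Fin (H + 1) → JointAction A) → ℝ) :
    trajMean π P s F = ∑ b, π 0 s b * ∑ s', P 0 s b s' *
      trajMean (fun t => π t.succ) (fun t => P t.succ) s'
        (fun x a => F (Fin.cons s x) (Fin.cons b a)) := by
  have h1 : trajMean π P s F = ∑ x : Fin (H + 1) → Fin S, ∑ b, ∑ a : Fin H → JointAction A,
      π 0 s b * P 0 s b (x 0) * trajProb (fun t => π t.succ) (fun t => P t.succ) x a *
        F (Fin.cons s x) (Fin.cons b a) := by
    unfold trajMean
    rw [← (Fin.consEquiv fun _ : Fin (H + 2) => Fin S).sum_comp, Fintype.sum_prod_type_right]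
    refine Finset.sum_congr rfl fun x _ => ?_
    rw [Finset.sum_eq_single s]
    · rw [← (Fin.consEquiv fun _ : Fin (H + 1) => JointAction A).sum_comp,
        Fintype.sum_prod_type]
      refine Finset.sum_congr rfl fun b _ => Finset.sum_congr rfl fun a _ => ?_
      simp [Fin.consEquiv, trajProb, Fin.prod_univ_succ]
    · intro x0 _ hx0
      refine Finset.sum_eq_zero fun a _ => ?_
      simp [Fin.consEquiv, hx0]
    · simp
  have h2 : ∀ b, (∑ s', P 0 s b s' *
      trajMean (fun t => π t.succ) (fun t => P t.succ) s'
        (fun x a => F (Fin.cons s x) (Fin.cons b a))) =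
      ∑ x : Fin (H + 1) → Fin S, ∑ a : Fin H → JointAction A, P 0 s b (x 0) *
        (trajProb (fun t => π t.succ) (fun t => P t.succ) x a *
        F (Fin.cons s x) (Fin.cons b a)) := by
    intro b
    simp only [trajMean, Finset.mul_sum, mul_ite, mul_zero]
    rw [Finset.sum_comm]
    refine Finset.sum_congr rfl fun x _ => ?_
    rw [Finset.sum_comm]
    refine Finset.sum_congr rfl fun a _ => ?_
    rw [Finset.sum_ite_eq]
    simp
  rw [h1, Finset.sum_comm]
  refine Finset.sum_congr rfl fun b _ => ?_
  rw [h2, Finset.mul_sum]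
  refine Finset.sum_congr rfl fun x _ => ?_
  rw [Finset.mul_sum]
  exact Finset.sum_congr rfl fun a _ => by ring

theorem trajMean_const {H : ℕ} {π : JointWeights S H A} (hπ : IsJointPolicy π)
    (P : TransKernel S H A) (s : Fin S) (c : ℝ) : trajMean π P s (fun _ _ => c) = c := by
  induction H generalizing s with
  | zero =>
    unfold trajMean trajProb
    rw [← (Equiv.funUnique (Fin 1) (Fin S)).symm.sum_comp]
    simp
  | succ H ih =>
    rw [trajMean_succ]
    have h := fun s' => ih (π := fun t => π t.succ) (fun t s => hπ t.succ s)
      (fun t => P t.succ) s'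
    simp only [h, ← Finset.sum_mul, stdSimplex.sum_eq_one, (hπ 0 s).2, one_mul]

theorem trajMean_add (π : JointWeights S H A) (P : TransKernel S H A) (s : Fin S)
    (F F' : (Fin (H + 1) → Fin S) → (Fin H → JointAction A) → ℝ) :
    trajMean π P s (fun x a => F x a + F' x a) = trajMean π P s F + trajMean π P s F' := by
  simp only [trajMean, ← Finset.sum_add_distrib]
  refine Finset.sum_congr rfl fun x _ => Finset.sum_congr rfl fun a _ => ?_
  split_ifs <;> ring

theorem value_eq_trajMean (r : Fin H → Fin S → JointAction A → ℝ) (π : JointWeights S H A)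
    (P : TransKernel S H A) (s : Fin S) :
    value r π P s = trajMean π P s fun x a => ∑ t : Fin H, r t (x t.castSucc) (a t) := rfl

/-- The Bellman equation. -/
theorem value_succ (r : Fin (H + 1) → Fin S → JointAction A → ℝ)
    {π : JointWeights S (H + 1) A} (hπ : IsJointPolicy π) (P : TransKernel S (H + 1) A)
    (s : Fin S) :
    value r π P s = ∑ b, π 0 s b * (r 0 s b + ∑ s', P 0 s b s' *
      value (fun t => r t.succ) (fun t => π t.succ) (fun t => P t.succ) s') := by
  rw [value_eq_trajMean, trajMean_succ]
  refine Finset.sum_congr rfl fun b _ => ?_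
  congr 1
  have hπ' : IsJointPolicy (fun t : Fin H => π t.succ) := fun t s => hπ t.succ s
  simp only [Fin.sum_univ_succ, trajMean_add]
  simp only [Fin.castSucc_zero, Fin.cons_zero, trajMean_const hπ', mul_add,
    Finset.sum_add_distrib, ← Finset.sum_mul, stdSimplex.sum_eq_one, one_mul]
  rfl

theorem value_zero (r : Fin 0 → Fin S → JointAction A → ℝ) (π : JointWeights S 0 A)
    (P : TransKernel S 0 A) (s : Fin S) : value r π P s = 0 := by
  simp [value]

end Trajectories

/-! ### Robust dynamic programming -/

section DynamicProgramming

variable {m S H : ℕ} {A : Fin m → ℕ}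

/-- Joint law of the action and the next state. -/
def stepWeight (μ : JointAction A → ℝ) (P : JointAction A → stdSimplex ℝ (Fin S)) :
    JointAction A × Fin S → ℝ :=
  fun x => μ x.1 * P x.1 x.2

/-- Reward plus contaminated continuation value. -/
def stepTarget (ρ : JointAction A → ℝ) (R : ℝ) (V : Fin S → ℝ) : JointAction A × Fin S → ℝ :=
  fun x => ρ x.1 + (1 - R) * V x.2 + R * ⨅ s', V s'

theorem stepWeight_mem_stdSimplex {μ : JointAction A → ℝ} (hμ : μ ∈ stdSimplex ℝ (JointAction A))
    (P : JointAction A → stdSimplex ℝ (Fin S)) :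
    stepWeight μ P ∈ stdSimplex ℝ (JointAction A × Fin S) := by
  refine ⟨fun x => mul_nonneg (hμ.1 _) ((P _).2.1 _), ?_⟩
  simp only [stepWeight, Fintype.sum_prod_type, ← Finset.mul_sum,
    stdSimplex.sum_eq_one, mul_one, hμ.2]

theorem wMean_stepWeight (μ : JointAction A → ℝ) (P : JointAction A → stdSimplex ℝ (Fin S))
    (f : JointAction A × Fin S → ℝ) :
    wMean (stepWeight μ P) f = ∑ a, μ a * ∑ s', P a s' * f (a, s') := by
  simp only [wMean, stepWeight, Fintype.sum_prod_type, Finset.mul_sum, mul_assoc]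

/-- The step at which `n` further steps remain. -/
abbrev stepIdx {H : ℕ} (n : ℕ) (hn : n + 1 ≤ H) : Fin H :=
  ⟨H - (n + 1), Nat.sub_lt (Nat.lt_of_lt_of_le n.succ_pos hn) n.succ_pos⟩

/-- Robust value over the last `n` steps, by backward recursion. -/
def robustDP (R : ℝ) (P0 : TransKernel S H A) (r : Fin H → Fin S → JointAction A → ℝ)
    (π : JointWeights S H A) : (n : ℕ) → n ≤ H → Fin S → ℝ
  | 0, _ => fun _ => 0
  | n + 1, hn => fun s =>
      wMean (stepWeight (π (stepIdx n hn) s) (P0 (stepIdx n hn) s))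
        (stepTarget (r (stepIdx n hn) s) R (robustDP R P0 r π n (Nat.le_of_succ_le hn)))

theorem robustDP_congr (R : ℝ) (P0 : TransKernel S H A)
    (r : Fin H → Fin S → JointAction A → ℝ) {π π' : JointWeights S H A} (n : ℕ) (hn : n ≤ H)
    (h : ∀ t : Fin H, H - n ≤ t → π t = π' t) :
    robustDP R P0 r π n hn = robustDP R P0 r π' n hn := by
  induction n with
  | zero => rfl
  | succ n ih =>
    funext s
    simp only [robustDP]
    rw [ih (Nat.le_of_succ_le hn) fun t ht => h t (by omega), h (stepIdx n hn) le_rfl]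

/-- `value` is unrolled from the first step, whereas `robustDP` counts from the last one. Dropping
the first step reconciles the two, so that inductions on the horizon apply. -/
theorem robustDP_tail (R : ℝ) (P0 : TransKernel S (H + 1) A)
    (r : Fin (H + 1) → Fin S → JointAction A → ℝ) (π : JointWeights S (H + 1) A) (n : ℕ)
    (hn : n ≤ H) :
    robustDP R P0 r π n (Nat.le_succ_of_le hn) =
      robustDP R (fun t => P0 t.succ) (fun t => r t.succ) (fun t => π t.succ) n hn := by
  induction n with
  | zero => rfl
  | succ n ih =>
    funext s
    have e : (stepIdx n (Nat.le_succ_of_le hn) : Fin (H + 1)) = (stepIdx n hn : Fin H).succ := by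
      apply Fin.ext
      simp only [Fin.val_succ]
      omega
    simp only [robustDP]
    rw [ih (Nat.le_of_succ_le hn), e]

theorem robustDP_full (R : ℝ) (P0 : TransKernel S (H + 1) A)
    (r : Fin (H + 1) → Fin S → JointAction A → ℝ) (π : JointWeights S (H + 1) A) (s : Fin S) :
    robustDP R P0 r π (H + 1) le_rfl s =
      wMean (stepWeight (π 0 s) (P0 0 s)) (stepTarget (r 0 s) R
        (robustDP R (fun t => P0 t.succ) (fun t => r t.succ) (fun t => π t.succ) H le_rfl)) := by
  have e : (stepIdx H le_rfl : Fin (H + 1)) = 0 := by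
    apply Fin.ext
    simp
  rw [← robustDP_tail]
  simp only [robustDP]
  rw [e]

theorem sum_mul_stepTarget (P : stdSimplex ℝ (Fin S)) (ρ : JointAction A → ℝ) (R : ℝ)
    (V : Fin S → ℝ) (a : JointAction A) :
    ∑ s', P s' * stepTarget ρ R V (a, s') =
      ρ a + ((1 - R) * ∑ s', P s' * V s' + R * ⨅ s', V s') := by
  have : ∀ s', P s' * stepTarget ρ R V (a, s') =
      P s' * (ρ a + R * ⨅ s', V s') + (1 - R) * (P s' * V s') := by
    intro s'; simp only [stepTarget]; ring
  simp only [this, Finset.sum_add_distrib, ← Finset.sum_mul, ← Finset.mul_sum,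
    stdSimplex.sum_eq_one]
  ring

/-- Under any admissible kernel the contaminating law averages the continuation value, which is at
least its minimum; the recursion is monotone in the continuation. -/
theorem robustDP_le_value {H : ℕ} {R : ℝ} (hR : 0 ≤ R) {P0 : TransKernel S H A}
    (r : Fin H → Fin S → JointAction A → ℝ) {π : JointWeights S H A} (hπ : IsJointPolicy π)
    {P : TransKernel S H A} (hP : P ∈ uncertaintySet R P0) (s : Fin S) :
    robustDP R P0 r π H le_rfl s ≤ value r π P s := by
  induction H generalizing s with
  | zero => rw [value_zero]; rfl
  | succ H ih =>
    rw [value_succ r hπ, robustDP_full, wMean_stepWeight]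
    refine Finset.sum_le_sum fun b _ => mul_le_mul_of_nonneg_left ?_ ((hπ 0 s).1 b)
    rw [sum_mul_stepTarget]
    have hV := fun s' => ih (P0 := fun t => P0 t.succ) (fun t => r t.succ)
      (π := fun t => π t.succ) (fun t s => hπ t.succ s) (P := fun t => P t.succ)
      (fun t s a => hP t.succ s a) s'
    set V := robustDP R (fun t => P0 t.succ) (fun t => r t.succ) (fun t => π t.succ) H le_rfl
    obtain ⟨P', hP'⟩ := hP 0 s b
    have h1 : ∑ s', P 0 s b s' * V s' ≤ ∑ s', P 0 s b s' *
        value (fun t => r t.succ) (fun t => π t.succ) (fun t => P t.succ) s' :=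
      Finset.sum_le_sum fun s' _ => mul_le_mul_of_nonneg_left (hV s') ((P 0 s b).2.1 s')
    have h2 : ∑ s', P 0 s b s' * V s' =
        (1 - R) * ∑ s', P0 0 s b s' * V s' + R * ∑ s', P' s' * V s' := by
      simp only [hP', add_mul, Finset.sum_add_distrib, Finset.mul_sum, mul_assoc]
    have h3 : ⨅ s', V s' ≤ ∑ s', P' s' * V s' :=
      le_wMean P'.2 fun s' => ciInf_le (Set.finite_range V).bddBelow s'
    nlinarith [mul_le_mul_of_nonneg_left h3 hR]

theorem exists_value_eq_robustDP [NeZero S] {H : ℕ} {R : ℝ} (hR : 0 ≤ R) (hR1 : R ≤ 1)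
    (P0 : TransKernel S H A) (r : Fin H → Fin S → JointAction A → ℝ) {π : JointWeights S H A}
    (hπ : IsJointPolicy π) :
    ∃ P ∈ uncertaintySet R P0, ∀ s, value r π P s = robustDP R P0 r π H le_rfl s := by
  induction H with
  | zero => exact ⟨P0, fun h => h.elim0, fun s => by rw [value_zero]; rfl⟩
  | succ H ih =>
    obtain ⟨P, hP, hval⟩ := ih (fun t => P0 t.succ) (fun t => r t.succ)
      (π := fun t => π t.succ) (fun t s => hπ t.succ s)
    set V := robustDP R (fun t => P0 t.succ) (fun t => r t.succ) (fun t => π t.succ) H le_rfl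
      with hVdef
    -- All contamination at the new step goes to a minimiser `s₀` of the continuation value. It does
    -- not depend on the current state or action, and the kernels of later steps are kept, so one
    -- kernel is worst for all initial states.
    obtain ⟨s₀, hs₀⟩ := exists_eq_ciInf_of_finite (f := V)
    let Q : Fin S → JointAction A → stdSimplex ℝ (Fin S) := fun s b =>
      ⟨fun s' => (1 - R) * P0 0 s b s' + R * (Pi.single s₀ 1 : Fin S → ℝ) s', by
        refine ⟨fun s' => add_nonneg (mul_nonneg (by linarith) ((P0 0 s b).2.1 s'))
          (mul_nonneg hR ((single_mem_stdSimplex ℝ s₀).1 s')), ?_⟩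
        rw [Finset.sum_add_distrib, ← Finset.mul_sum, ← Finset.mul_sum, stdSimplex.sum_eq_one,
          (single_mem_stdSimplex ℝ s₀).2]
        ring⟩
    refine ⟨Fin.cons Q P, ?_, fun s => ?_⟩
    · intro h
      refine Fin.cases ?_ (fun t => ?_) h
      · exact fun s b => ⟨⟨_, single_mem_stdSimplex ℝ s₀⟩, fun s' => rfl⟩
      · exact fun s b => hP t s b
    · rw [value_succ r hπ, robustDP_full, wMean_stepWeight]
      refine Finset.sum_congr rfl fun b _ => ?_
      rw [sum_mul_stepTarget]
      simp only [Fin.cons_zero, Fin.cons_succ, hval]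
      have h2 : ∑ s', (Q s b) s' * V s' = (1 - R) * ∑ s', P0 0 s b s' * V s' + R * V s₀ := by
        have : ∀ s', (Q s b) s' * V s' =
            (1 - R) * (P0 0 s b s' * V s') + R * ((Pi.single s₀ 1 : Fin S → ℝ) s' * V s') := by
          intro s'
          change ((1 - R) * P0 0 s b s' + R * (Pi.single s₀ 1 : Fin S → ℝ) s') * V s' = _
          ring
        simp only [this, Finset.sum_add_distrib, ← Finset.mul_sum]
        simp [Pi.single_apply]
      rw [h2, hs₀]

theorem uncertaintySet_self {R : ℝ} (P0 : TransKernel S H A) : P0 ∈ uncertaintySet R P0 :=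
  fun h s a => ⟨P0 h s a, fun s' => by ring⟩

/-- The robust value is computed by robust dynamic programming. -/
theorem robustValue_eq [NeZero S] (G : Game m S H A) {R : ℝ} (hR : 0 ≤ R) (hR1 : R ≤ 1)
    (i : Fin m) {π : JointWeights S H A} (hπ : IsJointPolicy π) (s : Fin S) :
    robustValue G R i π s = robustDP R G.P0 (G.r i) π H le_rfl s := by
  have hle : ∀ P : uncertaintySet R G.P0,
      robustDP R G.P0 (G.r i) π H le_rfl s ≤ value (G.r i) π P s :=
    fun P => robustDP_le_value hR (G.r i) hπ P.2 s
  have : Nonempty (uncertaintySet R G.P0) := ⟨⟨_, uncertaintySet_self G.P0⟩⟩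
  refine le_antisymm ?_ (le_ciInf hle)
  obtain ⟨P, hP, hval⟩ := exists_value_eq_robustDP hR hR1 G.P0 (G.r i) hπ
  rw [← hval]
  exact ciInf_le (f := fun P : uncertaintySet R G.P0 => value (G.r i) π P s)
    ⟨_, Set.forall_mem_range.2 hle⟩ ⟨P, hP⟩

end DynamicProgramming

/-! ### Deviations -/

section Deviations

variable {m S H : ℕ} {A : Fin m → ℕ}

/-- The involution that exchanges the action of player `i` with a spare one. -/
def swapAction (i : Fin m) : JointAction A × Fin (A i) ≃ JointAction A × Fin (A i) :=
  ⟨fun x => (Function.update x.1 i x.2, x.1 i), fun x => (Function.update x.1 i x.2, x.1 i),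
    fun x => by simp, fun x => by simp⟩

theorem deviate_mem_stdSimplex (i : Fin m) (π' : PlayerPolicy S H A i) {π : JointWeights S H A}
    {h : Fin H} {s : Fin S} (hπ : π h s ∈ stdSimplex ℝ (JointAction A)) :
    deviate i π' π h s ∈ stdSimplex ℝ (JointAction A) := by
  refine ⟨fun a => mul_nonneg ((π' h s).2.1 _) (Finset.sum_nonneg fun b _ => hπ.1 _), ?_⟩
  have h1 : ∑ a, deviate i π' π h s a =
      ∑ x : JointAction A × Fin (A i), π' h s (x.1 i) * π h s (Function.update x.1 i x.2) := by
    simp only [deviate, Finset.mul_sum, Fintype.sum_prod_type]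
  -- Exchanging player `i`'s action with the summed one separates the factors: `π'` then depends on
  -- the spare action only, `π` on the joint action only.
  rw [h1, ← (swapAction i).sum_comp]
  simp only [swapAction, Equiv.coe_fn_mk, Function.update_self, Function.update_idem,
    Function.update_eq_self, Fintype.sum_prod_type, ← Finset.sum_mul]
  simp only [stdSimplex.sum_eq_one, one_mul, hπ.2]

end Deviations

/-! ### Mixing weights -/

section MixWeight

theorem mixWeight_succ (α : ℕ → ℝ) {K k : ℕ} (hk : k ≤ K) :
    mixWeight α (K + 1) k = (1 - α (K + 1)) * mixWeight α K k := by
  rw [mixWeight, mixWeight, Finset.prod_Icc_succ_top (by omega)]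
  ring

theorem mixWeight_self (α : ℕ → ℝ) (K : ℕ) : mixWeight α K K = α K := by
  rw [mixWeight, Finset.Icc_eq_empty (by omega), Finset.prod_empty, mul_one]

theorem sum_mixWeight_succ (α g : ℕ → ℝ) (K : ℕ) :
    ∑ k : Fin (K + 1), mixWeight α (K + 1) (k + 1) * g k =
      (1 - α (K + 1)) * (∑ k : Fin K, mixWeight α K (k + 1) * g k) + α (K + 1) * g K := by
  rw [Fin.sum_univ_castSucc, Finset.mul_sum]
  congr 1
  · refine Finset.sum_congr rfl fun k _ => ?_
    rw [Fin.val_castSucc, mixWeight_succ α (show (k : ℕ) + 1 ≤ K from k.2)]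
    ring
  · simp [mixWeight_self]

/-- Unrolling a recursive inequality with step sizes `α`. -/
theorem le_sum_mixWeight {α u g : ℕ → ℝ} {K : ℕ} (hα : ∀ k, α (k + 1) ≤ 1) (h0 : u 0 ≤ 0)
    (hu : ∀ k < K, u (k + 1) ≤ (1 - α (k + 1)) * u k + α (k + 1) * g k) :
    u K ≤ ∑ k : Fin K, mixWeight α K (k + 1) * g k := by
  induction K with
  | zero => simpa using h0
  | succ K ih =>
    rw [sum_mixWeight_succ]
    have h1 := ih fun k hk => hu k (hk.trans K.lt_succ_self)
    have h2 := hu K K.lt_succ_self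
    have h3 := mul_le_mul_of_nonneg_left h1 (sub_nonneg.2 (hα K))
    linarith

theorem eq_sum_mixWeight {α u g : ℕ → ℝ} {K : ℕ} (h0 : u 0 = 0)
    (hu : ∀ k < K, u (k + 1) = (1 - α (k + 1)) * u k + α (k + 1) * g k) :
    u K = ∑ k : Fin K, mixWeight α K (k + 1) * g k := by
  induction K with
  | zero => simpa using h0
  | succ K ih =>
    rw [sum_mixWeight_succ, hu K K.lt_succ_self, ih fun k hk => hu k (hk.trans K.lt_succ_self)]

/-- The step sizes `c / (k - 1 + c)`. -/
def harmStep (c : ℝ) (k : ℕ) : ℝ := c / ((k : ℝ) - 1 + c)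

variable {c : ℝ}

theorem harmStep_succ (c : ℝ) (k : ℕ) : harmStep c (k + 1) = c / (k + c) := by
  simp [harmStep]

theorem harmStep_succ_pos (hc : 0 < c) (k : ℕ) : 0 < harmStep c (k + 1) := by
  rw [harmStep_succ]; positivity

theorem harmStep_succ_le_one (hc : 0 < c) (k : ℕ) : harmStep c (k + 1) ≤ 1 := by
  rw [harmStep_succ, div_le_one (by positivity)]
  linarith [(Nat.cast_nonneg k : (0 : ℝ) ≤ k)]

theorem one_sub_harmStep_succ (hc : 0 < c) (k : ℕ) : 1 - harmStep c (k + 1) = k / (k + c) := by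
  rw [harmStep_succ]
  have : (k : ℝ) + c ≠ 0 := by positivity
  field_simp
  ring

theorem mixWeight_nonneg (hc : 0 < c) (K k : ℕ) : 0 ≤ mixWeight (harmStep c) K (k + 1) := by
  refine mul_nonneg (harmStep_succ_pos hc k).le (Finset.prod_nonneg fun j hj => ?_)
  obtain ⟨j, rfl⟩ : ∃ n, j = n + 1 := ⟨j - 1, by have := (Finset.mem_Icc.1 hj).1; omega⟩
  linarith [harmStep_succ_le_one hc j]

theorem mixWeight_mem_stdSimplex (hc : 0 < c) {K : ℕ} (hK : K ≠ 0) :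
    (fun k : Fin K => mixWeight (harmStep c) K (k + 1)) ∈ stdSimplex ℝ (Fin K) := by
  refine ⟨fun k => mixWeight_nonneg hc K k, ?_⟩
  -- The sequence `0, 1, 1, …` solves the recursion with constant input `1` because the first step
  -- size equals `1`; unrolling it gives total weight `1`.
  have h := eq_sum_mixWeight (α := harmStep c) (u := fun k => if k = 0 then 0 else 1)
    (g := fun _ => 1) (K := K) (by simp) (by
      intro k _
      rcases Nat.eq_zero_or_pos k with rfl | hk
      · simp [harmStep, hc.ne']
      · simp [hk.ne'])
  simpa [hK] using h.symm

theorem mixWeight_le (hc : 1 ≤ c) {K k : ℕ} (hk : k < K) :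
    mixWeight (harmStep c) K (k + 1) ≤ c / K := by
  have hc0 : 0 < c := by linarith
  -- The sharper denominator `K - 1 + c` makes the induction close: passing to `K + 1` costs the
  -- factor `K / (K - 1 + c)`, at most `1` since `c ≥ 1`.
  have key : ∀ K, ∀ k < K, mixWeight (harmStep c) K (k + 1) ≤ c / ((K : ℝ) - 1 + c) := by
    intro K
    induction K with
    | zero => intro k hk; omega
    | succ K ih =>
      intro k hk
      have e : ((K + 1 : ℕ) : ℝ) - 1 + c = K + c := by push_cast; ring
      rw [e]
      rcases Nat.lt_succ_iff_lt_or_eq.1 hk with h | rfl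
      · have hK : (1 : ℝ) ≤ K := by exact_mod_cast (by omega : 1 ≤ K)
        rw [mixWeight_succ _ (by omega), one_sub_harmStep_succ hc0]
        calc (K : ℝ) / (K + c) * mixWeight (harmStep c) K (k + 1)
            ≤ K / (K + c) * (c / ((K : ℝ) - 1 + c)) :=
              mul_le_mul_of_nonneg_left (ih k h) (by positivity)
          _ = c / (K + c) * (K / ((K : ℝ) - 1 + c)) := by ring
          _ ≤ c / (K + c) * 1 := by
              refine mul_le_mul_of_nonneg_left ?_ (by positivity)
              rw [div_le_one (by linarith)]
              linarith
          _ = _ := mul_one _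
      · rw [mixWeight_self, harmStep_succ]
  have hK : (1 : ℝ) ≤ K := by exact_mod_cast (by omega : 1 ≤ K)
  exact (key K k hk).trans (div_le_div_of_nonneg_left hc0.le (by linarith) (by linarith))

/-- Bernoulli's inequality bounds each factor `1 - c / (K + c)` by `(1 - 1 / (K + c)) ^ c`, and the
bases telescope. With `c` of order `log K` this makes the weights of early rounds polynomially small
in `K`. -/
theorem mixWeight_le_rpow (hc : 1 ≤ c) {K k : ℕ} (hk : k < K) :
    mixWeight (harmStep c) K (k + 1) ≤ ((k + c) / ((K : ℝ) - 1 + c)) ^ c := by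
  have hc0 : 0 < c := by linarith
  induction K with
  | zero => omega
  | succ K ih =>
    have e : ((K + 1 : ℕ) : ℝ) - 1 + c = K + c := by push_cast; ring
    rw [e]
    rcases Nat.lt_succ_iff_lt_or_eq.1 hk with h | rfl
    · have hK : (1 : ℝ) ≤ K := by exact_mod_cast (by omega : 1 ≤ K)
      have h1 : 1 - harmStep c (K + 1) ≤ (((K : ℝ) - 1 + c) / (K + c)) ^ c := by
        have hb := one_add_mul_self_le_rpow_one_add (s := -(1 / ((K : ℝ) + c))) (by
          rw [neg_le_neg_iff, div_le_one (by linarith)]; linarith) hc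
        have e1 : 1 + -(1 / ((K : ℝ) + c)) = ((K : ℝ) - 1 + c) / (K + c) := by
          have : (K : ℝ) + c ≠ 0 := by positivity
          field_simp
          ring
        rw [e1] at hb
        rw [harmStep_succ]
        refine le_trans (le_of_eq ?_) hb
        ring
      rw [mixWeight_succ _ (by omega)]
      have h2 : 0 ≤ (k + c) / ((K : ℝ) - 1 + c) := div_nonneg (by positivity) (by linarith)
      have h3 : 0 ≤ ((K : ℝ) - 1 + c) / (K + c) := div_nonneg (by linarith) (by positivity)
      calc (1 - harmStep c (K + 1)) * mixWeight (harmStep c) K (k + 1)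
          ≤ (((K : ℝ) - 1 + c) / (K + c)) ^ c * ((k + c) / ((K : ℝ) - 1 + c)) ^ c :=
            mul_le_mul h1 (ih h) (mixWeight_nonneg hc0 _ _) (Real.rpow_nonneg h3 _)
        _ = ((k + c) / ((K : ℝ) + c)) ^ c := by
            rw [← Real.mul_rpow h3 h2]
            congr 1
            have : (K : ℝ) - 1 + c ≠ 0 := by linarith
            field_simp
    · rw [mixWeight_self, div_self (by positivity), Real.one_rpow]
      exact harmStep_succ_le_one hc0 k

end MixWeight

/-! ### Follow the regularized leader -/

section FreeEnergy

variable {X : Type} [Fintype X]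

/-- The normalized free energy of the table `Q` at inverse temperature `η`. -/
def freeEnergy (η : ℝ) (Q : X → ℝ) : ℝ :=
  Real.log (wMean (fun _ => (Fintype.card X : ℝ)⁻¹) fun a => Real.exp (η * Q a)) / η

theorem freeEnergy_mul {η c : ℝ} (hc : 0 < c) (Q : X → ℝ) :
    freeEnergy η (fun a => c * Q a) = c * freeEnergy (η * c) Q := by
  rw [freeEnergy, freeEnergy]
  simp only [← mul_assoc]
  rw [mul_div_assoc', mul_comm η c, mul_div_mul_left _ _ hc.ne']

variable [Nonempty X]

theorem uniform_mem_stdSimplex :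
    (fun _ => (Fintype.card X : ℝ)⁻¹) ∈ stdSimplex ℝ X := by
  refine ⟨fun _ => by positivity, ?_⟩
  simp

theorem wMean_exp_pos {p : X → ℝ} (hp : p ∈ stdSimplex ℝ X) (f : X → ℝ) :
    0 < wMean p fun a => Real.exp (f a) := by
  obtain ⟨a, ha⟩ := Finite.exists_min f
  exact (Real.exp_pos (f a)).trans_le (le_wMean hp fun b => Real.exp_le_exp.2 (ha b))

theorem log_wMean_exp_le_of_le {p : X → ℝ} (hp : p ∈ stdSimplex ℝ X) {f : X → ℝ} {b : ℝ}
    (h : ∀ a, f a ≤ b) : Real.log (wMean p fun a => Real.exp (f a)) ≤ b := by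
  rw [Real.log_le_iff_le_exp (wMean_exp_pos hp f)]
  exact wMean_le hp fun a => Real.exp_le_exp.2 (h a)

theorem freeEnergy_le {η b : ℝ} (hη : 0 < η) {Q : X → ℝ} (h : ∀ a, Q a ≤ b) :
    freeEnergy η Q ≤ b := by
  rw [freeEnergy, div_le_iff₀ hη, mul_comm]
  exact log_wMean_exp_le_of_le uniform_mem_stdSimplex
    fun a => mul_le_mul_of_nonneg_left (h a) hη.le

theorem le_freeEnergy {η : ℝ} (hη : 0 < η) (Q : X → ℝ) (a : X) :
    Q a ≤ freeEnergy η Q + Real.log (Fintype.card X) / η := by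
  have hn : (0 : ℝ) < Fintype.card X := by exact_mod_cast Fintype.card_pos
  have h : (Fintype.card X : ℝ)⁻¹ * Real.exp (η * Q a) ≤
      wMean (fun _ => (Fintype.card X : ℝ)⁻¹) fun a => Real.exp (η * Q a) :=
    Finset.single_le_sum (f := fun b => (Fintype.card X : ℝ)⁻¹ * Real.exp (η * Q b))
      (fun b _ => by positivity) (Finset.mem_univ a)
  have h2 := Real.log_le_log (by positivity) h
  rw [Real.log_mul (by positivity) (Real.exp_pos _).ne', Real.log_inv, Real.log_exp] at h2
  rw [freeEnergy, ← add_div, le_div_iff₀ hη]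
  linarith

/-- This is the power mean inequality for the functions `exp (θ Q)`, and it relies on the
normalisation by the uniform law. It allows the learning rate to vary between rounds. -/
theorem freeEnergy_mono {θ η : ℝ} (hθ : 0 < θ) (h : θ ≤ η) (Q : X → ℝ) :
    freeEnergy θ Q ≤ freeEnergy η Q := by
  have hu := uniform_mem_stdSimplex (X := X)
  have hη : 0 < η := hθ.trans_le h
  have hj := Real.rpow_arith_mean_le_arith_mean_rpow Finset.univ
    (fun _ : X => (Fintype.card X : ℝ)⁻¹) (fun a => Real.exp (θ * Q a)) (fun a _ => hu.1 a) hu.2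
    (fun a _ => (Real.exp_pos _).le) (p := η / θ) ((one_le_div hθ).2 h)
  have hpos := wMean_exp_pos hu (fun a => θ * Q a)
  have h2 := Real.log_le_log (Real.rpow_pos_of_pos hpos _) hj
  have e : ∀ a, Real.exp (θ * Q a) ^ (η / θ) = Real.exp (η * Q a) := by
    intro a
    rw [← Real.exp_mul]
    congr 1
    field_simp
  simp only [e] at h2
  rw [Real.log_rpow hpos] at h2
  rw [freeEnergy, freeEnergy, div_le_div_iff₀ hθ hη]
  have h3 := mul_le_mul_of_nonneg_right h2 hθ.le
  have e3 : η / θ * Real.log (wMean (fun _ => (Fintype.card X : ℝ)⁻¹)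
      fun a => Real.exp (θ * Q a)) * θ = Real.log (wMean (fun _ => (Fintype.card X : ℝ)⁻¹)
      fun a => Real.exp (θ * Q a)) * η := by
    field_simp
  rw [e3] at h3
  exact h3

/-- The increment of the potential is exactly a cumulant generating function under the policy
currently played, which is where the mean and the variance in the regret bound come from. -/
theorem freeEnergy_add {η t : ℝ} (Q q : X → ℝ) :
    freeEnergy η (fun a => Q a + t * q a) = freeEnergy η Q +
      Real.log (wMean (softmax η Q) fun a => Real.exp (η * t * q a)) / η := by
  have hu := uniform_mem_stdSimplex (X := X)
  have hpos := wMean_exp_pos hu (fun a => η * Q a)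
  have e : (wMean (fun _ => (Fintype.card X : ℝ)⁻¹) fun a => Real.exp (η * (Q a + t * q a))) =
      (wMean (fun _ => (Fintype.card X : ℝ)⁻¹) fun a => Real.exp (η * Q a)) *
        wMean (softmax η Q) fun a => Real.exp (η * t * q a) := by
    have hs : 0 < ∑ b, Real.exp (η * Q b) :=
      Finset.sum_pos (fun b _ => Real.exp_pos _) Finset.univ_nonempty
    have h1 : (wMean (fun _ => (Fintype.card X : ℝ)⁻¹) fun a => Real.exp (η * Q a)) =
        (Fintype.card X : ℝ)⁻¹ * ∑ b, Real.exp (η * Q b) := by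
      rw [wMean, Finset.mul_sum]
    rw [h1, wMean, wMean, Finset.mul_sum]
    refine Finset.sum_congr rfl fun a _ => ?_
    change _ = _ * (Real.exp (η * Q a) / (∑ b, Real.exp (η * Q b)) * _)
    rw [mul_add, Real.exp_add, ← mul_assoc η t]
    field_simp
  rw [freeEnergy, e, Real.log_mul hpos.ne' (wMean_exp_pos (coe_mem_stdSimplex (softmax η Q)) _).ne', add_div]
  rfl

/-- Shrinking the table by `1 - α` amounts to multiplying the inverse temperature by `1 - α`; if the
result is at most `η`, monotonicity returns to temperature `η`, where `freeEnergy_add` applies. -/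
theorem freeEnergy_step_le {α η η' : ℝ} (hα : α < 1) (hη' : 0 < η')
    (h : η' * (1 - α) ≤ η) (Q q : X → ℝ) :
    freeEnergy η' (fun a => (1 - α) * Q a + α * q a) ≤ (1 - α) * freeEnergy η Q +
      (1 - α) * (Real.log (wMean (softmax η Q)
        fun a => Real.exp (η * (α / (1 - α)) * q a)) / η) := by
  have h1 : 0 < 1 - α := by linarith
  have e : (fun a => (1 - α) * Q a + α * q a) =
      fun a => (1 - α) * (Q a + α / (1 - α) * q a) := by
    funext a
    field_simp
  rw [e, freeEnergy_mul h1, ← mul_add, ← freeEnergy_add]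
  exact mul_le_mul_of_nonneg_left (freeEnergy_mono (mul_pos hη' h1) h _) h1.le

theorem freeEnergy_step_le_of_le {α η η' hi : ℝ} (hα0 : 0 ≤ α) (hα : α ≤ 1) (hη : 0 < η)
    (hη' : 0 < η') (h : η' * (1 - α) ≤ η) {Q q : X → ℝ} (hq : ∀ a, q a ≤ hi) :
    freeEnergy η' (fun a => (1 - α) * Q a + α * q a) ≤ (1 - α) * freeEnergy η Q + α * hi := by
  rcases hα.lt_or_eq with h1 | rfl
  · refine (freeEnergy_step_le h1 hη' h Q q).trans ?_
    have h2 : 0 < 1 - α := by linarith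
    have h3 : Real.log (wMean (softmax η Q)
        fun a => Real.exp (η * (α / (1 - α)) * q a)) ≤ η * (α / (1 - α)) * hi :=
      log_wMean_exp_le_of_le (coe_mem_stdSimplex (softmax η Q)) fun a =>
        mul_le_mul_of_nonneg_left (hq a) (by positivity)
    have h4 : (1 - α) * (Real.log (wMean (softmax η Q)
        fun a => Real.exp (η * (α / (1 - α)) * q a)) / η) ≤
        (1 - α) * (η * (α / (1 - α)) * hi / η) := by gcongr
    have e : (1 - α) * (η * (α / (1 - α)) * hi / η) = α * hi := by field_simp
    linarith
  -- The case `α = 1` is that of the first round: the old table is forgotten and only the range of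
  -- `q` matters.
  · simpa using freeEnergy_le hη' hq

theorem freeEnergy_step_le_of_small {α η η' lo hi : ℝ} (hα0 : 0 ≤ α) (hα : α < 1) (hη : 0 < η)
    (hη' : 0 < η') (h : η' * (1 - α) ≤ η) {Q q : X → ℝ} (hlo : ∀ a, lo ≤ q a)
    (hhi : ∀ a, q a ≤ hi) (hsmall : η * (α / (1 - α)) * (hi - lo) ≤ 1) :
    freeEnergy η' (fun a => (1 - α) * Q a + α * q a) ≤ (1 - α) * freeEnergy η Q +
      α * (wMean (softmax η Q) q + η * (α / (1 - α)) * wVar (softmax η Q) q) := by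
  refine (freeEnergy_step_le hα hη' h Q q).trans ?_
  have h2 : 0 < 1 - α := by linarith
  have h3 := log_wMean_exp_le (coe_mem_stdSimplex (softmax η Q)) (t := η * (α / (1 - α))) (by positivity)
    hlo hhi hsmall
  have h4 : (1 - α) * (Real.log (wMean (softmax η Q)
      fun a => Real.exp (η * (α / (1 - α)) * q a)) / η) ≤
      (1 - α) * ((η * (α / (1 - α)) * wMean (softmax η Q) q +
        (η * (α / (1 - α))) ^ 2 * wVar (softmax η Q) q) / η) := by gcongr
  have e : (1 - α) * ((η * (α / (1 - α)) * wMean (softmax η Q) q +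
        (η * (α / (1 - α))) ^ 2 * wVar (softmax η Q) q) / η) =
      α * (wMean (softmax η Q) q + η * (α / (1 - α)) * wVar (softmax η Q) q) := by
    field_simp
  linarith

/-- Regret of follow the regularized leader with step sizes `α` and `η`: a round contributes a
variance term if its learning rate is below `b`, and its range otherwise. -/
theorem ftrl_regret {α η : ℕ → ℝ} {Q q : ℕ → X → ℝ} {K : ℕ} {b lo hi : ℝ} (hb : 0 ≤ b)
    (hα0 : ∀ k, 0 ≤ α (k + 1)) (hα1 : ∀ k, α (k + 1) ≤ 1) (hη : ∀ k, 0 < η (k + 1))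
    (hηα : ∀ k, η (k + 2) * (1 - α (k + 1)) ≤ η (k + 1)) (hQ0 : ∀ a, Q 0 a = 0)
    (hQ : ∀ k < K, ∀ a, Q (k + 1) a = (1 - α (k + 1)) * Q k a + α (k + 1) * q k a)
    (hlo : ∀ k < K, ∀ a, lo ≤ q k a) (hhi : ∀ k < K, ∀ a, q k a ≤ hi)
    (hbsmall : b * (hi - lo) ≤ 1) {u : ℕ → ℝ}
    (hu0 : ∀ k, 0 ≤ u k)
    (hu : ∀ k < K, (α (k + 1) < 1 ∧ η (k + 1) * (α (k + 1) / (1 - α (k + 1))) ≤ b) ∨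
      hi - lo ≤ u k) (a : X) :
    Q K a ≤ (∑ k : Fin K, mixWeight α K (k + 1) *
      (wMean (softmax (η (k + 1)) (Q k)) (q k) + b * wVar (softmax (η (k + 1)) (Q k)) (q k) + u k))
      + Real.log (Fintype.card X) / η (K + 1) := by
  -- The potential dominates every entry of the final table up to the entropy term. Its recursion is
  -- unrolled with the mixing weights.
  refine (le_freeEnergy (hη K) (Q K) a).trans (add_le_add_left ?_ _)
  refine le_sum_mixWeight (u := fun k => freeEnergy (η (k + 1)) (Q k))
    (g := fun k => wMean (softmax (η (k + 1)) (Q k)) (q k)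
      + b * wVar (softmax (η (k + 1)) (Q k)) (q k) + u k) hα1
    (freeEnergy_le (hη 0) fun a => (hQ0 a).le) fun k hk => ?_
  have hvar := wVar_nonneg (coe_mem_stdSimplex (softmax (η (k + 1)) (Q k))) (q k)
  have e : Q (k + 1) = fun a => (1 - α (k + 1)) * Q k a + α (k + 1) * q k a :=
    funext (hQ k hk)
  change freeEnergy (η (k + 2)) (Q (k + 1)) ≤ _
  rw [e]
  rcases hu k hk with ⟨h1, h2⟩ | h
  · have hlohi : 0 ≤ hi - lo := by
      obtain ⟨a⟩ := ‹Nonempty X›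
      linarith [hlo k hk a, hhi k hk a]
    refine (freeEnergy_step_le_of_small (hα0 k) h1 (hη k) (hη (k + 1)) (hηα k) (hlo k hk)
      (hhi k hk) ((mul_le_mul_of_nonneg_right h2 hlohi).trans hbsmall)).trans ?_
    refine add_le_add_right (mul_le_mul_of_nonneg_left ?_ (hα0 k)) _
    have := mul_le_mul_of_nonneg_right h2 hvar
    have := hu0 k
    change _ ≤ wMean (softmax (η (k + 1)) (Q k)) (q k)
      + b * wVar (softmax (η (k + 1)) (Q k)) (q k) + u k
    linarith
  · refine (freeEnergy_step_le_of_le (hα0 k) (hα1 k) (hη k) (hη (k + 1)) (hηα k)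
      (hhi k hk)).trans ?_
    refine add_le_add_right (mul_le_mul_of_nonneg_left ?_ (hα0 k)) _
    have := le_wMean (coe_mem_stdSimplex (softmax (η (k + 1)) (Q k))) (hlo k hk)
    have := mul_nonneg hb hvar
    change _ ≤ wMean (softmax (η (k + 1)) (Q k)) (q k)
      + b * wVar (softmax (η (k + 1)) (Q k)) (q k) + u k
    linarith

end FreeEnergy

/-! ### The parameter regime -/

/-- The rate `sqrt (L ^ 3 / (K M))`. -/
def rate (M L : ℝ) (K : ℕ) : ℝ := Real.sqrt (L ^ 3 / (K * M))

/-- The consequences of a large number of rounds on which the analysis rests. -/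
structure Regime (cα cb M L : ℝ) (K : ℕ) : Prop where
  cα_pos : 0 < cα
  cb_pos : 0 < cb
  K_large : 32 ≤ K
  one_le_M : 1 ≤ M
  one_le_L : 1 ≤ L
  log_le : Real.log K ≤ L
  one_le_c : 1 ≤ cα * Real.log K
  early_harm : 2 * (cα * Real.log K) ≤ Real.exp (-(2 / cα)) * K
  early_log : 4 * cα / cb ^ 2 ≤ Real.exp (-(2 / cα)) * L
  small : 24 * (cb + 1) * (rate M L K * M) ≤ 1
  rate_large : 6 ≤ cb * rate M L K * K
  M_le : M ≤ K

namespace Regime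

variable {cα cb M L : ℝ} {K : ℕ}

theorem K_pos (h : Regime cα cb M L K) : (0 : ℝ) < K := by
  have : (32 : ℝ) ≤ K := by exact_mod_cast h.K_large
  linarith

theorem log_pos (h : Regime cα cb M L K) : 0 < Real.log K := by
  refine Real.log_pos ?_
  have : (32 : ℝ) ≤ K := by exact_mod_cast h.K_large
  linarith

theorem M_pos (h : Regime cα cb M L K) : 0 < M := by linarith [h.one_le_M]

theorem rate_pos (h : Regime cα cb M L K) : 0 < rate M L K := by
  have h1 := h.K_pos
  have h2 := h.M_pos
  have h3 : 0 < L := by linarith [h.one_le_L]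
  exact Real.sqrt_pos.2 (by positivity)

theorem rate_sq (h : Regime cα cb M L K) : rate M L K ^ 2 = L ^ 3 / (K * M) := by
  have h1 := h.K_pos
  have h2 := h.M_pos
  have h3 : 0 < L := by linarith [h.one_le_L]
  exact Real.sq_sqrt (by positivity)

theorem rate_mul_M_small (h : Regime cα cb M L K) : 24 * (rate M L K * M) ≤ 1 := by
  have h1 : 0 ≤ cb * (rate M L K * M) :=
    mul_nonneg h.cb_pos.le (mul_nonneg h.rate_pos.le h.M_pos.le)
  linarith [h.small]

theorem cb_rate_mul_M_small (h : Regime cα cb M L K) : 24 * (cb * rate M L K * M) ≤ 1 := by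
  have h1 : 0 ≤ rate M L K * M := mul_nonneg h.rate_pos.le h.M_pos.le
  linarith [h.small]

/-- The learning rate is small except in early rounds, whose weight is negligible. -/
theorem late_or_early (h : Regime cα cb M L K) {k : ℕ} (hk : k < K) :
    (harmStep (cα * Real.log K) (k + 1) < 1 ∧
      Real.sqrt (Real.log K / (harmStep (cα * Real.log K) (k + 1) * M)) *
        (harmStep (cα * Real.log K) (k + 1) / (1 - harmStep (cα * Real.log K) (k + 1))) ≤
          cb * rate M L K) ∨
      mixWeight (harmStep (cα * Real.log K)) K (k + 1) ≤ 1 / (K : ℝ) ^ 2 := by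
  have hl := h.log_pos
  have hK := h.K_pos
  have hM := h.M_pos
  have hL : 0 < L := by linarith [h.one_le_L]
  have hcα := h.cα_pos
  have hcb := h.cb_pos
  set l := Real.log K with hldef
  set c := cα * l with hc
  have hc1 : 1 ≤ c := h.one_le_c
  have hc0 : 0 < c := by linarith
  have hk0 : (0 : ℝ) ≤ k := Nat.cast_nonneg k
  -- The first condition gives `(k + c) / k ^ 2 ≤ 4 / (k + c)`, and the second is then what the
  -- squared learning rate needs to be below `(cb * rate) ^ 2`. If one of them fails, `early_harm`
  -- or `early_log` gives `k + c ≤ exp (-(2 / cα)) * K`, and the `c`-th power of `exp (-(2 / cα))`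
  -- is `K ^ (-2)`.
  by_cases hlate : c ≤ k ∧ 4 * cα / cb ^ 2 * K ≤ (k + c) * L
  · left
    obtain ⟨h1, h2⟩ := hlate
    have hkpos : (0 : ℝ) < k := by linarith
    refine ⟨?_, ?_⟩
    · rw [harmStep_succ, div_lt_one (by positivity)]
      linarith
    · rw [one_sub_harmStep_succ hc0, harmStep_succ]
      refine (pow_le_pow_iff_left₀ (by positivity)
        (mul_nonneg hcb.le h.rate_pos.le) two_ne_zero).1 ?_
      rw [mul_pow, mul_pow, Real.sq_sqrt (by positivity), h.rate_sq]
      have e : l / (c / (k + c) * M) * (c / (k + c) / (k / (k + c))) ^ 2 =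
          (l * c / M) * ((k + c) / k ^ 2) := by
        field_simp
      rw [e]
      have h3 : ((k : ℝ) + c) / k ^ 2 ≤ 4 / (k + c) := by
        rw [div_le_div_iff₀ (by positivity) (by positivity)]
        nlinarith
      have h4 : 4 / ((k : ℝ) + c) ≤ cb ^ 2 * L / (cα * K) := by
        rw [div_le_div_iff₀ (by positivity) (by positivity)]
        rw [div_mul_eq_mul_div, div_le_iff₀ (by positivity)] at h2
        linarith
      calc l * c / M * (((k : ℝ) + c) / k ^ 2) ≤ l * c / M * (cb ^ 2 * L / (cα * K)) :=
            mul_le_mul_of_nonneg_left (h3.trans h4) (by positivity)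
        _ = cb ^ 2 * ((l ^ 2 * L) / (K * M)) := by
            rw [hc]; field_simp
        _ ≤ cb ^ 2 * (L ^ 3 / (K * M)) := by
            have : l ^ 2 ≤ L ^ 2 := pow_le_pow_left₀ hl.le h.log_le 2
            have h5 : l ^ 2 * L ≤ L ^ 3 := by nlinarith
            gcongr
  · right
    refine (mixWeight_le_rpow hc1 hk).trans ?_
    have hden : 0 < (K : ℝ) - 1 + c := by linarith
    have h0 : 0 < (k + c) / ((K : ℝ) - 1 + c) := by positivity
    have hratio : (k + c) / ((K : ℝ) - 1 + c) ≤ Real.exp (-(2 / cα)) := by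
      rw [div_le_iff₀ hden]
      have hr : (k : ℝ) + c ≤ Real.exp (-(2 / cα)) * K := by
        rw [not_and_or, not_le, not_le] at hlate
        rcases hlate with h1 | h1
        · exact le_trans (by linarith) h.early_harm
        · have h2 := mul_le_mul_of_nonneg_right h.early_log hK.le
          refine le_of_mul_le_mul_right ?_ hL
          linarith
      exact hr.trans (mul_le_mul_of_nonneg_left (by linarith) (Real.exp_pos _).le)
    calc ((k + c) / ((K : ℝ) - 1 + c)) ^ c ≤ Real.exp (-(2 / cα)) ^ c :=
          Real.rpow_le_rpow h0.le hratio hc0.le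
      _ = 1 / (K : ℝ) ^ 2 := by
          rw [← Real.exp_mul]
          have e : -(2 / cα) * c = -(l + l) := by
            rw [hc]; field_simp; ring
          rw [e, Real.exp_neg, Real.exp_add, hldef, Real.exp_log hK]
          field_simp

theorem learningRate_pos (h : Regime cα cb M L K) (k : ℕ) :
    0 < Real.sqrt (Real.log K / (harmStep (cα * Real.log K) (k + 1) * M)) := by
  have hl := h.log_pos
  have hM := h.M_pos
  have := harmStep_succ_pos (mul_pos h.cα_pos hl) k
  exact Real.sqrt_pos.2 (by positivity)

/-- This is the compatibility of step sizes and learning rates needed for the potential argument.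
The squared learning rate is proportional to `k + c`, so the claim amounts to `(k + 1 + c) k ^ 2 ≤
(k + c) ^ 3`. -/
theorem learningRate_succ_le (h : Regime cα cb M L K) (k : ℕ) :
    Real.sqrt (Real.log K / (harmStep (cα * Real.log K) (k + 2) * M)) *
      (1 - harmStep (cα * Real.log K) (k + 1)) ≤
      Real.sqrt (Real.log K / (harmStep (cα * Real.log K) (k + 1) * M)) := by
  have hl := h.log_pos
  have hM := h.M_pos
  have hc1 := h.one_le_c
  have hc0 := mul_pos h.cα_pos hl
  have hk0 : (0 : ℝ) ≤ k := Nat.cast_nonneg k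
  have e : harmStep (cα * Real.log K) (k + 2) = cα * Real.log K / (k + 1 + cα * Real.log K) := by
    have := harmStep_succ (cα * Real.log K) (k + 1)
    push_cast at this
    exact this
  rw [e, one_sub_harmStep_succ hc0, harmStep_succ]
  set l := Real.log K
  set c := cα * l
  refine (pow_le_pow_iff_left₀ (by positivity) (Real.sqrt_nonneg _) two_ne_zero).1 ?_
  rw [mul_pow, Real.sq_sqrt (by positivity), Real.sq_sqrt (by positivity)]
  have e1 : l / (c / (k + 1 + c) * M) * (k / (k + c)) ^ 2 =
      (l / (c * M)) * ((k + 1 + c) * k ^ 2 / (k + c) ^ 2) := by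
    field_simp
  have e2 : l / (c / (k + c) * M) = (l / (c * M)) * (k + c) := by
    field_simp
  rw [e1, e2]
  refine mul_le_mul_of_nonneg_left ?_ (by positivity)
  rw [div_le_iff₀ (by positivity)]
  have h1 : (k : ℝ) ^ 2 ≤ (k + c) * (2 * k * c) := by
    nlinarith [mul_nonneg (mul_nonneg hk0 hk0) (sub_nonneg.2 hc1), mul_nonneg hk0 hk0,
      mul_nonneg hk0 (mul_nonneg hc0.le hc0.le)]
  nlinarith [mul_nonneg hk0 hk0, mul_nonneg (mul_nonneg (add_nonneg hk0 hc0.le) hc0.le) hc0.le]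

/-- The regret of follow the regularized leader is dominated by the bonus. -/
theorem regret_le_bonus (h : Regime cα cb M L K) {X : Type} [Fintype X] [Nonempty X]
    {Q q : ℕ → X → ℝ} {lo hi : ℝ} (hX : Real.log (Fintype.card X) ≤ L)
    (hQ0 : ∀ a, Q 0 a = 0)
    (hQ : ∀ k < K, ∀ a, Q (k + 1) a = (1 - harmStep (cα * Real.log K) (k + 1)) * Q k a +
      harmStep (cα * Real.log K) (k + 1) * q k a)
    (hlo : ∀ k < K, ∀ a, lo ≤ q k a) (hhi : ∀ k < K, ∀ a, q k a ≤ hi)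
    (hspan : hi - lo ≤ 3 * M) (a : X) {p : ℕ → stdSimplex ℝ X}
    (hp : ∀ k, p k =
      softmax (Real.sqrt (Real.log K / (harmStep (cα * Real.log K) (k + 1) * M))) (Q k)) :
    Q K a ≤ (∑ k : Fin K, mixWeight (harmStep (cα * Real.log K)) K (k + 1) * wMean (p k) (q k))
      + cb * rate M L K * ∑ k : Fin K, mixWeight (harmStep (cα * Real.log K)) K (k + 1) *
        (wVar (p k) (q k) + M) := by
  classical
  have hl := h.log_pos
  have hK := h.K_pos
  have hM := h.M_pos
  have hc0 := mul_pos h.cα_pos hl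
  have hρ := h.rate_pos
  have hcb := h.cb_pos
  set α := harmStep (cα * Real.log K) with hα
  -- Rounds of negligible weight are charged their full range `3 M`, all other rounds a variance
  -- term.
  set u : ℕ → ℝ := fun k => if k < K ∧ mixWeight α K (k + 1) ≤ 1 / (K : ℝ) ^ 2 then 3 * M else 0
    with hu
  have hreg := ftrl_regret (α := α) (Q := Q) (q := q) (K := K) (u := u)
    (η := fun k => Real.sqrt (Real.log K / (α k * M))) (b := cb * rate M L K) (lo := lo)
    (hi := hi) (by positivity)
    (fun k => (harmStep_succ_pos hc0 k).le) (fun k => harmStep_succ_le_one hc0 k)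
    h.learningRate_pos h.learningRate_succ_le hQ0 hQ hlo hhi
    (by
      have h1 := h.cb_rate_mul_M_small
      have h2 : cb * rate M L K * (hi - lo) ≤ cb * rate M L K * (3 * M) :=
        mul_le_mul_of_nonneg_left hspan (by positivity)
      have h3 : 0 ≤ cb * rate M L K * M := by positivity
      linarith)
    (fun k => by
      simp only [hu]
      split_ifs <;> positivity)
    (fun k hk => by
      rcases h.late_or_early hk with h1 | h1
      · exact Or.inl h1
      · right
        simp only [hu, hk, hα, h1, and_self, if_true]
        exact hspan) a
  simp only [← hp] at hreg
  have hw := mixWeight_mem_stdSimplex hc0 (K := K) (by have := h.K_large; omega)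
  -- There are at most `K` such rounds, each of weight at most `1 / K ^ 2`, so they cost `3 M / K`.
  -- By `rate_large` this is at most half of the constant part `cb * rate * M` of the bonus.
  have hub : ∑ k : Fin K, mixWeight α K (k + 1) * u k ≤ cb / 2 * rate M L K * M := by
    have h1 : ∀ k : Fin K, mixWeight α K (k + 1) * u k ≤ 1 / (K : ℝ) ^ 2 * (3 * M) := by
      intro k
      simp only [hu]
      split_ifs with h2
      · exact mul_le_mul_of_nonneg_right h2.2 (by positivity)
      · rw [mul_zero]; positivity
    calc ∑ k : Fin K, mixWeight α K (k + 1) * u k ≤ ∑ _k : Fin K, 1 / (K : ℝ) ^ 2 * (3 * M) :=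
          Finset.sum_le_sum fun k _ => h1 k
      _ = 3 * M / K := by
          rw [Finset.sum_const, Finset.card_univ, Fintype.card_fin, nsmul_eq_mul]
          field_simp
      _ ≤ cb / 2 * rate M L K * M := by
          rw [div_le_iff₀ hK]
          nlinarith [h.rate_large]
  -- The entropy term uses up the other half of the constant part of the bonus.
  have hlog : Real.log (Fintype.card X) / Real.sqrt (Real.log K / (α (K + 1) * M)) ≤
      cb / 2 * rate M L K * M := by
    have hL0 : 0 ≤ L := by linarith [h.one_le_L]
    have h1 : 0 < Real.sqrt (Real.log K / (α (K + 1) * M)) := h.learningRate_pos K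
    refine (div_le_div_of_nonneg_right hX h1.le).trans ?_
    refine (pow_le_pow_iff_left₀ (by positivity) (by positivity) two_ne_zero).1 ?_
    have hcα := h.cα_pos
    rw [div_pow, Real.sq_sqrt (by have := harmStep_succ_pos hc0 K; positivity), mul_pow, mul_pow,
      h.rate_sq, hα, harmStep_succ]
    have e1 : L ^ 2 / (Real.log K / (cα * Real.log K / (K + cα * Real.log K) * M)) =
        L ^ 2 * M * cα / (K + cα * Real.log K) := by
      field_simp
    have e2 : (cb / 2) ^ 2 * (L ^ 3 / (K * M)) * M ^ 2 = L ^ 2 * M * (cb ^ 2 * L / 4) / K := by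
      field_simp
      ring
    rw [e1, e2]
    have h4 : cα ≤ cb ^ 2 * L / 4 := by
      have h5 := h.early_log
      have h6 : Real.exp (-(2 / cα)) ≤ 1 := Real.exp_le_one_iff.2 (by
        rw [neg_nonpos]; positivity)
      have h7 : 4 * cα / cb ^ 2 ≤ L := h5.trans (by nlinarith)
      rw [div_le_iff₀ (by positivity)] at h7
      linarith
    have : 0 ≤ L ^ 2 * M := by positivity
    gcongr
    linarith
  have hsum : ∑ k : Fin K, mixWeight α K (k + 1) * M = M := by
    rw [← Finset.sum_mul]
    rw [hw.2, one_mul]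
  simp only [mul_add, Finset.sum_add_distrib] at hreg ⊢
  rw [hsum]
  have e : ∑ k : Fin K, mixWeight α K (k + 1) * (cb * rate M L K * wVar (p k) (q k)) =
      cb * rate M L K * ∑ k : Fin K, mixWeight α K (k + 1) * wVar (p k) (q k) := by
    rw [Finset.mul_sum]
    exact Finset.sum_congr rfl fun k _ => by ring
  rw [e] at hreg
  linarith

end Regime

/-! ### One step of robust dynamic programming -/

section OneStep

variable {m S : ℕ} {A : Fin m → ℕ}

theorem iInf_le_apply (V : Fin S → ℝ) (s : Fin S) : ⨅ s', V s' ≤ V s :=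
  ciInf_le (Set.finite_range V).bddBelow s

theorem iInf_mono_fin {V U : Fin S → ℝ} (h : ∀ s, V s ≤ U s) : ⨅ s, V s ≤ ⨅ s, U s :=
  ciInf_mono (Set.finite_range V).bddBelow h

variable {ρ : JointAction A → ℝ} {R : ℝ}

theorem stepTarget_mono (hR : 0 ≤ R) (hR1 : R ≤ 1) {V U : Fin S → ℝ} (h : ∀ s, V s ≤ U s)
    (x : JointAction A × Fin S) : stepTarget ρ R V x ≤ stepTarget ρ R U x :=
  add_le_add (add_le_add le_rfl (mul_le_mul_of_nonneg_left (h _) (by linarith)))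
    (mul_le_mul_of_nonneg_left (iInf_mono_fin h) hR)

theorem le_stepTarget (hR1 : R ≤ 1) (hρ : ∀ a, 0 ≤ ρ a) (V : Fin S → ℝ)
    (x : JointAction A × Fin S) : ⨅ s, V s ≤ stepTarget ρ R V x := by
  have h1 := mul_le_mul_of_nonneg_left (iInf_le_apply V x.2) (sub_nonneg.2 hR1)
  have h2 := hρ x.1
  rw [stepTarget]
  linarith

theorem stepTarget_le [NeZero S] (hR1 : R ≤ 1) (hρ : ∀ a, ρ a ≤ 1) {V : Fin S → ℝ} {B : ℝ}
    (hB : ∀ s s', V s - V s' ≤ B) (x : JointAction A × Fin S) :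
    stepTarget ρ R V x ≤ 1 + (1 - R) * B + ⨅ s, V s := by
  obtain ⟨s₀, hs₀⟩ := exists_eq_ciInf_of_finite (f := V)
  have h1 := mul_le_mul_of_nonneg_left (hB x.2 s₀) (sub_nonneg.2 hR1)
  have h2 := hρ x.1
  rw [hs₀] at h1
  rw [stepTarget]
  linarith

variable {p : JointAction A × Fin S → ℝ} {M : ℝ} {f : Fin S → ℝ}

/-- One step of the law of total variance. -/
theorem sq_add_wVar_le (hp : p ∈ stdSimplex ℝ (JointAction A × Fin S)) (hR : 0 ≤ R) (hR1 : R ≤ 1)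
    (hρ0 : ∀ a, 0 ≤ ρ a) (hρ1 : ∀ a, ρ a ≤ 1) (hM : 1 ≤ M) (hf : ∀ s, f s - ⨅ s', f s' ≤ M)
    {y : ℝ} (hy0 : 0 ≤ y) (hy : y ≤ wMean p (stepTarget ρ R f) - ⨅ s', f s') :
    y ^ 2 + wVar p (stepTarget ρ R f) ≤
      (1 - R) * wMean p (fun x => (f x.2 - ⨅ s', f s') ^ 2) + 3 * M := by
  set b := ⨅ s', f s' with hb
  have hv0 : ∀ s, 0 ≤ f s - b := fun s => sub_nonneg.2 (iInf_le_apply f s)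
  have e1 : wVar p (stepTarget ρ R f) = wVar p (fun x => stepTarget ρ R f x + -b) :=
    (wVar_add_const hp _ _).symm
  have e2 : wMean p (fun x => stepTarget ρ R f x + -b) = wMean p (stepTarget ρ R f) - b := by
    rw [wMean_add, wMean_const hp]; ring
  -- Relative to the minimum `b`, the target is `ρ + (1 - R) (f - b)`. In its square the terms with
  -- the reward are at most `1 + 2 M ≤ 3 M`, and `(1 - R) ^ 2 ≤ 1 - R`.
  have h1 : wMean p (fun x => (stepTarget ρ R f x + -b) ^ 2) ≤
      wMean p (fun x => (1 - R) * (f x.2 - b) ^ 2 + 3 * M) := by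
    refine wMean_mono hp fun x => ?_
    have e : stepTarget ρ R f x + -b = ρ x.1 + (1 - R) * (f x.2 - b) := by
      rw [stepTarget, ← hb]; ring
    rw [e]
    have h2 := hv0 x.2
    have h3 := hf x.2
    have h4 := hρ0 x.1
    have h5 := hρ1 x.1
    have h6 : (1 - R) * (f x.2 - b) ≤ M := by nlinarith
    have h7 : 0 ≤ (1 - R) * (f x.2 - b) := mul_nonneg (by linarith) h2
    have h8 : ((1 - R) * (f x.2 - b)) ^ 2 ≤ (1 - R) * (f x.2 - b) ^ 2 := by
      have : 0 ≤ (1 - R) * R * (f x.2 - b) ^ 2 :=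
        mul_nonneg (mul_nonneg (by linarith) hR) (sq_nonneg _)
      nlinarith
    nlinarith
  rw [wMean_add, wMean_mul_left, wMean_const hp] at h1
  have h2 : y ^ 2 ≤ (wMean p (stepTarget ρ R f) - b) ^ 2 := pow_le_pow_left₀ hy0 hy 2
  rw [e1, wVar, e2]
  linarith

/-- The quadratic correction has variance at most `4 M ^ 2 τ ^ 2` times that of `(1 - R) (f - b)`,
hence a small multiple of the variance of the target up to the reward noise. The invariant may
therefore carry the correction without spoiling the variance bound. -/
theorem wVar_stepTarget_add_sq_le (hp : p ∈ stdSimplex ℝ (JointAction A × Fin S))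
    (hρ0 : ∀ a, 0 ≤ ρ a) (hρ1 : ∀ a, ρ a ≤ 1)
    (hf : ∀ s, f s - ⨅ s', f s' ≤ M) {τ d : ℝ} (hτ : (τ * M) ^ 2 ≤ 1 / 16) :
    wVar p (stepTarget ρ R fun s => f s + τ * (f s - ⨅ s', f s') ^ 2 + d) ≤
      3 * wVar p (stepTarget ρ R f) + 1 := by
  set b := ⨅ s', f s' with hb
  set g : Fin S → ℝ := fun s => f s + τ * (f s - b) ^ 2 + d with hg
  have hv0 : ∀ s, 0 ≤ f s - b := fun s => sub_nonneg.2 (iInf_le_apply f s)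
  have e1 : stepTarget ρ R g = fun x => (stepTarget ρ R f x + τ * (1 - R) * (f x.2 - b) ^ 2) +
      ((1 - R) * d + R * (⨅ s, g s) - R * b) := by
    funext x
    simp only [stepTarget, hg, ← hb]
    ring
  have e2 : (fun x : JointAction A × Fin S => (1 - R) * (f x.2 - b)) =
      fun x => (stepTarget ρ R f x + -1 * ρ x.1) + -b := by
    funext x
    simp only [stepTarget, ← hb]
    ring
  have h1 : wVar p (fun x => f x.2 - b) * (1 - R) ^ 2 ≤ 2 * wVar p (stepTarget ρ R f) + 2 := by
    rw [mul_comm, ← wVar_mul_left, e2, wVar_add_const hp]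
    refine (wVar_add_le hp _ _).trans ?_
    rw [wVar_mul_left]
    have := wVar_le_sq hp (f := fun x => ρ x.1) (fun x => hρ0 x.1) (fun x => hρ1 x.1)
    linarith
  have h2 := wVar_sq_le hp (f := fun x => f x.2 - b) (fun x => hv0 x.2) (fun x => hf x.2)
  have h3 : wVar p (fun x => τ * (1 - R) * (f x.2 - b) ^ 2) ≤
      1 / 4 * (2 * wVar p (stepTarget ρ R f) + 2) := by
    rw [wVar_mul_left]
    have h4 := wVar_nonneg hp (fun x => f x.2 - b)
    calc (τ * (1 - R)) ^ 2 * wVar p (fun x => (f x.2 - b) ^ 2)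
        ≤ (τ * (1 - R)) ^ 2 * (4 * M ^ 2 * wVar p fun x => f x.2 - b) :=
          mul_le_mul_of_nonneg_left h2 (sq_nonneg _)
      _ = (τ * M) ^ 2 * (4 * ((wVar p fun x => f x.2 - b) * (1 - R) ^ 2)) := by ring
      _ ≤ 1 / 16 * (4 * ((wVar p fun x => f x.2 - b) * (1 - R) ^ 2)) :=
          mul_le_mul_of_nonneg_right hτ (by positivity)
      _ ≤ 1 / 4 * (2 * wVar p (stepTarget ρ R f) + 2) := by linarith
  rw [e1, wVar_add_const hp]
  refine (wVar_add_le hp _ _).trans ?_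
  linarith

theorem stepTarget_sub_le [NeZero S] (hR : 0 ≤ R) (hR1 : R ≤ 1) (hρ0 : ∀ a, 0 ≤ ρ a) (hρ1 : ∀ a, ρ a ≤ 1)
    (hM : 1 ≤ M) {V : Fin S → ℝ} (hV : ∀ s s', V s - V s' ≤ 2 * M)
    (x x' : JointAction A × Fin S) : stepTarget ρ R V x - stepTarget ρ R V x' ≤ 3 * M := by
  have h1 := stepTarget_le hR1 hρ1 hV x
  have h2 := le_stepTarget hR1 hρ0 V x'
  nlinarith

theorem wMean_stepTarget_add_const (hp : p ∈ stdSimplex ℝ (JointAction A × Fin S))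
    (f : Fin S → ℝ) (τ d : ℝ) {b : ℝ} (hb : ⨅ s', f s' = b) :
    wMean p (stepTarget ρ R fun s => f s + τ * (f s - b) ^ 2 + d) =
      wMean p (stepTarget ρ R f) + τ * ((1 - R) * wMean p (fun x => (f x.2 - b) ^ 2)) +
        ((1 - R) * d + R * ((⨅ s, (f s + τ * (f s - b) ^ 2 + d)) - b)) := by
  have e1 : (stepTarget ρ R fun s => f s + τ * (f s - b) ^ 2 + d) =
      fun x => (stepTarget ρ R f x + (τ * (1 - R)) * (f x.2 - b) ^ 2) +
      ((1 - R) * d + R * ((⨅ s, (f s + τ * (f s - b) ^ 2 + d)) - b)) := by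
    funext x
    simp only [stepTarget, hb]
    ring
  rw [e1, wMean_add, wMean_add, wMean_mul_left, wMean_const hp]
  ring

theorem span_add_sq {τ d : ℝ} (hM : 0 ≤ M) (hτ : |τ| * M ≤ 1 / 4)
    (hf : ∀ s, f s - ⨅ s', f s' ≤ M) (s s' : Fin S) :
    (f s + τ * (f s - ⨅ s', f s') ^ 2 + d) - (f s' + τ * (f s' - ⨅ s', f s') ^ 2 + d) ≤
      2 * M := by
  set b := ⨅ s', f s'
  have h0 : ∀ s, 0 ≤ f s - b := fun s => sub_nonneg.2 (iInf_le_apply f s)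
  have h1 : ∀ s, |τ * (f s - b) ^ 2| ≤ 1 / 4 * M := by
    intro s
    rw [abs_mul, abs_of_nonneg (sq_nonneg (f s - b))]
    have h2 : (f s - b) ^ 2 ≤ M ^ 2 := pow_le_pow_left₀ (h0 s) (hf s) 2
    have h3 := abs_nonneg τ
    calc |τ| * (f s - b) ^ 2 ≤ |τ| * M ^ 2 := mul_le_mul_of_nonneg_left h2 h3
      _ = (|τ| * M) * M := by ring
      _ ≤ 1 / 4 * M := mul_le_mul_of_nonneg_right hτ hM
  have h2 := abs_le.1 (h1 s)
  have h3 := abs_le.1 (h1 s')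
  linarith [h0 s', hf s, h2.2, h3.1]

/-- Propagation of upper bounds through the mean-plus-variance operator. -/
theorem wMean_add_wVar_stepTarget_le [NeZero S]
    (hp : p ∈ stdSimplex ℝ (JointAction A × Fin S)) (hR : 0 ≤ R) (hR1 : R ≤ 1) (hρ0 : ∀ a, 0 ≤ ρ a) (hρ1 : ∀ a, ρ a ≤ 1) (hM : 1 ≤ M)
    (hf : ∀ s, f s - ⨅ s', f s' ≤ M) {y : ℝ} (hy0 : 0 ≤ y)
    (hy : y ≤ wMean p (stepTarget ρ R f) - ⨅ s', f s') {l d : ℝ} (hl0 : 0 ≤ l)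
    (hl : 12 * (l * M) ≤ 1) {V : Fin S → ℝ} (hV : ∀ s s', V s - V s' ≤ 2 * M)
    (hVU : ∀ s, V s ≤ f s - 3 * l * (f s - ⨅ s', f s') ^ 2 + d) :
    wMean p (stepTarget ρ R V) + l * wVar p (stepTarget ρ R V) ≤
      wMean p (stepTarget ρ R f) - 3 * l * y ^ 2 + d + (9 * (l * M) + l) := by
  obtain ⟨b, hb⟩ : ∃ b, ⨅ s', f s' = b := ⟨_, rfl⟩
  have hlM : 0 ≤ l * M := mul_nonneg hl0 (by linarith)
  have hτ : |-(3 * l)| * M ≤ 1 / 4 := by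
    rw [abs_neg, abs_of_nonneg (by positivity)]
    linarith
  have hτ2 : (-(3 * l) * M) ^ 2 ≤ 1 / 16 := by
    have : (-(3 * l) * M) ^ 2 = 9 * (l * M) ^ 2 := by ring
    rw [this]
    nlinarith
  have hkey := sq_add_wVar_le hp hR hR1 hρ0 hρ1 hM hf hy0 hy
  have hvar := wVar_stepTarget_add_sq_le (R := R) hp hρ0 hρ1 hf (d := d) hτ2
  have hspan := span_add_sq (f := f) (d := d) (by linarith) hτ hf
  have hmean := wMean_stepTarget_add_const (ρ := ρ) (R := R) hp f (-(3 * l)) d hb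
  rw [hb] at hkey hvar hspan hVU
  set U : Fin S → ℝ := fun s => f s + -(3 * l) * (f s - b) ^ 2 + d with hU
  have hVU' : ∀ s, V s ≤ U s := fun s => (hVU s).trans (le_of_eq (by simp only [hU]; ring))
  have hmono := stepTarget_mono (ρ := ρ) hR hR1 hVU'
  have habs := abs_wVar_sub_le hp hmono (stepTarget_sub_le hR hR1 hρ0 hρ1 hM hV)
    (stepTarget_sub_le hR hR1 hρ0 hρ1 hM hspan)
  have h1 := (abs_le.1 habs).1
  have h2 := wMean_mono hp hmono
  -- At a minimiser of `f` the quadratic correction vanishes, so the contaminated part of the target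
  -- sees only the shift `d`.
  have hinf : ⨅ s, U s ≤ b + d := by
    obtain ⟨s₀, hs₀⟩ := exists_eq_ciInf_of_finite (f := f)
    refine (iInf_le_apply U s₀).trans (le_of_eq ?_)
    simp only [hU, hs₀, hb]
    ring
  have h3 : l * (wVar p (stepTarget ρ R V) - wVar p (stepTarget ρ R U)) ≤
      l * (2 * (3 * M) * (wMean p (stepTarget ρ R U) - wMean p (stepTarget ρ R V))) :=
    mul_le_mul_of_nonneg_left (by linarith) hl0
  -- Since `6 l M ≤ 1`, the change of variance when `V` is replaced by `U` is absorbed by the change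
  -- of mean: mean plus `l` times variance is monotone in this range.
  have h4 : l * (2 * (3 * M) * (wMean p (stepTarget ρ R U) - wMean p (stepTarget ρ R V))) ≤
      wMean p (stepTarget ρ R U) - wMean p (stepTarget ρ R V) := by
    have : 0 ≤ wMean p (stepTarget ρ R U) - wMean p (stepTarget ρ R V) := by linarith
    nlinarith
  have h5 := mul_le_mul_of_nonneg_left hvar hl0
  -- The coefficient `3 l` of the correction matches the factor `3` in `hvar`: the variance of `U`
  -- costs `3 l` times the variance for `f`, and `3 l` times the total variance inequality trades
  -- this for `-3 l y ^ 2` plus `9 l M`.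
  have h6 := mul_le_mul_of_nonneg_left hkey (by positivity : 0 ≤ 3 * l)
  have h7 : R * ((⨅ s, U s) - b) ≤ R * d := mul_le_mul_of_nonneg_left (by linarith) hR
  change wMean p (stepTarget ρ R U) = _ + ((1 - R) * d + R * ((⨅ s, U s) - b)) at hmean
  linarith

/-- Propagation of lower bounds through the mean-minus-variance operator. -/
theorem le_wMean_sub_wVar_stepTarget [NeZero S]
    (hp : p ∈ stdSimplex ℝ (JointAction A × Fin S)) (hR : 0 ≤ R) (hR1 : R ≤ 1) (hρ0 : ∀ a, 0 ≤ ρ a) (hρ1 : ∀ a, ρ a ≤ 1) (hM : 1 ≤ M)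
    (hf : ∀ s, f s - ⨅ s', f s' ≤ M) {y : ℝ} (hy0 : 0 ≤ y)
    (hy : y ≤ wMean p (stepTarget ρ R f) - ⨅ s', f s') {l d : ℝ} (hl0 : 0 ≤ l)
    (hl : 12 * (l * M) ≤ 1) {V : Fin S → ℝ} (hV : ∀ s s', V s - V s' ≤ 2 * M)
    (hVU : ∀ s, f s + 3 * l * (f s - ⨅ s', f s') ^ 2 - d ≤ V s) :
    wMean p (stepTarget ρ R f) + 3 * l * y ^ 2 - d - (9 * (l * M) + l) ≤
      wMean p (stepTarget ρ R V) - l * wVar p (stepTarget ρ R V) := by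
  obtain ⟨b, hb⟩ : ∃ b, ⨅ s', f s' = b := ⟨_, rfl⟩
  have hlM : 0 ≤ l * M := mul_nonneg hl0 (by linarith)
  have hτ : |3 * l| * M ≤ 1 / 4 := by
    rw [abs_of_nonneg (by positivity)]
    linarith
  have hτ2 : (3 * l * M) ^ 2 ≤ 1 / 16 := by
    have : (3 * l * M) ^ 2 = 9 * (l * M) ^ 2 := by ring
    rw [this]
    nlinarith
  have hkey := sq_add_wVar_le hp hR hR1 hρ0 hρ1 hM hf hy0 hy
  have hvar := wVar_stepTarget_add_sq_le (R := R) hp hρ0 hρ1 hf (d := -d) hτ2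
  have hspan := span_add_sq (f := f) (d := -d) (by linarith) hτ hf
  have hmean := wMean_stepTarget_add_const (ρ := ρ) (R := R) hp f (3 * l) (-d) hb
  rw [hb] at hkey hvar hspan hVU
  set U : Fin S → ℝ := fun s => f s + 3 * l * (f s - b) ^ 2 + -d with hU
  have hVU' : ∀ s, U s ≤ V s := fun s => (le_of_eq (by simp only [hU]; ring)).trans (hVU s)
  have hmono := stepTarget_mono (ρ := ρ) hR hR1 hVU'
  have habs := abs_wVar_sub_le hp hmono (stepTarget_sub_le hR hR1 hρ0 hρ1 hM hspan)
    (stepTarget_sub_le hR hR1 hρ0 hρ1 hM hV)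
  have h1 := (abs_le.1 habs).2
  have h2 := wMean_mono hp hmono
  -- Here the correction is added, so it can only raise the minimum.
  have hinf : b - d ≤ ⨅ s, U s := by
    refine le_ciInf fun s => ?_
    have h3 := iInf_le_apply f s
    rw [hb] at h3
    have : 0 ≤ 3 * l * (f s - b) ^ 2 := by positivity
    simp only [hU]
    linarith
  have h3 : l * (wVar p (stepTarget ρ R V) - wVar p (stepTarget ρ R U)) ≤
      l * (2 * (3 * M) * (wMean p (stepTarget ρ R V) - wMean p (stepTarget ρ R U))) :=
    mul_le_mul_of_nonneg_left (by linarith) hl0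
  have h4 : l * (2 * (3 * M) * (wMean p (stepTarget ρ R V) - wMean p (stepTarget ρ R U))) ≤
      wMean p (stepTarget ρ R V) - wMean p (stepTarget ρ R U) := by
    have : 0 ≤ wMean p (stepTarget ρ R V) - wMean p (stepTarget ρ R U) := by linarith
    nlinarith
  have h5 := mul_le_mul_of_nonneg_left hvar hl0
  have h6 := mul_le_mul_of_nonneg_left hkey (by positivity : 0 ≤ 3 * l)
  have h7 : R * (-d) ≤ R * ((⨅ s, U s) - b) := mul_le_mul_of_nonneg_left (by linarith) hR
  change wMean p (stepTarget ρ R U) = _ + ((1 - R) * -d + R * ((⨅ s, U s) - b)) at hmean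
  linarith

end OneStep

/-! ### Backward induction -/

section Backward

variable {m S H : ℕ} {A : Fin m → ℕ}

/-- The weights are a joint policy on the last `n` steps. -/
def IsPolicyOnLast (n : ℕ) (π : JointWeights S H A) : Prop :=
  ∀ t : Fin H, H - n ≤ t → ∀ s, π t s ∈ stdSimplex ℝ (JointAction A)

theorem IsPolicyOnLast.pred {n : ℕ} {π : JointWeights S H A} (h : IsPolicyOnLast (n + 1) π) :
    IsPolicyOnLast n π := fun t ht => h t (by omega)

theorem IsPolicyOnLast.deviate {n : ℕ} {π : JointWeights S H A} (h : IsPolicyOnLast n π)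
    (i : Fin m) (π' : PlayerPolicy S H A i) : IsPolicyOnLast n (deviate i π' π) :=
  fun t ht s => deviate_mem_stdSimplex i π' (h t ht s)

theorem robustDP_le {R : ℝ} (hR : 0 ≤ R) (hR1 : R ≤ 1) (P0 : TransKernel S H A)
    {r : Fin H → Fin S → JointAction A → ℝ} (hr : ∀ h s a, r h s a ≤ 1)
    {π : JointWeights S H A} {n : ℕ} (hn : n ≤ H) (hπ : IsPolicyOnLast n π) (s : Fin S) :
    robustDP R P0 r π n hn s ≤ n := by
  induction n generalizing s with
  | zero => simp [robustDP]
  | succ n ih =>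
    refine wMean_le (stepWeight_mem_stdSimplex (hπ _ le_rfl s) _) fun x => ?_
    have hV := ih (Nat.le_of_succ_le hn) hπ.pred
    have h1 := mul_le_mul_of_nonneg_left (hV x.2) (sub_nonneg.2 hR1)
    have h2 := mul_le_mul_of_nonneg_left ((iInf_le_apply _ x.2).trans (hV x.2)) hR
    have h3 := hr (stepIdx n hn) s x.1
    rw [stepTarget]
    push_cast
    linarith

variable [NeZero S]

theorem robustDP_nonneg {R : ℝ} (hR1 : R ≤ 1) (P0 : TransKernel S H A)
    {r : Fin H → Fin S → JointAction A → ℝ} (hr : ∀ h s a, 0 ≤ r h s a)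
    {π : JointWeights S H A} {n : ℕ} (hn : n ≤ H) (hπ : IsPolicyOnLast n π) (s : Fin S) :
    0 ≤ robustDP R P0 r π n hn s := by
  induction n generalizing s with
  | zero => exact le_rfl
  | succ n ih =>
    refine le_wMean (stepWeight_mem_stdSimplex (hπ _ le_rfl s) _) fun x => ?_
    exact (le_ciInf (ih (Nat.le_of_succ_le hn) hπ.pred)).trans
      (le_stepTarget hR1 (hr _ s) _ x)

/-- Rewards are nonnegative, so one more step cannot lower the minimum. The excess at the new step
is thus at most the new value minus the old minimum, as required of `y` in `sq_add_wVar_le`. -/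
theorem iInf_robustDP_le_succ {R : ℝ} (hR1 : R ≤ 1) (P0 : TransKernel S H A)
    {r : Fin H → Fin S → JointAction A → ℝ} (hr : ∀ h s a, 0 ≤ r h s a)
    {π : JointWeights S H A} {n : ℕ} (hn : n + 1 ≤ H) (hπ : IsPolicyOnLast (n + 1) π) :
    ⨅ s, robustDP R P0 r π n (Nat.le_of_succ_le hn) s ≤ ⨅ s, robustDP R P0 r π (n + 1) hn s :=
  le_ciInf fun s => le_wMean (stepWeight_mem_stdSimplex (hπ _ le_rfl s) _)
    fun x => le_stepTarget hR1 (hr _ s) _ x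

/-- If `R * M = 1`, then `M` is the fixed point of `B ↦ 1 + (1 - R) * B`, the map governing spans
under contamination. If `M = H`, the values themselves lie in `[0, H]`. -/
theorem robustDP_span_le {R M : ℝ} (hR : 0 ≤ R) (hR1 : R ≤ 1) (hM : 0 ≤ M)
    (hMR : M = H ∨ R * M = 1)
    (P0 : TransKernel S H A) {r : Fin H → Fin S → JointAction A → ℝ}
    (hr0 : ∀ h s a, 0 ≤ r h s a) (hr1 : ∀ h s a, r h s a ≤ 1)
    {π : JointWeights S H A} {n : ℕ} (hn : n ≤ H) (hπ : IsPolicyOnLast n π) (s : Fin S) :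
    robustDP R P0 r π n hn s - ⨅ s', robustDP R P0 r π n hn s' ≤ M := by
  rcases hMR with rfl | hMR
  · have h1 := robustDP_le hR hR1 P0 hr1 hn hπ s
    have h2 : 0 ≤ ⨅ s', robustDP R P0 r π n hn s' :=
      le_ciInf fun s' => robustDP_nonneg hR1 P0 hr0 hn hπ s'
    have h3 : (n : ℝ) ≤ H := by exact_mod_cast hn
    linarith
  · induction n generalizing s with
    | zero => simpa [robustDP] using hM
    | succ n ih =>
      have hspan : ∀ s s', robustDP R P0 r π n (Nat.le_of_succ_le hn) s -
          robustDP R P0 r π n (Nat.le_of_succ_le hn) s' ≤ M := fun s s' => by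
        have h1 := ih (Nat.le_of_succ_le hn) hπ.pred s
        have h2 := iInf_le_apply (robustDP R P0 r π n (Nat.le_of_succ_le hn)) s'
        linarith
      have h1 : robustDP R P0 r π (n + 1) hn s ≤ 1 + (1 - R) * M +
          ⨅ s', robustDP R P0 r π n (Nat.le_of_succ_le hn) s' :=
        wMean_le (stepWeight_mem_stdSimplex (hπ _ le_rfl s) _)
          fun x => stepTarget_le hR1 (hr1 _ s) hspan x
      have h2 := iInf_robustDP_le_succ hR1 P0 hr0 hn hπ
      linarith

/-- The distribution on joint actions when player `i` plays `σ` against the marginal of `μ`. -/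
def devWeight (i : Fin m) (σ : stdSimplex ℝ (Fin (A i))) (μ : JointAction A → ℝ) :
    JointAction A → ℝ :=
  fun a => σ (a i) * ∑ b : Fin (A i), μ (Function.update a i b)

/-- Range of value estimates for the last `n` steps. -/
structure ValueRange (M : ℝ) (n : ℕ) (V : Fin m → Fin S → ℝ) : Prop where
  nonneg : ∀ i s, 0 ≤ V i s
  le : ∀ i s, V i s ≤ n
  span : ∀ i s s', V i s - V i s' ≤ 2 * M

/-- The new value estimates `V'` are within mean-variance bounds of one step of dynamic
programming applied to `V`, for the policy `μ` from above and for all deviations from below. -/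
structure StepCert (G : Game m S H A) (R l e : ℝ) (n : ℕ) (hn : n + 1 ≤ H)
    (V V' : Fin m → Fin S → ℝ) (μ : Fin S → JointAction A → ℝ) (x : ℝ) : Prop where
  upper : ∀ i s, V' i s ≤
    wMean (stepWeight (μ s) (G.P0 (stepIdx n hn) s)) (stepTarget (G.r i (stepIdx n hn) s) R (V i)) +
    l * wVar (stepWeight (μ s) (G.P0 (stepIdx n hn) s))
      (stepTarget (G.r i (stepIdx n hn) s) R (V i)) + e + x
  lower : ∀ i s (σ : stdSimplex ℝ (Fin (A i))),
    min (wMean (stepWeight (devWeight i σ (μ s)) (G.P0 (stepIdx n hn) s))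
        (stepTarget (G.r i (stepIdx n hn) s) R (V i)) -
      l * wVar (stepWeight (devWeight i σ (μ s)) (G.P0 (stepIdx n hn) s))
        (stepTarget (G.r i (stepIdx n hn) s) R (V i))) (n + 1) - e - x ≤ V' i s

/-- The deviation of a value from its minimum. -/
def excess (f : Fin S → ℝ) (s : Fin S) : ℝ := f s - ⨅ s', f s'

/-- Invariant of the backward recursion after `n` steps, with accumulated slack `x`. -/
structure BackwardInv (G : Game m S H A) (R M l e : ℝ) (n : ℕ) (hn : n ≤ H)
    (V : Fin m → Fin S → ℝ) (π : JointWeights S H A) (x : ℝ) : Prop where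
  policy : IsPolicyOnLast n π
  range : ValueRange M n V
  upper : ∀ i s, V i s ≤ robustDP R G.P0 (G.r i) π n hn s -
    3 * l * excess (robustDP R G.P0 (G.r i) π n hn) s ^ 2 + (n * e + x)
  lower : ∀ i (π' : PlayerPolicy S H A i) s,
    robustDP R G.P0 (G.r i) (deviate i π' π) n hn s +
      3 * l * excess (robustDP R G.P0 (G.r i) (deviate i π' π) n hn) s ^ 2 - (n * e + x) ≤ V i s

/-- The invariant for `V` is fed into the mean-variance bounds of the certificate. The variance is
paid by the quadratic correction, so that a step adds only `e'` to the error and the slack `y` of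
its certificate. -/
theorem BackwardInv.step {G : Game m S H A} {R M l e e' : ℝ} (hR : 0 ≤ R) (hR1 : R ≤ 1)
    (hM : 1 ≤ M) (hMR : M = H ∨ R * M = 1) (hl0 : 0 ≤ l) (hl : 12 * (l * M) ≤ 1) (he : 0 ≤ e)
    (he' : e' = 9 * (l * M) + l + e) {n : ℕ} (hn : n + 1 ≤ H) {V V' : Fin m → Fin S → ℝ}
    {π : JointWeights S H A} {μ : Fin S → JointAction A → ℝ} {x y : ℝ} (hx : 0 ≤ x)
    (h : BackwardInv G R M l e' n (Nat.le_of_succ_le hn) V π x)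
    (hcert : StepCert G R l e n hn V V' μ y) (hV' : ValueRange M (n + 1) V')
    (hμ : ∀ s, μ s ∈ stdSimplex ℝ (JointAction A)) :
    BackwardInv G R M l e' (n + 1) hn V' (Function.update π (stepIdx n hn) μ) (x + y) := by
  set t₀ : Fin H := stepIdx n hn with ht₀
  have hlM : 0 ≤ l * M := mul_nonneg hl0 (by linarith)
  have hne : ∀ t : Fin H, H - n ≤ t → t ≠ t₀ := by
    intro t ht heq
    rw [heq, ht₀] at ht
    simp only at ht
    omega
  have hpol : IsPolicyOnLast (n + 1) (Function.update π t₀ μ) := by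
    intro t ht s
    by_cases h1 : t = t₀
    · rw [h1, Function.update_self]
      exact hμ s
    · rw [Function.update_of_ne h1]
      refine h.policy t ?_ s
      have : (t : ℕ) ≠ H - (n + 1) := fun h2 => h1 (Fin.ext h2)
      omega
  refine ⟨hpol, hV', fun i s => ?_, fun i π' s => ?_⟩
  · have hcongr : robustDP R G.P0 (G.r i) (Function.update π t₀ μ) n (Nat.le_of_succ_le hn) =
        robustDP R G.P0 (G.r i) π n (Nat.le_of_succ_le hn) :=
      robustDP_congr R G.P0 (G.r i) n _ fun t ht => Function.update_of_ne (hne t ht) _ _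
    have hup := h.upper i
    rw [← hcongr] at hup
    set f := robustDP R G.P0 (G.r i) (Function.update π t₀ μ) n (Nat.le_of_succ_le hn) with hf
    set f' := robustDP R G.P0 (G.r i) (Function.update π t₀ μ) (n + 1) hn with hf'
    have hmean : f' s = wMean (stepWeight (μ s) (G.P0 t₀ s)) (stepTarget (G.r i t₀ s) R f) := by
      rw [hf', robustDP, ← ht₀, Function.update_self]
    have h1 := wMean_add_wVar_stepTarget_le
      (stepWeight_mem_stdSimplex (hμ s) (G.P0 t₀ s)) hR hR1 (G.r_nonneg i t₀ s)
      (G.r_le_one i t₀ s) hM (f := f)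
      (robustDP_span_le hR hR1 (by linarith) hMR G.P0 (G.r_nonneg i) (G.r_le_one i) _ hpol.pred)
      (y := excess f' s) (sub_nonneg.2 (iInf_le_apply f' s))
      (by
        rw [← hmean, excess]
        linarith [iInf_robustDP_le_succ hR1 G.P0 (G.r_nonneg i) hn hpol])
      hl0 hl (h.range.span i) hup
    have h2 := hcert.upper i s
    rw [← hmean] at h1
    push_cast
    rw [he'] at h1 ⊢
    linarith
  · have hdev : ∀ t : Fin H, H - n ≤ t →
        deviate i π' (Function.update π t₀ μ) t = deviate i π' π t := by
      intro t ht
      funext s a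
      simp only [deviate]
      rw [Function.update_of_ne (hne t ht)]
    have hcongr : robustDP R G.P0 (G.r i) (deviate i π' (Function.update π t₀ μ)) n
        (Nat.le_of_succ_le hn) =
        robustDP R G.P0 (G.r i) (deviate i π' π) n (Nat.le_of_succ_le hn) :=
      robustDP_congr R G.P0 (G.r i) n _ hdev
    have hlow := h.lower i π'
    rw [← hcongr] at hlow
    have hpol' := hpol.deviate i π'
    have hd : deviate i π' (Function.update π t₀ μ) t₀ s = devWeight i (π' t₀ s) (μ s) := by
      funext a
      simp only [deviate, devWeight, Function.update_self]
    set f := robustDP R G.P0 (G.r i) (deviate i π' (Function.update π t₀ μ)) n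
      (Nat.le_of_succ_le hn) with hf
    set f' := robustDP R G.P0 (G.r i) (deviate i π' (Function.update π t₀ μ)) (n + 1) hn with hf'
    have hmean : f' s = wMean (stepWeight (devWeight i (π' t₀ s) (μ s)) (G.P0 t₀ s))
        (stepTarget (G.r i t₀ s) R f) := by
      rw [← hd]
      rfl
    have hspan' : excess f' s ≤ M := robustDP_span_le hR hR1 (by linarith) hMR G.P0
      (G.r_nonneg i) (G.r_le_one i) hn hpol' s
    have hex0 : 0 ≤ excess f' s := sub_nonneg.2 (iInf_le_apply f' s)
    have hmem : devWeight i (π' t₀ s) (μ s) ∈ stdSimplex ℝ (JointAction A) := by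
      rw [← hd]
      exact hpol' t₀ le_rfl s
    have h1 := le_wMean_sub_wVar_stepTarget
      (stepWeight_mem_stdSimplex hmem (G.P0 t₀ s)) hR hR1 (G.r_nonneg i t₀ s)
      (G.r_le_one i t₀ s) hM (f := f)
      (robustDP_span_le hR hR1 (by linarith) hMR G.P0 (G.r_nonneg i) (G.r_le_one i) _ hpol'.pred)
      (y := excess f' s) hex0
      (by
        rw [← hmean, excess]
        linarith [iInf_robustDP_le_succ hR1 G.P0 (G.r_nonneg i) hn hpol'])
      hl0 hl (h.range.span i) hlow
    rw [← hmean] at h1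
    have h2 := hcert.lower i s (π' t₀ s)
    have hle : f' s ≤ n + 1 := by
      have := robustDP_le hR hR1 G.P0 (G.r_le_one i) hn hpol' s
      push_cast at this
      exact this
    have hf'0 : 0 ≤ ⨅ s', f' s' :=
      le_ciInf fun s' => robustDP_nonneg hR1 G.P0 (G.r_nonneg i) hn hpol' s'
    -- This serves the case where the estimate is truncated at `n + 1`. The value `f' s` is below
    -- the cap anyway, and its correction is at most `3 l M (n + 1)`, which fits into the error `(n
    -- + 1) * e'` accumulated so far.
    have hsq : 3 * l * excess f' s ^ 2 ≤ 3 * (l * M) * (n + 1) := by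
      have h3 : excess f' s ≤ n + 1 := by rw [excess]; linarith
      have h4 : excess f' s ^ 2 ≤ M * (n + 1) := by
        rw [sq]
        exact mul_le_mul hspan' h3 hex0 (by linarith)
      calc 3 * l * excess f' s ^ 2 ≤ 3 * l * (M * (n + 1)) :=
            mul_le_mul_of_nonneg_left h4 (by positivity)
        _ = _ := by ring
    push_cast
    have hn0 : (0 : ℝ) ≤ n := Nat.cast_nonneg n
    rcases min_choice (wMean (stepWeight (devWeight i (π' t₀ s) (μ s)) (G.P0 t₀ s))
        (stepTarget (G.r i t₀ s) R (V i)) -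
      l * wVar (stepWeight (devWeight i (π' t₀ s) (μ s)) (G.P0 t₀ s))
        (stepTarget (G.r i t₀ s) R (V i))) ((n : ℝ) + 1) with h3 | h3
    · rw [h3] at h2
      rw [he'] at h1 ⊢
      linarith
    · rw [h3] at h2
      have h5 : 0 ≤ (n : ℝ) * (9 * (l * M) + l + e) := by positivity
      have h6 : 3 * (l * M) * (n + 1) ≤ (n + 1) * (9 * (l * M) + l) := by nlinarith
      have h7 : 0 ≤ (n : ℝ) * e := by positivity
      rw [he']
      nlinarith

/-- Every deviation lies below `V`, and `V` below the policy itself, each up to `H * e + x`; the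
corrections have the favourable sign and are dropped. -/
theorem BackwardInv.gap_le {G : Game m S H A} {R M l e : ℝ} (hR : 0 ≤ R) (hR1 : R ≤ 1)
    (hl0 : 0 ≤ l) {V : Fin m → Fin S → ℝ} {π : JointWeights S H A} {x ε : ℝ}
    (h : BackwardInv G R M l e H le_rfl V π x) (hε : 2 * (H * e + x) ≤ ε) (hε0 : 0 ≤ ε) :
    IsRobustCCE G R ε π := by
  have hπ : IsJointPolicy π := fun t s => h.policy t (by simp) s
  refine ⟨hπ, Real.iSup_le (fun s => Real.iSup_le (fun i => ?_) hε0) hε0⟩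
  have hdp : robustDP R G.P0 (G.r i) π H le_rfl s = robustValue G R i π s :=
    (robustValue_eq G hR hR1 i hπ s).symm
  have h0 : 0 ≤ robustValue G R i π s := by
    rw [← hdp]
    exact robustDP_nonneg hR1 G.P0 (G.r_nonneg i) le_rfl h.policy s
  rw [sub_le_iff_le_add]
  refine Real.iSup_le (fun π' => ?_) (by linarith)
  have hdev : IsJointPolicy (deviate i π' π) := fun t s => deviate_mem_stdSimplex i π' (hπ t s)
  rw [robustValue_eq G hR hR1 i hdev, ← hdp]
  have h1 := h.upper i s
  have h2 := h.lower i π' s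
  have h3 : 0 ≤ 3 * l * excess (robustDP R G.P0 (G.r i) π H le_rfl) s ^ 2 := by positivity
  have h4 : 0 ≤ 3 * l * excess (robustDP R G.P0 (G.r i) (deviate i π' π) H le_rfl) s ^ 2 := by
    positivity
  linarith

end Backward

/-! ### Expectations under probability mass functions -/

section Expectation

variable {α β : Type}

/-- The expectation of a function with values in `[0, ∞]`. -/
def pmfMean (p : PMF α) (g : α → ENNReal) : ENNReal := ∑' a, p a * g a

theorem pmfMean_mono (p : PMF α) {g g' : α → ENNReal} (h : ∀ a, g a ≤ g' a) :
    pmfMean p g ≤ pmfMean p g' :=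
  ENNReal.tsum_le_tsum fun a => mul_le_mul_right (h a) _

theorem pmfMean_mono_support (p : PMF α) {g g' : α → ENNReal} (h : ∀ a ∈ p.support, g a ≤ g' a) :
    pmfMean p g ≤ pmfMean p g' := by
  refine ENNReal.tsum_le_tsum fun a => ?_
  by_cases ha : p a = 0
  · simp [ha]
  · exact mul_le_mul_right (h a ((p.mem_support_iff a).2 ha)) _

theorem pmfMean_const (p : PMF α) (c : ENNReal) : pmfMean p (fun _ => c) = c := by
  rw [pmfMean, ENNReal.tsum_mul_right, p.tsum_coe, one_mul]

theorem pmfMean_add (p : PMF α) (g g' : α → ENNReal) :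
    pmfMean p (fun a => g a + g' a) = pmfMean p g + pmfMean p g' := by
  simp only [pmfMean, mul_add, ENNReal.tsum_add]

theorem pmfMean_sum {ι : Type} (s : Finset ι) (p : PMF α) (g : ι → α → ENNReal) :
    pmfMean p (fun a => ∑ i ∈ s, g i a) = ∑ i ∈ s, pmfMean p (g i) := by
  classical
  induction s using Finset.induction_on with
  | empty => simp [pmfMean]
  | insert i s hi ih => simp only [Finset.sum_insert hi, pmfMean_add, ih]

theorem pmfMean_mul_left (p : PMF α) (c : ENNReal) (g : α → ENNReal) :
    pmfMean p (fun a => c * g a) = c * pmfMean p g := by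
  rw [pmfMean, pmfMean, ← ENNReal.tsum_mul_left]
  exact tsum_congr fun a => by ring

theorem pmfMean_pure (a : α) (g : α → ENNReal) : pmfMean (PMF.pure a) g = g a := by
  rw [pmfMean, tsum_eq_single a]
  · simp
  · intro b hb
    simp [hb]

theorem pmfMean_bind (p : PMF α) (q : α → PMF β) (g : β → ENNReal) :
    pmfMean (p.bind q) g = pmfMean p fun a => pmfMean (q a) g := by
  simp only [pmfMean, PMF.bind_apply, ← ENNReal.tsum_mul_right, ← ENNReal.tsum_mul_left]
  rw [ENNReal.tsum_comm]
  exact tsum_congr fun a => tsum_congr fun b => by ring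

theorem pmfMean_map (p : PMF α) (f : α → β) (g : β → ENNReal) :
    pmfMean (p.map f) g = pmfMean p fun a => g (f a) := by
  rw [PMF.map, pmfMean_bind]
  exact congrArg _ (funext fun a => pmfMean_pure _ _)

theorem toOuterMeasure_eq_pmfMean (p : PMF α) (s : Set α) :
    p.toOuterMeasure s = pmfMean p (s.indicator 1) := by
  rw [PMF.toOuterMeasure_apply, pmfMean]
  refine tsum_congr fun a => ?_
  by_cases h : a ∈ s <;> simp [h]

/-- No measurability enters, although the states of the recursion form an uncountable type: the
outer measure of a `PMF` is a sum over points. -/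
theorem toOuterMeasure_add_compl (p : PMF α) (s : Set α) :
    p.toOuterMeasure s + p.toOuterMeasure sᶜ = 1 := by
  rw [toOuterMeasure_eq_pmfMean, toOuterMeasure_eq_pmfMean, ← pmfMean_add, ← pmfMean_const p 1]
  congr 1
  funext a
  by_cases h : a ∈ s <;> simp [h]

variable [Fintype α]

/-- The real weights of a probability mass function. -/
def pmfWeight (p : PMF α) (a : α) : ℝ := (p a).toReal

theorem pmfWeight_mem_stdSimplex (p : PMF α) : pmfWeight p ∈ stdSimplex ℝ α := by
  refine ⟨fun a => ENNReal.toReal_nonneg, ?_⟩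
  have h := p.tsum_coe
  rw [tsum_fintype] at h
  simp only [pmfWeight]
  rw [← ENNReal.toReal_sum fun a _ => p.apply_ne_top a, h, ENNReal.toReal_one]

theorem pmfMean_ofReal (p : PMF α) {g : α → ℝ} (hg : ∀ a, 0 ≤ g a) :
    pmfMean p (fun a => ENNReal.ofReal (g a)) = ENNReal.ofReal (wMean (pmfWeight p) g) := by
  rw [pmfMean, tsum_fintype, wMean, ENNReal.ofReal_sum_of_nonneg fun a _ =>
    mul_nonneg ((pmfWeight_mem_stdSimplex p).1 a) (hg a)]
  refine Finset.sum_congr rfl fun a _ => ?_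
  rw [ENNReal.ofReal_mul ((pmfWeight_mem_stdSimplex p).1 a), pmfWeight,
    ENNReal.ofReal_toReal (p.apply_ne_top a)]

theorem wMean_pmfWeight_map [Fintype β] (p : PMF α) (f : α → β) (g : β → ℝ) :
    wMean (pmfWeight (p.map f)) g = wMean (pmfWeight p) fun a => g (f a) := by
  classical
  have h : ∀ b, pmfWeight (p.map f) b = ∑ a, if b = f a then pmfWeight p a else 0 := by
    intro b
    rw [pmfWeight, PMF.map_apply, tsum_fintype, ENNReal.toReal_sum]
    · refine Finset.sum_congr rfl fun a _ => ?_
      split_ifs <;> simp [pmfWeight]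
    · intro a _
      split_ifs
      · exact p.apply_ne_top a
      · simp
  simp only [wMean, h, Finset.sum_mul, ite_mul, zero_mul]
  rw [Finset.sum_comm]
  refine Finset.sum_congr rfl fun a _ => ?_
  simp

theorem indepPMF_map_eval {ι : Type} [Fintype ι] [DecidableEq ι] {γ : ι → Type}
    [∀ i, Fintype (γ i)] (p : ∀ i, PMF (γ i)) (i : ι) :
    (indepPMF p).map (fun x => x i) = p i := by
  classical
  ext b
  rw [PMF.map_apply, tsum_fintype]
  -- The event that coordinate `i` equals `b` is put into the `i`-th factor, so the sum over product
  -- points factorises and all other factors sum to `1`.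
  set q : ∀ j, γ j → ENNReal :=
    Function.update (fun j a => p j a) i (fun a => if b = a then p i a else 0) with hq
  have h1 : ∀ x : ∀ j, γ j, (if b = x i then indepPMF p x else 0) = ∏ j, q j (x j) := by
    intro x
    have e1 : indepPMF p x = ∏ j, p j (x j) := rfl
    rw [e1, ← Finset.mul_prod_erase _ _ (Finset.mem_univ i),
      ← Finset.mul_prod_erase _ (fun j => q j (x j)) (Finset.mem_univ i)]
    have e2 : ∏ j ∈ Finset.univ.erase i, q j (x j) = ∏ j ∈ Finset.univ.erase i, p j (x j) := by
      refine Finset.prod_congr rfl fun j hj => ?_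
      rw [hq, Function.update_of_ne (Finset.ne_of_mem_erase hj)]
    rw [e2, hq, Function.update_self]
    split_ifs <;> simp
  rw [Finset.sum_congr rfl fun x _ => h1 x]
  have h2 := Finset.prod_univ_sum (fun j => (Finset.univ : Finset (γ j))) q
  rw [Fintype.piFinset_univ] at h2
  rw [← h2, ← Finset.mul_prod_erase _ _ (Finset.mem_univ i), Finset.prod_eq_one, mul_one, hq,
    Function.update_self]
  · simp
  · intro j hj
    rw [hq, Function.update_of_ne (Finset.ne_of_mem_erase hj),
      ← tsum_fintype (L := .unconditional _)]
    exact (p j).tsum_coe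

end Expectation

/-! ### Product weights on joint actions -/

section ProductWeights

variable {m S H : ℕ} {A : Fin m → ℕ}

/-- Independent actions with laws `p j`. -/
def prodWeight (p : ∀ j, stdSimplex ℝ (Fin (A j))) (a : JointAction A) : ℝ := ∏ j, p j (a j)

/-- The point mass at an action. -/
def pointMass {n : ℕ} (b : Fin n) : stdSimplex ℝ (Fin n) :=
  ⟨Pi.single b 1, single_mem_stdSimplex ℝ b⟩

theorem pointMass_apply {n : ℕ} (b c : Fin n) : pointMass b c = if c = b then 1 else 0 := by
  change (Pi.single b 1 : Fin n → ℝ) c = _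
  rw [Pi.single_apply]

theorem prodWeight_mem_stdSimplex (p : ∀ j, stdSimplex ℝ (Fin (A j))) :
    prodWeight p ∈ stdSimplex ℝ (JointAction A) := by
  refine ⟨fun a => Finset.prod_nonneg fun j _ => (p j).2.1 _, ?_⟩
  have h := Finset.prod_univ_sum (fun j => (Finset.univ : Finset (Fin (A j)))) fun j b => p j b
  rw [Fintype.piFinset_univ] at h
  simp only [prodWeight]
  rw [← h]
  exact Finset.prod_eq_one fun j _ => stdSimplex.sum_eq_one _

theorem prodWeight_update (p : ∀ j, stdSimplex ℝ (Fin (A j))) (i : Fin m)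
    (σ : stdSimplex ℝ (Fin (A i))) (a : JointAction A) :
    prodWeight (Function.update p i σ) a = σ (a i) * ∏ j ∈ Finset.univ.erase i, p j (a j) := by
  rw [prodWeight, ← Finset.mul_prod_erase _ _ (Finset.mem_univ i), Function.update_self]
  congr 1
  refine Finset.prod_congr rfl fun j hj => ?_
  rw [Function.update_of_ne (Finset.ne_of_mem_erase hj)]

theorem prodWeight_update_eq_sum (p : ∀ j, stdSimplex ℝ (Fin (A j))) (i : Fin m)
    (σ : stdSimplex ℝ (Fin (A i))) (a : JointAction A) :
    prodWeight (Function.update p i σ) a =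
      ∑ b, σ b * prodWeight (Function.update p i (pointMass b)) a := by
  simp only [prodWeight_update, pointMass_apply, ite_mul, one_mul, zero_mul, mul_ite, mul_zero]
  simp

/-- Together with linearity in the weights (`devWeight_sum`), a deviation against the correlated
mixture becomes the mixture of the round-wise product laws with player `i` replaced by the fixed
`σ`. This is why external regret suffices for coarse correlated equilibria. -/
theorem devWeight_prodWeight (p : ∀ j, stdSimplex ℝ (Fin (A j))) (i : Fin m)
    (σ : stdSimplex ℝ (Fin (A i))) (a : JointAction A) :
    devWeight i σ (prodWeight p) a = prodWeight (Function.update p i σ) a := by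
  have h : ∀ b, prodWeight p (Function.update a i b) =
      p i b * ∏ j ∈ Finset.univ.erase i, p j (a j) := by
    intro b
    rw [prodWeight, ← Finset.mul_prod_erase _ _ (Finset.mem_univ i), Function.update_self]
    congr 1
    refine Finset.prod_congr rfl fun j hj => ?_
    rw [Function.update_of_ne (Finset.ne_of_mem_erase hj)]
  simp only [devWeight, h, ← Finset.sum_mul, stdSimplex.sum_eq_one, one_mul, prodWeight_update]

theorem devWeight_sum {ι : Type} [Fintype ι] (w : ι → ℝ) (μ : ι → JointAction A → ℝ) (i : Fin m)
    (σ : stdSimplex ℝ (Fin (A i))) (a : JointAction A) :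
    devWeight i σ (fun a => ∑ k, w k * μ k a) a = ∑ k, w k * devWeight i σ (μ k) a := by
  simp only [devWeight]
  rw [Finset.sum_comm, Finset.mul_sum]
  refine Finset.sum_congr rfl fun k _ => ?_
  rw [← Finset.mul_sum]
  ring

theorem stepWeight_sum {ι : Type} [Fintype ι] (w : ι → ℝ) (μ : ι → JointAction A → ℝ)
    (P : JointAction A → stdSimplex ℝ (Fin S)) :
    stepWeight (fun a => ∑ k, w k * μ k a) P = fun x => ∑ k, w k * stepWeight (μ k) P x := by
  funext x
  simp only [stepWeight, Finset.sum_mul, mul_assoc]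

theorem pmfWeight_sampleLaw (G : Game m S H A) (h : Fin H)
    (p : ∀ j, Fin S → stdSimplex ℝ (Fin (A j))) (i : Fin m) (s : Fin S) (b : Fin (A i)) :
    pmfWeight (sampleLaw G h p i s b) =
      stepWeight (prodWeight (Function.update (fun j => p j s) i (pointMass b))) (G.P0 h s) := by
  have hpure : (PMF.pure b : PMF (Fin (A i))) = simplexPMF (pointMass b) := by
    ext c
    change (PMF.pure b) c = ENNReal.ofReal (pointMass b c)
    rw [pointMass_apply, PMF.pure_apply]
    split_ifs <;> simp
  have hupd : Function.update (fun j => simplexPMF (p j s)) i (PMF.pure b) =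
      fun j => simplexPMF (Function.update (fun j => p j s) i (pointMass b) j) := by
    funext j
    rw [hpure, Function.apply_update (fun j => simplexPMF)]
  funext x
  obtain ⟨a, s'⟩ := x
  have h1 : sampleLaw G h p i s b (a, s') =
      indepPMF (fun j => simplexPMF (Function.update (fun j => p j s) i (pointMass b) j)) a *
        simplexPMF (G.P0 h s a) s' := by
    rw [sampleLaw, hupd, PMF.bind_apply, tsum_eq_single a]
    · congr 1
      rw [PMF.map_apply, tsum_eq_single s']
      · simp
      · intro s'' hs
        simp [hs.symm]
    · intro a' ha
      have : (PMF.map (fun s' => (a', s')) (simplexPMF (G.P0 h s a'))) (a, s') = 0 := by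
        rw [PMF.map_apply]
        simp [ha.symm]
      rw [this, mul_zero]
  have h2 : indepPMF (fun j => simplexPMF (Function.update (fun j => p j s) i (pointMass b) j)) a =
      ENNReal.ofReal (prodWeight (Function.update (fun j => p j s) i (pointMass b)) a) := by
    rw [prodWeight, ENNReal.ofReal_prod_of_nonneg fun j _ => stdSimplex.zero_le _ _]
    rfl
  have h3 : simplexPMF (G.P0 h s a) s' = ENNReal.ofReal (G.P0 h s a s') := rfl
  rw [pmfWeight, h1, h2, h3, ENNReal.toReal_mul, ENNReal.toReal_ofReal, ENNReal.toReal_ofReal]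
  · rfl
  · exact stdSimplex.zero_le _ _
  · exact (prodWeight_mem_stdSimplex _).1 a

/-- Only the marginal law of each table entry is needed: independence between the entries of one
round is never used in the concentration argument. -/
theorem wMean_drawLaw (G : Game m S H A) (h : Fin H)
    (p : ∀ j, Fin S → stdSimplex ℝ (Fin (A j))) (i : Fin m) (s : Fin S) (b : Fin (A i))
    (g : JointAction A × Fin S → ℝ) :
    wMean (pmfWeight (drawLaw G h p)) (fun d => g (d i s b)) =
      wMean (stepWeight (prodWeight (Function.update (fun j => p j s) i (pointMass b)))
        (G.P0 h s)) g := by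
  have e : (drawLaw G h p).map (fun d => d i s b) = sampleLaw G h p i s b := by
    have e1 : (fun d : Draw S A => d i s b) =
        (fun z => z b) ∘ (fun y : Fin S → Fin (A i) → JointAction A × Fin S => y s) ∘
          (fun d : Draw S A => d i) := rfl
    rw [e1, ← PMF.map_comp, ← PMF.map_comp, drawLaw]
    erw [indepPMF_map_eval, indepPMF_map_eval, indepPMF_map_eval]
  rw [← pmfWeight_sampleLaw, ← e, wMean_pmfWeight_map]

end ProductWeights

/-! ### The exponential supermartingale -/

section Supermartingale

variable {m S H : ℕ} {A : Fin m → ℕ} [∀ i, NeZero (A i)]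

/-- The policy of a round is a function of the earlier samples, so the factor of that round has
conditional mean at most `1` given the past; the product is a supermartingale. -/
theorem pmfMean_roundsLaw_prod_le (G : Game m S H A) (R : ℝ) (α η : ℕ → ℝ) (h : Fin H)
    (V : Fin m → Fin S → ℝ) (f : (k : ℕ) → (Fin k → Draw S A) → Draw S A → ENNReal)
    (K : ℕ)
    (hf : ∀ k < K, ∀ D, pmfMean (drawLaw G h (ftrlPolicy G R α η h V k D)) (f k D) ≤ 1) :
    pmfMean (roundsLaw G R α η h V K)
      (fun D => ∏ k : Fin K, f k (Fin.take k k.isLt.le D) (D k)) ≤ 1 := by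
  induction K with
  | zero => simp [roundsLaw, pmfMean_pure]
  | succ K ih =>
    rw [roundsLaw, pmfMean_bind]
    refine le_trans (pmfMean_mono _ fun D => ?_) (ih fun k hk => hf k (hk.trans K.lt_succ_self))
    rw [pmfMean_map]
    have e : ∀ d, ∏ k : Fin (K + 1), f k
        (Fin.take k k.isLt.le (Fin.snoc (α := fun _ => Draw S A) D d))
        (Fin.snoc (α := fun _ => Draw S A) D d k) =
        (∏ k : Fin K, f k (Fin.take k k.isLt.le D) (D k)) * f K D d := by
      intro d
      rw [Fin.prod_univ_castSucc]
      congr 1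
      · refine Finset.prod_congr rfl fun k _ => ?_
        rw [Fin.snoc_castSucc]
        congr 1
        funext j
        exact Fin.snoc_castSucc (α := fun _ => Draw S A) (n := K) d D
          (Fin.castLE k.isLt.le j)
      · rw [Fin.snoc_last]
        congr 1
        funext j
        exact Fin.snoc_castSucc (α := fun _ => Draw S A) (n := K) d D j
    simp only [e]
    rw [pmfMean_mul_left]
    exact mul_le_of_le_one_right' (hf K K.lt_succ_self D)

end Supermartingale

/-! ### Exponential moments of one round -/

section OneRound

variable {Ω : Type} [Fintype Ω] {W : Ω → ℝ}

theorem wMean_exp_centered_le (hW : W ∈ stdSimplex ℝ Ω) {q : Ω → ℝ} {t : ℝ}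
    (ht : ∀ ω, t * (wMean W q - q ω) ≤ 1) :
    wMean W (fun ω => Real.exp (t * (wMean W q - q ω) - t ^ 2 * wVar W q)) ≤ 1 := by
  have h := wMean_exp_le hW ht
  have e1 : (fun ω => Real.exp (t * (wMean W q - q ω) - t ^ 2 * wVar W q)) =
      fun ω => Real.exp (-(t ^ 2 * wVar W q)) * Real.exp (t * (wMean W q - q ω)) := by
    funext ω
    rw [← Real.exp_add]
    ring_nf
  have e2 : wMean W (fun ω => (t * (wMean W q - q ω)) ^ 2) = t ^ 2 * wVar W q := by
    rw [wVar_eq hW, ← wMean_mul_left]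
    congr 1
    funext ω
    ring
  have e3 : wMean W (fun ω => t * (wMean W q - q ω)) = 0 := by
    rw [wMean_mul_left, wMean_sub, wMean_const hW]
    ring
  rw [e2, e3, zero_add] at h
  rw [e1, wMean_mul_left, Real.exp_neg, inv_mul_le_iff₀ (Real.exp_pos _), mul_one]
  exact h

theorem wMean_comm {X : Type} [Fintype X] (W : Ω → ℝ) (π : X → ℝ) (q : Ω → X → ℝ) :
    wMean W (fun ω => wMean π (q ω)) = wMean π (fun a => wMean W fun ω => q ω a) := by
  simp only [wMean, Finset.mul_sum]
  rw [Finset.sum_comm]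
  exact Finset.sum_congr rfl fun a _ => Finset.sum_congr rfl fun ω _ => by ring

/-- Exponential moment of the mean and the variance under `π` of a random table `q` whose entry
at `a` has the law of `g` under `P a`. -/
theorem wMean_exp_mean_add_var_le (hW : W ∈ stdSimplex ℝ Ω) {X Y : Type} [Fintype X] [Fintype Y]
    {π : X → ℝ} (hπ : π ∈ stdSimplex ℝ X) {q : Ω → X → ℝ} {P : X → Y → ℝ} {g : Y → ℝ}
    (hq1 : ∀ a, wMean W (fun ω => q ω a) = wMean (P a) g)
    (hq2 : ∀ a, wMean W (fun ω => q ω a ^ 2) = wMean (P a) fun y => g y ^ 2)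
    {lo hi B t c b : ℝ} (hlo : ∀ ω a, lo ≤ q ω a) (hhi : ∀ ω a, q ω a ≤ hi) (hB : hi - lo ≤ B)
    (ht : 0 ≤ t) (hc : 0 ≤ c) (h1 : t * B + t * c * B ^ 2 ≤ 1)
    (hb : c + 2 * t + 2 * t * c ^ 2 * B ^ 2 ≤ b) :
    wMean W (fun ω => Real.exp (t * (wMean π (q ω) - wMean π (fun a => wMean (P a) g))
      + t * c * wVar π (q ω) - t * b * wVar (fun y => ∑ a, π a * P a y) g)) ≤ 1 := by
  set T := wVar (fun y => ∑ a, π a * P a y) g with hT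
  set z := wMean π (fun a => wMean (P a) g) with hz
  have hlohi : ∀ ω : Ω, ∀ a : X, 0 ≤ hi - lo := fun ω a => by linarith [hlo ω a, hhi ω a]
  have hmean : wMean W (fun ω => wMean π (q ω)) = z := by
    rw [wMean_comm, hz]
    simp only [hq1]
  have hY0 : ∀ ω, 0 ≤ wVar π (q ω) := fun ω => wVar_nonneg hπ _
  have hYB : ∀ ω, wVar π (q ω) ≤ B ^ 2 := fun ω => by
    have hX : Nonempty X := by
      by_contra hX
      have := hπ.2
      rw [not_nonempty_iff] at hX
      simp at this
    obtain ⟨a⟩ := hX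
    exact (wVar_le_sq hπ (hlo ω) (hhi ω)).trans (pow_le_pow_left₀ (hlohi ω a) hB 2)
  have hT1 : wMean π (fun a => wVar (P a) g) ≤ T := wMean_wVar_le hπ P g
  -- The mean of the second moment is exact, and Jensen's inequality handles the subtracted square
  -- of the mean.
  have hEY : wMean W (fun ω => wVar π (q ω)) ≤ T := by
    have h2 := sq_wMean_le hW (fun ω => wMean π (q ω))
    rw [hmean] at h2
    simp only [wVar] at hT ⊢
    rw [wMean_sub, wMean_comm W π (fun ω a => q ω a ^ 2), hT]
    simp only [hq2, wMean_sum_weights]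
    linarith
  have hT0 : 0 ≤ T := (le_wMean hW hY0).trans hEY
  -- Jensen's inequality over `π` reduces this to the average of the variances of single entries,
  -- which concavity bounds by `T`. No correlation between entries has to be controlled.
  have hEsq : wMean W (fun ω => (wMean π (q ω) - z) ^ 2) ≤ T := by
    have h2 : ∀ ω, (wMean π (q ω) - z) ^ 2 ≤
        wMean π (fun a => (q ω a - wMean (P a) g) ^ 2) := by
      intro ω
      rw [hz, ← wMean_sub]
      exact sq_wMean_le hπ _
    refine (wMean_mono hW h2).trans ?_
    rw [wMean_comm W π (fun ω a => (q ω a - wMean (P a) g) ^ 2)]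
    refine le_trans (le_of_eq ?_) hT1
    congr 1
    funext a
    rw [← hq1, ← wVar_eq hW, wVar, wVar, hq1, hq2]
  have hx1 : ∀ ω, t * (wMean π (q ω) - z) + t * c * wVar π (q ω) ≤ 1 := by
    intro ω
    have h3 : wMean π (q ω) ≤ hi := wMean_le hπ (hhi ω)
    have h4 : lo ≤ z := by
      rw [← hmean]
      exact le_wMean hW fun ω => le_wMean hπ (hlo ω)
    have h5 : t * (wMean π (q ω) - z) ≤ t * B := mul_le_mul_of_nonneg_left (by linarith) ht
    have h6 : t * c * wVar π (q ω) ≤ t * c * B ^ 2 :=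
      mul_le_mul_of_nonneg_left (hYB ω) (mul_nonneg ht hc)
    linarith
  have hexp := wMean_exp_le hW hx1
  have hE1 : wMean W (fun ω => t * (wMean π (q ω) - z) + t * c * wVar π (q ω)) ≤ t * c * T := by
    rw [wMean_add, wMean_mul_left, wMean_mul_left, wMean_sub, hmean, wMean_const hW]
    have := mul_le_mul_of_nonneg_left hEY (mul_nonneg ht hc)
    linarith
  have hE2 : wMean W (fun ω => (t * (wMean π (q ω) - z) + t * c * wVar π (q ω)) ^ 2) ≤
      2 * t ^ 2 * T + 2 * (t * c) ^ 2 * B ^ 2 * T := by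
    have h3 : ∀ ω, (t * (wMean π (q ω) - z) + t * c * wVar π (q ω)) ^ 2 ≤
        2 * t ^ 2 * (wMean π (q ω) - z) ^ 2 + 2 * (t * c) ^ 2 * B ^ 2 * wVar π (q ω) := by
      intro ω
      have h4 : wVar π (q ω) ^ 2 ≤ B ^ 2 * wVar π (q ω) := by
        rw [sq]
        exact mul_le_mul_of_nonneg_right (hYB ω) (hY0 ω)
      have h5 : (t * c) ^ 2 * wVar π (q ω) ^ 2 ≤ (t * c) ^ 2 * (B ^ 2 * wVar π (q ω)) :=
        mul_le_mul_of_nonneg_left h4 (sq_nonneg _)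
      nlinarith [sq_nonneg (t * (wMean π (q ω) - z) - t * c * wVar π (q ω))]
    refine (wMean_mono hW h3).trans ?_
    rw [wMean_add, wMean_mul_left, wMean_mul_left]
    exact add_le_add (mul_le_mul_of_nonneg_left hEsq (by positivity))
      (mul_le_mul_of_nonneg_left hEY (by positivity))
  have hfin : t * c * T + (2 * t ^ 2 * T + 2 * (t * c) ^ 2 * B ^ 2 * T) ≤ t * b * T := by
    have := mul_le_mul_of_nonneg_right hb (mul_nonneg ht hT0)
    nlinarith
  have e1 : (fun ω => Real.exp (t * (wMean π (q ω) - z) + t * c * wVar π (q ω) - t * b * T)) =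
      fun ω => Real.exp (-(t * b * T)) *
        Real.exp (t * (wMean π (q ω) - z) + t * c * wVar π (q ω)) := by
    funext ω
    rw [← Real.exp_add]
    ring_nf
  rw [e1, wMean_mul_left, Real.exp_neg, inv_mul_le_iff₀ (Real.exp_pos _), mul_one]
  refine hexp.trans (Real.exp_le_exp.2 ?_)
  linarith

end OneRound

/-! ### Analysis of one step of the algorithm -/

section Step

variable {m S H : ℕ} {A : Fin m → ℕ}

/-- Law of the action and the next state when player `i` plays `a` and the others play `p`. -/
def ownWeight (G : Game m S H A) (h : Fin H) (p : ∀ j, stdSimplex ℝ (Fin (A j))) (s : Fin S)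
    (i : Fin m) (a : Fin (A i)) : JointAction A × Fin S → ℝ :=
  stepWeight (prodWeight (Function.update p i (pointMass a))) (G.P0 h s)

theorem ownWeight_mem_stdSimplex (G : Game m S H A) (h : Fin H)
    (p : ∀ j, stdSimplex ℝ (Fin (A j))) (s : Fin S) (i : Fin m) (a : Fin (A i)) :
    ownWeight G h p s i a ∈ stdSimplex ℝ (JointAction A × Fin S) :=
  stepWeight_mem_stdSimplex (prodWeight_mem_stdSimplex _) _

theorem stepWeight_update_eq_sum (G : Game m S H A) (h : Fin H)
    (p : ∀ j, stdSimplex ℝ (Fin (A j))) (s : Fin S) (i : Fin m) (σ : stdSimplex ℝ (Fin (A i))) :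
    stepWeight (prodWeight (Function.update p i σ)) (G.P0 h s) =
      fun x => ∑ a, σ a * ownWeight G h p s i a x := by
  have : prodWeight (Function.update p i σ) =
      fun a => ∑ b, σ b * prodWeight (Function.update p i (pointMass b)) a :=
    funext (prodWeight_update_eq_sum p i σ)
  rw [this, stepWeight_sum]
  rfl

theorem stepWeight_eq_sum (G : Game m S H A) (h : Fin H)
    (p : ∀ j, stdSimplex ℝ (Fin (A j))) (s : Fin S) (i : Fin m) :
    stepWeight (prodWeight p) (G.P0 h s) = fun x => ∑ a, p i a * ownWeight G h p s i a x := by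
  rw [← stepWeight_update_eq_sum, Function.update_eq_self]

theorem le_qEst {G : Game m S H A} {R : ℝ} {V : Fin m → Fin S → ℝ} (hR1 : R ≤ 1)
    (h : Fin H) (d : Draw S A) (i : Fin m) (s : Fin S)
    (a : Fin (A i)) : ⨅ s', V i s' ≤ qEst G R h V d i s a :=
  le_stepTarget hR1 (G.r_nonneg i h s) (V i) (d i s a)

theorem qEst_le [NeZero S] {G : Game m S H A} {R : ℝ} {V : Fin m → Fin S → ℝ} (hR1 : R ≤ 1)
    {B : ℝ} (hV : ∀ i s s', V i s - V i s' ≤ B) (h : Fin H)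
    (d : Draw S A) (i : Fin m) (s : Fin S) (a : Fin (A i)) :
    qEst G R h V d i s a ≤ 1 + (1 - R) * B + ⨅ s', V i s' :=
  stepTarget_le hR1 (G.r_le_one i h s) (hV i) (d i s a)

variable [∀ i, NeZero (A i)]

/-- The estimate before truncation. -/
def rawValue (G : Game m S H A) (R cb δ : ℝ) (α η : ℕ → ℝ) (h : Fin H)
    (V : Fin m → Fin S → ℝ) {K : ℕ} (D : Fin K → Draw S A) (i : Fin m) (s : Fin S) : ℝ :=
  (∑ k : Fin K, mixWeight α K (k + 1) *
      wMean (usedPolicy G R α η h V D k i s) (qEst G R h V (D k) i s))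
    + bonus G R cb δ α η h V D i s

theorem nextValue_eq (G : Game m S H A) (R cb δ : ℝ) (α η : ℕ → ℝ) {n : ℕ} (hn : n + 1 ≤ H)
    (V : Fin m → Fin S → ℝ) {K : ℕ} (D : Fin K → Draw S A) (i : Fin m) (s : Fin S) :
    nextValue G R cb δ α η (stepIdx n hn) V D i s =
      min (rawValue G R cb δ α η (stepIdx n hn) V D i s) (n + 1) := by
  have : (H : ℝ) - ((stepIdx n hn : Fin H) : ℕ) = n + 1 := by
    simp only
    rw [Nat.cast_sub hn]
    push_cast
    ring
  rw [nextValue, this]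
  rfl

theorem mixedPolicy_mem_stdSimplex (G : Game m S H A) (R : ℝ) {c : ℝ} (hc : 0 < c) (η : ℕ → ℝ)
    (h : Fin H) (V : Fin m → Fin S → ℝ) {K : ℕ} (hK : K ≠ 0) (D : Fin K → Draw S A) (s : Fin S) :
    mixedPolicy G R (harmStep c) η h V D s ∈ stdSimplex ℝ (JointAction A) :=
  sum_weights_mem_stdSimplex (mixWeight_mem_stdSimplex hc hK)
    fun k => prodWeight_mem_stdSimplex fun i => usedPolicy G R (harmStep c) η h V D k i s

theorem stepWeight_mixedPolicy (G : Game m S H A) (R : ℝ) (α η : ℕ → ℝ) (h : Fin H)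
    (V : Fin m → Fin S → ℝ) {K : ℕ} (D : Fin K → Draw S A) (s : Fin S) :
    stepWeight (mixedPolicy G R α η h V D s) (G.P0 h s) = fun x => ∑ k : Fin K,
      mixWeight α K (k + 1) *
        stepWeight (prodWeight fun j => usedPolicy G R α η h V D k j s) (G.P0 h s) x :=
  stepWeight_sum _ _ _

theorem stepWeight_devWeight_mixedPolicy (G : Game m S H A) (R : ℝ) (α η : ℕ → ℝ) (h : Fin H)
    (V : Fin m → Fin S → ℝ) {K : ℕ} (D : Fin K → Draw S A) (s : Fin S) (i : Fin m)
    (σ : stdSimplex ℝ (Fin (A i))) :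
    stepWeight (devWeight i σ (mixedPolicy G R α η h V D s)) (G.P0 h s) = fun x => ∑ k : Fin K,
      mixWeight α K (k + 1) *
        stepWeight (prodWeight (Function.update (fun j => usedPolicy G R α η h V D k j s) i σ))
          (G.P0 h s) x := by
  have : devWeight i σ (mixedPolicy G R α η h V D s) = fun a => ∑ k : Fin K,
      mixWeight α K (k + 1) *
        prodWeight (Function.update (fun j => usedPolicy G R α η h V D k j s) i σ) a := by
    funext a
    have e := devWeight_sum (fun k : Fin K => mixWeight α K (k + 1))
      (fun k => prodWeight fun j => usedPolicy G R α η h V D k j s) i σ a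
    simp only [devWeight_prodWeight] at e
    exact e
  rw [this, stepWeight_sum]

variable {G : Game m S H A} {R cα cb δ : ℝ} {K : ℕ} {V : Fin m → Fin S → ℝ}

theorem rawValue_eq (hreg : Regime cα cb (effHorizon H R) (logTerm S A K δ) K) (η : ℕ → ℝ)
    (h : Fin H) (D : Fin K → Draw S A) (i : Fin m) (s : Fin S) :
    rawValue G R cb δ (stepα cα K) η h V D i s =
      (∑ k : Fin K, mixWeight (stepα cα K) K (k + 1) *
        (wMean (usedPolicy G R (stepα cα K) η h V D k i s) (qEst G R h V (D k) i s) +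
          cb * rate (effHorizon H R) (logTerm S A K δ) K *
            wVar (usedPolicy G R (stepα cα K) η h V D k i s) (qEst G R h V (D k) i s))) +
      cb * rate (effHorizon H R) (logTerm S A K δ) K * effHorizon H R := by
  have hw := mixWeight_mem_stdSimplex (mul_pos hreg.cα_pos hreg.log_pos) (K := K)
    (by have := hreg.K_large; omega)
  have hsum : ∑ k : Fin K, mixWeight (stepα cα K) K (k + 1) * effHorizon H R =
      effHorizon H R := by
    rw [← Finset.sum_mul]
    exact (congrArg (· * effHorizon H R) hw.2).trans (one_mul _)
  have hb : bonus G R cb δ (stepα cα K) η h V D i s =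
      cb * rate (effHorizon H R) (logTerm S A K δ) K * ∑ k : Fin K,
        mixWeight (stepα cα K) K (k + 1) *
        (wVar (usedPolicy G R (stepα cα K) η h V D k i s) (qEst G R h V (D k) i s) +
          effHorizon H R) := rfl
  rw [rawValue, hb]
  simp only [mul_add, Finset.sum_add_distrib, hsum]
  rw [← add_assoc]
  congr 2
  rw [Finset.mul_sum]
  exact Finset.sum_congr rfl fun k _ => by ring

variable [NeZero S]

/-- The variance part of the bonus stays within the range of the samples by `wMean_add_mul_wVar_le`.
The constant `2` is one unit for the reward and one for the constant part of the bonus. -/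
theorem rawValue_bounds (hR : 0 ≤ R) (hR1 : R ≤ 1)
    (hreg : Regime cα cb (effHorizon H R) (logTerm S A K δ) K) (η : ℕ → ℝ)
    (hV : ∀ i s s', V i s - V i s' ≤ 2 * effHorizon H R) (h : Fin H) (D : Fin K → Draw S A)
    (i : Fin m) (s : Fin S) :
    ⨅ s', V i s' ≤ rawValue G R cb δ (stepα cα K) η h V D i s ∧
      rawValue G R cb δ (stepα cα K) η h V D i s ≤
        2 + (1 - R) * (2 * effHorizon H R) + ⨅ s', V i s' := by
  have hw := mixWeight_mem_stdSimplex (mul_pos hreg.cα_pos hreg.log_pos) (K := K)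
    (by have := hreg.K_large; omega)
  have hc0 : 0 ≤ cb * rate (effHorizon H R) (logTerm S A K δ) K :=
    mul_nonneg hreg.cb_pos.le hreg.rate_pos.le
  have hM := hreg.one_le_M
  have hsm := hreg.cb_rate_mul_M_small
  have hcM : 0 ≤ cb * rate (effHorizon H R) (logTerm S A K δ) K * effHorizon H R :=
    mul_nonneg hc0 (by linarith)
  rw [rawValue_eq hreg]
  constructor
  · have h1 := le_wMean hw (f := fun k : Fin K =>
      wMean (usedPolicy G R (stepα cα K) η h V D k i s) (qEst G R h V (D k) i s) +
          cb * rate (effHorizon H R) (logTerm S A K δ) K *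
            wVar (usedPolicy G R (stepα cα K) η h V D k i s) (qEst G R h V (D k) i s))
      (c := ⨅ s', V i s') fun k => by
        have h2 := le_wMean (coe_mem_stdSimplex (usedPolicy G R (stepα cα K) η h V D k i s))
          (le_qEst (G := G) (V := V) hR1 h (D k) i s)
        have h3 := mul_nonneg hc0
          (wVar_nonneg (coe_mem_stdSimplex (usedPolicy G R (stepα cα K) η h V D k i s))
            (qEst G R h V (D k) i s))
        linarith
    exact h1.trans (le_add_of_nonneg_right hcM)
  · have h1 := wMean_le hw (f := fun k : Fin K =>
      wMean (usedPolicy G R (stepα cα K) η h V D k i s) (qEst G R h V (D k) i s) +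
          cb * rate (effHorizon H R) (logTerm S A K δ) K *
            wVar (usedPolicy G R (stepα cα K) η h V D k i s) (qEst G R h V (D k) i s))
      (c := 1 + (1 - R) * (2 * effHorizon H R) + ⨅ s', V i s') fun k =>
        wMean_add_mul_wVar_le (coe_mem_stdSimplex _) (le_qEst hR1 h (D k) i s)
          (qEst_le hR1 hV h (D k) i s) hc0 (by
            have h4 : 1 + (1 - R) * (2 * effHorizon H R) + (⨅ s', V i s') - ⨅ s', V i s' ≤
                3 * effHorizon H R := by nlinarith
            have := mul_le_mul_of_nonneg_left h4 hc0
            linarith)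
    refine (add_le_add_left h1 _).trans ?_
    linarith

/-- If `R * M = 1`, the bound `2 + (1 - R) * (2 M)` on the new span equals `2 M`, so spans up to `2
M` reproduce themselves despite the bonus. If `M = H`, truncation is enough. -/
theorem nextValue_range (hR : 0 ≤ R) (hR1 : R ≤ 1)
    (hMR : effHorizon H R = H ∨ R * effHorizon H R = 1)
    (hreg : Regime cα cb (effHorizon H R) (logTerm S A K δ) K) (η : ℕ → ℝ) {n : ℕ}
    (hn : n + 1 ≤ H) (hV : ValueRange (effHorizon H R) n V) (D : Fin K → Draw S A) :
    ValueRange (effHorizon H R) (n + 1)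
        (nextValue G R cb δ (stepα cα K) η (stepIdx n hn) V D) ∧
      ∀ i s, ⨅ s', V i s' ≤ nextValue G R cb δ (stepα cα K) η (stepIdx n hn) V D i s := by
  have hb := rawValue_bounds (G := G) hR hR1 hreg η hV.span (stepIdx n hn) D
  have hinf0 : ∀ i, 0 ≤ ⨅ s', V i s' := fun i => le_ciInf fun s => hV.nonneg i s
  have hinf1 : ∀ i, ⨅ s', V i s' ≤ n + 1 := fun i =>
    (iInf_le_apply (V i) 0).trans ((hV.le i 0).trans (by linarith))
  have hlow : ∀ i s, ⨅ s', V i s' ≤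
      nextValue G R cb δ (stepα cα K) η (stepIdx n hn) V D i s := by
    intro i s
    rw [nextValue_eq]
    exact le_min (hb i s).1 (hinf1 i)
  have hle : ∀ i s, nextValue G R cb δ (stepα cα K) η (stepIdx n hn) V D i s ≤
      ((n + 1 : ℕ) : ℝ) := by
    intro i s
    rw [nextValue_eq]
    push_cast
    exact min_le_right _ _
  refine ⟨⟨fun i s => (hinf0 i).trans (hlow i s), hle, fun i s s' => ?_⟩, hlow⟩
  rcases hMR with hMR | hMR
  · have h1 := hle i s
    have h2 := (hinf0 i).trans (hlow i s')
    have h3 : ((n + 1 : ℕ) : ℝ) ≤ H := by exact_mod_cast hn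
    have h4 := hreg.one_le_M
    linarith
  · have h1 := hlow i s'
    have h2 : nextValue G R cb δ (stepα cα K) η (stepIdx n hn) V D i s ≤
        rawValue G R cb δ (stepα cα K) η (stepIdx n hn) V D i s := by
      rw [nextValue_eq]
      exact min_le_left _ _
    have h3 := (hb i s).2
    linarith

/-- Holds for all samples: the new estimate and the Bellman targets both lie between `min V` and
`min V + 4 M`. This makes a failed step cost `O(M)` instead of ruining the recursion. -/
theorem stepCert_of_large_slack (hR : 0 ≤ R) (hR1 : R ≤ 1)
    (hMR : effHorizon H R = H ∨ R * effHorizon H R = 1)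
    (hreg : Regime cα cb (effHorizon H R) (logTerm S A K δ) K) (η : ℕ → ℝ) {n : ℕ}
    (hn : n + 1 ≤ H) (hV : ValueRange (effHorizon H R) n V) (D : Fin K → Draw S A) {l e : ℝ}
    (hl : 0 ≤ l) (he : 0 ≤ e) :
    StepCert G R l e n hn V (nextValue G R cb δ (stepα cα K) η (stepIdx n hn) V D)
      (mixedPolicy G R (stepα cα K) η (stepIdx n hn) V D) (4 * effHorizon H R) := by
  have hM := hreg.one_le_M
  have hμ : ∀ s, mixedPolicy G R (stepα cα K) η (stepIdx n hn) V D s ∈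
      stdSimplex ℝ (JointAction A) := fun s =>
    mixedPolicy_mem_stdSimplex G R (mul_pos hreg.cα_pos hreg.log_pos) η _ V
      (by have := hreg.K_large; omega) D s
  refine ⟨fun i s => ?_, fun i s σ => ?_⟩
  · have hp := stepWeight_mem_stdSimplex (hμ s) (G.P0 (stepIdx n hn) s)
    have h1 := le_wMean hp (le_stepTarget hR1 (G.r_nonneg i (stepIdx n hn) s) (V i))
    have h2 := mul_nonneg hl
      (wVar_nonneg hp (stepTarget (G.r i (stepIdx n hn) s) R (V i)))
    have h3 := (rawValue_bounds (G := G) hR hR1 hreg η hV.span (stepIdx n hn) D i s).2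
    have h4 : nextValue G R cb δ (stepα cα K) η (stepIdx n hn) V D i s ≤
        rawValue G R cb δ (stepα cα K) η (stepIdx n hn) V D i s := by
      rw [nextValue_eq]
      exact min_le_left _ _
    nlinarith
  · have hd : devWeight i σ (mixedPolicy G R (stepα cα K) η (stepIdx n hn) V D s) ∈
        stdSimplex ℝ (JointAction A) :=
      deviate_mem_stdSimplex i (fun _ _ => σ)
        (π := fun _ => mixedPolicy G R (stepα cα K) η (stepIdx n hn) V D) (h := stepIdx n hn)
        (hμ s)
    have hp := stepWeight_mem_stdSimplex hd (G.P0 (stepIdx n hn) s)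
    have h1 := wMean_le hp
      (stepTarget_le hR1 (G.r_le_one i (stepIdx n hn) s) (hV.span i))
    have h2 := mul_nonneg hl
      (wVar_nonneg hp (stepTarget (G.r i (stepIdx n hn) s) R (V i)))
    have h3 := (nextValue_range (G := G) hR hR1 hMR hreg η hn hV D).2 i s
    refine le_trans (sub_le_sub_right (sub_le_sub_right (min_le_left _ _) _) _) ?_
    nlinarith

end Step

/-! ### Concentration and the good event -/

section Concentration

variable {m S H : ℕ} {A : Fin m → ℕ}

/-- Exponent controlling the sampled rewards of one own action in one round with weight `t`. -/
def ownExponent (G : Game m S H A) (R : ℝ) (h : Fin H) (V : Fin m → Fin S → ℝ)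
    (i : Fin m) (s : Fin S) (a : Fin (A i)) (t : ℝ) (p : ∀ j, stdSimplex ℝ (Fin (A j)))
    (d : Draw S A) : ℝ :=
  t * (wMean (ownWeight G h p s i a) (stepTarget (G.r i h s) R (V i)) - qEst G R h V d i s a) -
    t ^ 2 * wVar (ownWeight G h p s i a) (stepTarget (G.r i h s) R (V i))

/-- Exponent controlling the sampled mean and variance under the policy in one round with
weight `t`. -/
def jointExponent (G : Game m S H A) (R c b : ℝ) (h : Fin H) (V : Fin m → Fin S → ℝ)
    (i : Fin m) (s : Fin S) (t : ℝ) (p : ∀ j, stdSimplex ℝ (Fin (A j))) (d : Draw S A) : ℝ :=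
  t * (wMean (p i) (qEst G R h V d i s) -
      wMean (p i) (fun a => wMean (ownWeight G h p s i a) (stepTarget (G.r i h s) R (V i)))) +
    t * c * wVar (p i) (qEst G R h V d i s) -
    t * b * wVar (stepWeight (prodWeight p) (G.P0 h s)) (stepTarget (G.r i h s) R (V i))

variable {G : Game m S H A} {R : ℝ} {V : Fin m → Fin S → ℝ}

theorem wMean_qEst (h : Fin H) (p : ∀ j, Fin S → stdSimplex ℝ (Fin (A j))) (i : Fin m)
    (s : Fin S) (a : Fin (A i)) (g : ℝ → ℝ) :
    wMean (pmfWeight (drawLaw G h p)) (fun d => g (qEst G R h V d i s a)) =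
      wMean (ownWeight G h (fun j => p j s) s i a)
        (fun x => g (stepTarget (G.r i h s) R (V i) x)) :=
  wMean_drawLaw G h p i s a fun x => g (stepTarget (G.r i h s) R (V i) x)

variable [NeZero S] {B : ℝ}

theorem pmfMean_ownExponent_le (hR1 : R ≤ 1) (hV : ∀ i s s', V i s - V i s' ≤ B) {t : ℝ}
    (ht : 0 ≤ t) (htB : t * (1 + (1 - R) * B) ≤ 1) (h : Fin H)
    (p : ∀ j, Fin S → stdSimplex ℝ (Fin (A j))) (i : Fin m) (s : Fin S) (a : Fin (A i)) :
    pmfMean (drawLaw G h p) (fun d => ENNReal.ofReal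
      (Real.exp (ownExponent G R h V i s a t (fun j => p j s) d))) ≤ 1 := by
  rw [pmfMean_ofReal _ fun d => (Real.exp_pos _).le, ← ENNReal.ofReal_one]
  refine ENNReal.ofReal_le_ofReal ?_
  have hW := pmfWeight_mem_stdSimplex (drawLaw G h p)
  have e1 := wMean_qEst (G := G) (R := R) (V := V) h p i s a fun x => x
  have e2 := wMean_qEst (G := G) (R := R) (V := V) h p i s a fun x => x ^ 2
  have e3 : wVar (pmfWeight (drawLaw G h p)) (fun d => qEst G R h V d i s a) =
      wVar (ownWeight G h (fun j => p j s) s i a) (stepTarget (G.r i h s) R (V i)) := by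
    rw [wVar, wVar, e2, e1]
  have key := wMean_exp_centered_le hW (q := fun d => qEst G R h V d i s a) (t := t) fun d => by
    have h1 := wMean_le hW (fun d => qEst_le (G := G) hR1 hV h d i s a)
    have h2 := le_qEst (G := G) (V := V) hR1 h d i s a
    exact (mul_le_mul_of_nonneg_left (by linarith) ht).trans htB
  rw [e3, e1] at key
  exact key

theorem pmfMean_jointExponent_le (hR1 : R ≤ 1) (hV : ∀ i s s', V i s - V i s' ≤ B)
    {t c b B' : ℝ} (hB' : 1 + (1 - R) * B ≤ B') (ht : 0 ≤ t) (hc : 0 ≤ c)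
    (h1 : t * B' + t * c * B' ^ 2 ≤ 1)
    (hb : c + 2 * t + 2 * t * c ^ 2 * B' ^ 2 ≤ b) (h : Fin H)
    (p : ∀ j, Fin S → stdSimplex ℝ (Fin (A j))) (i : Fin m) (s : Fin S) :
    pmfMean (drawLaw G h p) (fun d => ENNReal.ofReal
      (Real.exp (jointExponent G R c b h V i s t (fun j => p j s) d))) ≤ 1 := by
  rw [pmfMean_ofReal _ fun d => (Real.exp_pos _).le, ← ENNReal.ofReal_one]
  refine ENNReal.ofReal_le_ofReal ?_
  have hW := pmfWeight_mem_stdSimplex (drawLaw G h p)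
  have key := wMean_exp_mean_add_var_le hW (coe_mem_stdSimplex (p i s))
    (q := fun d => qEst G R h V d i s) (P := ownWeight G h (fun j => p j s) s i)
    (g := stepTarget (G.r i h s) R (V i))
    (fun a => wMean_qEst (G := G) (R := R) (V := V) h p i s a fun x => x)
    (fun a => wMean_qEst (G := G) (R := R) (V := V) h p i s a fun x => x ^ 2)
    (fun d a => le_qEst hR1 h d i s a) (fun d a => qEst_le hR1 hV h d i s a)
    (B := B') (by linarith) ht hc h1 hb
  rw [← stepWeight_eq_sum G h (fun j => p j s) s i] at key
  exact key

end Concentration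

/-! ### Union bound over players, states and own actions. -/

section GoodEvent

variable {m S H : ℕ} {A : Fin m → ℕ} [∀ i, NeZero (A i)]

/-- All exponential supermartingales of the step stay below `exp x`. -/
structure GoodEvent (G : Game m S H A) (R : ℝ) (α η : ℕ → ℝ) (h : Fin H)
    (V : Fin m → Fin S → ℝ) (θ c b x : ℝ) {K : ℕ} (D : Fin K → Draw S A) : Prop where
  own : ∀ i s a, ∑ k : Fin K, ownExponent G R h V i s a (θ * mixWeight α K (k + 1))
    (fun j => usedPolicy G R α η h V D k j s) (D k) ≤ x
  joint : ∀ i s, ∑ k : Fin K, jointExponent G R c b h V i s (θ * mixWeight α K (k + 1))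
    (fun j => usedPolicy G R α η h V D k j s) (D k) ≤ x

variable {G : Game m S H A} {R : ℝ} {V : Fin m → Fin S → ℝ}

theorem pmfMean_exp_sum_le {α η : ℕ → ℝ} {h : Fin H} {K : ℕ} {s : Fin S}
    (F : ℕ → (∀ j, stdSimplex ℝ (Fin (A j))) → Draw S A → ℝ)
    (hF : ∀ k < K, ∀ p : ∀ j, Fin S → stdSimplex ℝ (Fin (A j)), pmfMean (drawLaw G h p)
      (fun d => ENNReal.ofReal (Real.exp (F k (fun j => p j s) d))) ≤ 1) (x : ℝ) :
    pmfMean (roundsLaw G R α η h V K) (fun D => ENNReal.ofReal (Real.exp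
      ((∑ k : Fin K, F k (fun j => usedPolicy G R α η h V D k j s) (D k)) - x))) ≤
      ENNReal.ofReal (Real.exp (-x)) := by
  have key := pmfMean_roundsLaw_prod_le G R α η h V
    (fun k D d => ENNReal.ofReal (Real.exp (F k (fun j => ftrlPolicy G R α η h V k D j s) d))) K
    fun k hk D => hF k hk _
  have e : ∀ D : Fin K → Draw S A, ENNReal.ofReal (Real.exp
      ((∑ k : Fin K, F k (fun j => usedPolicy G R α η h V D k j s) (D k)) - x)) =
      ENNReal.ofReal (Real.exp (-x)) * ∏ k : Fin K, ENNReal.ofReal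
        (Real.exp (F k (fun j => ftrlPolicy G R α η h V k (Fin.take k k.isLt.le D) j s) (D k))) := by
    intro D
    rw [← ENNReal.ofReal_prod_of_nonneg fun k _ => (Real.exp_pos _).le, ← Real.exp_sum,
      ← ENNReal.ofReal_mul (Real.exp_pos _).le, ← Real.exp_add, sub_eq_neg_add]
    rfl
  simp only [e]
  rw [pmfMean_mul_left]
  exact mul_le_of_le_one_right' key

/-- Union bound for the failure of the good event. -/
theorem toOuterMeasure_not_goodEvent_le [NeZero S] (hR : 0 ≤ R) (hR1 : R ≤ 1) {M : ℝ} (hM : 1 ≤ M)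
    (hV : ∀ i s s', V i s - V i s' ≤ 2 * M) {α η : ℕ → ℝ} {h : Fin H} {θ c b x ρ : ℝ} {K : ℕ}
    (hw0 : ∀ k < K, 0 ≤ θ * mixWeight α K (k + 1)) (hw : ∀ k < K, θ * mixWeight α K (k + 1) ≤ ρ)
    (hc : 0 ≤ c) (h1 : ρ * (3 * M) + ρ * c * (3 * M) ^ 2 ≤ 1)
    (hb : c + 2 * ρ + 2 * ρ * c ^ 2 * (3 * M) ^ 2 ≤ b) :
    (roundsLaw G R α η h V K).toOuterMeasure {D | ¬ GoodEvent G R α η h V θ c b x D} ≤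
      ENNReal.ofReal (2 * (S * ∑ i, (A i : ℝ)) * Real.exp (-x)) := by
  have hspan : 1 + (1 - R) * (2 * M) ≤ 3 * M := by nlinarith
  rw [toOuterMeasure_eq_pmfMean]
  -- Markov's inequality in exponential form: when an exponent `z` exceeds `x`, the term `exp (z -
  -- x)` alone is at least `1`.
  have hle : ∀ D : Fin K → Draw S A,
      Set.indicator {D | ¬ GoodEvent G R α η h V θ c b x D} (1 : (Fin K → Draw S A) → ENNReal) D ≤
      ∑ i : Fin m, ∑ s : Fin S, ((∑ a : Fin (A i), ENNReal.ofReal (Real.exp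
        ((∑ k : Fin K, ownExponent G R h V i s a (θ * mixWeight α K (k + 1))
          (fun j => usedPolicy G R α η h V D k j s) (D k)) - x))) +
        ENNReal.ofReal (Real.exp
        ((∑ k : Fin K, jointExponent G R c b h V i s (θ * mixWeight α K (k + 1))
          (fun j => usedPolicy G R α η h V D k j s) (D k)) - x))) := by
    intro D
    by_cases hD : GoodEvent G R α η h V θ c b x D
    · rw [Set.indicator_of_notMem (by simpa using hD)]
      exact zero_le
    · rw [Set.indicator_of_mem (by simpa using hD), Pi.one_apply]
      have hone : ∀ z : ℝ, x < z → 1 ≤ ENNReal.ofReal (Real.exp (z - x)) := by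
        intro z hz
        rw [← ENNReal.ofReal_one]
        exact ENNReal.ofReal_le_ofReal (Real.one_le_exp (by linarith))
      by_contra hcon
      refine hD ⟨fun i s a => ?_, fun i s => ?_⟩
      · by_contra hz
        refine hcon ((hone _ (not_le.1 hz)).trans ?_)
        refine le_trans ?_ (Finset.single_le_sum (fun _ _ => zero_le) (Finset.mem_univ i))
        refine le_trans ?_ (Finset.single_le_sum (fun _ _ => zero_le) (Finset.mem_univ s))
        refine le_trans ?_ le_self_add
        exact Finset.single_le_sum (f := fun a => ENNReal.ofReal (Real.exp
          ((∑ k : Fin K, ownExponent G R h V i s a (θ * mixWeight α K (k + 1))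
          (fun j => usedPolicy G R α η h V D k j s) (D k)) - x)))
          (fun _ _ => zero_le) (Finset.mem_univ a)
      · by_contra hz
        refine hcon ((hone _ (not_le.1 hz)).trans ?_)
        refine le_trans ?_ (Finset.single_le_sum (fun _ _ => zero_le) (Finset.mem_univ i))
        refine le_trans ?_ (Finset.single_le_sum (fun _ _ => zero_le) (Finset.mem_univ s))
        exact le_add_self
  refine (pmfMean_mono _ hle).trans ?_
  simp only [pmfMean_sum, pmfMean_add]
  have hA : ∀ i s (a : Fin (A i)), pmfMean (roundsLaw G R α η h V K) (fun D =>
      ENNReal.ofReal (Real.exp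
        ((∑ k : Fin K, ownExponent G R h V i s a (θ * mixWeight α K (k + 1))
          (fun j => usedPolicy G R α η h V D k j s) (D k)) - x))) ≤
      ENNReal.ofReal (Real.exp (-x)) := fun i s a =>
    pmfMean_exp_sum_le (fun k p d => ownExponent G R h V i s a (θ * mixWeight α K (k + 1)) p d)
      (fun k hk p => pmfMean_ownExponent_le hR1 hV (hw0 k hk) (by
        have h2 := hw0 k hk
        have h3 := hw k hk
        have h4 : 0 ≤ ρ := h2.trans h3
        have h5 : 0 ≤ ρ * c * (3 * M) ^ 2 := by positivity
        calc θ * mixWeight α K (k + 1) * (1 + (1 - R) * (2 * M))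
            ≤ ρ * (3 * M) := mul_le_mul h3 hspan (by nlinarith) h4
          _ ≤ 1 := by linarith) h p i s a) x
  have hB : ∀ i s, pmfMean (roundsLaw G R α η h V K) (fun D =>
      ENNReal.ofReal (Real.exp
        ((∑ k : Fin K, jointExponent G R c b h V i s (θ * mixWeight α K (k + 1))
          (fun j => usedPolicy G R α η h V D k j s) (D k)) - x))) ≤
      ENNReal.ofReal (Real.exp (-x)) := fun i s =>
    pmfMean_exp_sum_le (fun k p d => jointExponent G R c b h V i s
      (θ * mixWeight α K (k + 1)) p d)
      (fun k hk p => by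
        have h2 := hw0 k hk
        have h3 := hw k hk
        refine pmfMean_jointExponent_le hR1 hV hspan h2 hc (le_trans ?_ h1) (le_trans ?_ hb)
          h p i s
        · gcongr
        · gcongr) x
  have hcard : ∀ i : Fin m, (1 : ℝ) ≤ A i := fun i => by
    exact_mod_cast Nat.one_le_iff_ne_zero.2 (NeZero.ne (A i))
  calc _ ≤ ∑ i : Fin m, ∑ _s : Fin S, ((∑ _a : Fin (A i), ENNReal.ofReal (Real.exp (-x))) +
        ENNReal.ofReal (Real.exp (-x))) :=
        Finset.sum_le_sum fun i _ => Finset.sum_le_sum fun s _ =>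
          add_le_add (Finset.sum_le_sum fun a _ => hA i s a) (hB i s)
    _ = ENNReal.ofReal (∑ i : Fin m, ∑ _s : Fin S, ((∑ _a : Fin (A i), Real.exp (-x)) +
        Real.exp (-x))) := by
        have h0 := (Real.exp_pos (-x)).le
        rw [ENNReal.ofReal_sum_of_nonneg fun i _ => by positivity]
        refine Finset.sum_congr rfl fun i _ => ?_
        rw [ENNReal.ofReal_sum_of_nonneg fun s _ => by positivity]
        refine Finset.sum_congr rfl fun s _ => ?_
        rw [ENNReal.ofReal_add (by positivity) h0, ENNReal.ofReal_sum_of_nonneg fun _ _ => h0]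
    -- For each player and state there are `A i + 1 ≤ 2 * A i` exponents.
    _ ≤ ENNReal.ofReal (2 * (S * ∑ i, (A i : ℝ)) * Real.exp (-x)) := by
        refine ENNReal.ofReal_le_ofReal ?_
        have e : 2 * (S * ∑ i, (A i : ℝ)) * Real.exp (-x) =
            ∑ i : Fin m, ∑ _s : Fin S, (2 * (A i : ℝ) * Real.exp (-x)) := by
          simp only [Finset.sum_const, Finset.card_univ, Fintype.card_fin, nsmul_eq_mul,
            Finset.mul_sum, Finset.sum_mul]
          exact Finset.sum_congr rfl fun i _ => by ring
        rw [e]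
        refine Finset.sum_le_sum fun i _ => Finset.sum_le_sum fun s _ => ?_
        simp only [Finset.sum_const, Finset.card_univ, Fintype.card_fin, nsmul_eq_mul]
        nlinarith [hcard i, Real.exp_pos (-x)]

end GoodEvent

/-! ### From regret and concentration to the mean-variance certificate. -/

section Certificate

variable {m S H : ℕ} {A : Fin m → ℕ} [∀ i, NeZero (A i)] [NeZero S]
  {G : Game m S H A} {R cα cb δ : ℝ} {K : ℕ} {V : Fin m → Fin S → ℝ}

/-- The bonus makes up for the regret. -/
theorem sum_qEst_le_rawValue (hR : 0 ≤ R) (hR1 : R ≤ 1)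
    (hreg : Regime cα cb (effHorizon H R) (logTerm S A K δ) K)
    (hV : ∀ i s s', V i s - V i s' ≤ 2 * effHorizon H R) (h : Fin H) (D : Fin K → Draw S A)
    (i : Fin m) (hA : Real.log (A i) ≤ logTerm S A K δ) (s : Fin S) (a : Fin (A i)) :
    ∑ k : Fin K, mixWeight (stepα cα K) K (k + 1) * qEst G R h V (D k) i s a ≤
      rawValue G R cb δ (stepα cα K) (stepη cα H R K) h V D i s := by
  have hM := hreg.one_le_M
  -- The regret bound takes sequences indexed by `ℕ`; beyond the last round the tables are filled
  -- with zeros that never enter.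
  set Q : ℕ → Fin (A i) → ℝ := fun k a =>
    if hk : k ≤ K then qTable G R (stepα cα K) h V k (Fin.take k hk D) i s a else 0 with hQ
  set q : ℕ → Fin (A i) → ℝ := fun k a =>
    if hk : k < K then qEst G R h V (D ⟨k, hk⟩) i s a else 0 with hq
  have hQ0 : ∀ a, Q 0 a = 0 := fun a => by simp [hQ, qTable]
  have hQs : ∀ k < K, ∀ a, Q (k + 1) a = (1 - stepα cα K (k + 1)) * Q k a +
      stepα cα K (k + 1) * q k a := by
    intro k hk a
    simp only [hQ, hq, dif_pos hk, dif_pos hk.le, dif_pos (Nat.succ_le_of_lt hk), qTable]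
    rfl
  have hqk : ∀ k : Fin K, q k = qEst G R h V (D k) i s := fun k => by
    funext a
    simp only [hq, dif_pos k.2]
  have hsoft : ∀ k : Fin K, usedPolicy G R (stepα cα K) (stepη cα H R K) h V D k i s =
      softmax (stepη cα H R K (k + 1)) (Q k) := fun k => by
    have : Q k = qTable G R (stepα cα K) h V k (Fin.take k k.isLt.le D) i s := by
      funext a
      simp only [hQ, dif_pos k.isLt.le]
    rw [this]
    rfl
  have hsum : Q K a = ∑ k : Fin K, mixWeight (stepα cα K) K (k + 1) * q k a :=
    eq_sum_mixWeight (u := fun k => Q k a) (g := fun k => q k a) (hQ0 a)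
      fun k hk => hQs k hk a
  have key := hreg.regret_le_bonus (Q := Q) (q := q) (lo := ⨅ s', V i s')
    (hi := 1 + (1 - R) * (2 * effHorizon H R) + ⨅ s', V i s') (by simpa using hA) hQ0 hQs
    (fun k hk a => by
      simp only [hq, dif_pos hk]
      exact le_qEst hR1 h _ i s a)
    (fun k hk a => by
      simp only [hq, dif_pos hk]
      exact qEst_le hR1 hV h _ i s a)
    (by nlinarith) a (p := fun k => softmax (stepη cα H R K (k + 1)) (Q k)) (fun k => rfl)
  rw [hsum] at key
  simp only [hqk, ← hsoft] at key
  exact key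

/-- The upper bound comes from the joint exponents, which contain the sampled variance and hence
control the random bonus along with the mean. For the lower bound, the own-action exponents and the
regret bound are combined for each action and then averaged over `σ`. In both, concavity turns
averages of variances into the variance of the mixture. -/
theorem stepCert_of_goodEvent (hR : 0 ≤ R) (hR1 : R ≤ 1)
    (hreg : Regime cα cb (effHorizon H R) (logTerm S A K δ) K)
    (hA : ∀ i, Real.log (A i) ≤ logTerm S A K δ) {n : ℕ} (hn : n + 1 ≤ H)
    (hV : ∀ i s s', V i s - V i s' ≤ 2 * effHorizon H R) (D : Fin K → Draw S A)
    {θ x b ρ e : ℝ} (hθ : 0 < θ) (hx0 : 0 ≤ x)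
    (hw : ∀ k < K, θ * mixWeight (stepα cα K) K (k + 1) ≤ ρ) (hρb : ρ ≤ b)
    (he : x / θ + cb * rate (effHorizon H R) (logTerm S A K δ) K * effHorizon H R ≤ e)
    (hD : GoodEvent G R (stepα cα K) (stepη cα H R K) (stepIdx n hn) V θ
      (cb * rate (effHorizon H R) (logTerm S A K δ) K) b x D) :
    StepCert G R b e n hn V
      (nextValue G R cb δ (stepα cα K) (stepη cα H R K) (stepIdx n hn) V D)
      (mixedPolicy G R (stepα cα K) (stepη cα H R K) (stepIdx n hn) V D) 0 := by
  set h : Fin H := stepIdx n hn with hh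
  set α := stepα cα K with hα
  set η := stepη cα H R K with hη
  set c := cb * rate (effHorizon H R) (logTerm S A K δ) K with hc
  have hc0 : 0 ≤ c := mul_nonneg hreg.cb_pos.le hreg.rate_pos.le
  have hM := hreg.one_le_M
  have hcM : 0 ≤ c * effHorizon H R := mul_nonneg hc0 (by linarith)
  have hwmem : (fun k : Fin K => mixWeight α K (k + 1)) ∈ stdSimplex ℝ (Fin K) :=
    mixWeight_mem_stdSimplex (mul_pos hreg.cα_pos hreg.log_pos)
      (by have := hreg.K_large; omega)
  have hb0 : 0 ≤ b := by
    have h3 := hw 0 (by have := hreg.K_large; omega)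
    have h4 := mul_nonneg hθ.le (hwmem.1 ⟨0, by have := hreg.K_large; omega⟩)
    exact h4.trans (h3.trans hρb)
  refine ⟨fun i s => ?_, fun i s σ => ?_⟩
  · set X := stepTarget (G.r i h s) R (V i) with hX
    have hj := hD.joint i s
    have hraw := rawValue_eq (G := G) (V := V) hreg η h D i s
    rw [← hα, ← hc] at hraw
    set p : Fin K → ∀ j, stdSimplex ℝ (Fin (A j)) := fun k j => usedPolicy G R α η h V D k j s
      with hp
    have hmeank : ∀ k, wMean (p k i) (fun a => wMean (ownWeight G h (p k) s i a) X) =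
        wMean (stepWeight (prodWeight (p k)) (G.P0 h s)) X := fun k => by
      rw [stepWeight_eq_sum G h (p k) s i, wMean_sum_weights]
    have hmean : wMean (stepWeight (mixedPolicy G R α η h V D s) (G.P0 h s)) X =
        ∑ k : Fin K, mixWeight α K (k + 1) *
          wMean (stepWeight (prodWeight (p k)) (G.P0 h s)) X := by
      rw [stepWeight_mixedPolicy, wMean_sum_weights]
      rfl
    have hvar : ∑ k : Fin K, mixWeight α K (k + 1) *
        wVar (stepWeight (prodWeight (p k)) (G.P0 h s)) X ≤
        wVar (stepWeight (mixedPolicy G R α η h V D s) (G.P0 h s)) X := by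
      rw [stepWeight_mixedPolicy]
      exact wMean_wVar_le hwmem _ _
    have hsum : ∑ k : Fin K, jointExponent G R c b h V i s (θ * mixWeight α K (k + 1)) (p k) (D k)
        = θ * ((∑ k : Fin K, mixWeight α K (k + 1) * (wMean (p k i) (qEst G R h V (D k) i s) +
            c * wVar (p k i) (qEst G R h V (D k) i s))) -
          (∑ k : Fin K, mixWeight α K (k + 1) *
            wMean (stepWeight (prodWeight (p k)) (G.P0 h s)) X) -
          b * ∑ k : Fin K, mixWeight α K (k + 1) *
            wVar (stepWeight (prodWeight (p k)) (G.P0 h s)) X) := by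
      rw [Finset.mul_sum, ← Finset.sum_sub_distrib, ← Finset.sum_sub_distrib, Finset.mul_sum]
      refine Finset.sum_congr rfl fun k _ => ?_
      rw [jointExponent, ← hX, hmeank]
      ring
    have h1 : nextValue G R cb δ α η h V D i s ≤ rawValue G R cb δ α η h V D i s := by
      rw [hh, nextValue_eq]
      exact min_le_left _ _
    rw [hsum, ← le_div_iff₀' hθ, ← hmean] at hj
    have h2 := mul_le_mul_of_nonneg_left hvar hb0
    rw [hraw] at h1
    linarith
  · set X := stepTarget (G.r i h s) R (V i) with hX
    set p : Fin K → ∀ j, stdSimplex ℝ (Fin (A j)) := fun k j => usedPolicy G R α η h V D k j s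
      with hp
    have hμd : ∀ x, (∑ k : Fin K, mixWeight α K (k + 1) *
        stepWeight (prodWeight (Function.update (p k) i σ)) (G.P0 h s) x) =
        ∑ a, σ a * ∑ k : Fin K, mixWeight α K (k + 1) * ownWeight G h (p k) s i a x := by
      intro x
      simp only [stepWeight_update_eq_sum, Finset.mul_sum]
      rw [Finset.sum_comm]
      exact Finset.sum_congr rfl fun a _ => Finset.sum_congr rfl fun k _ => by ring
    have hlaw : stepWeight (devWeight i σ (mixedPolicy G R α η h V D s)) (G.P0 h s) =
        fun x => ∑ a, σ a * ∑ k : Fin K, mixWeight α K (k + 1) * ownWeight G h (p k) s i a x := by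
      rw [stepWeight_devWeight_mixedPolicy]
      exact funext hμd
    have hmean : wMean (stepWeight (devWeight i σ (mixedPolicy G R α η h V D s)) (G.P0 h s)) X =
        wMean σ (fun a => ∑ k : Fin K, mixWeight α K (k + 1) *
          wMean (ownWeight G h (p k) s i a) X) := by
      rw [hlaw, wMean_sum_weights σ]
      congr 1
      funext a
      rw [wMean_sum_weights]
      rfl
    have hvar : wMean σ (fun a => ∑ k : Fin K, mixWeight α K (k + 1) *
          wVar (ownWeight G h (p k) s i a) X) ≤
        wVar (stepWeight (devWeight i σ (mixedPolicy G R α η h V D s)) (G.P0 h s)) X := by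
      rw [hlaw]
      refine le_trans (wMean_mono (coe_mem_stdSimplex σ) fun a => ?_)
        (wMean_wVar_le (coe_mem_stdSimplex σ)
          (fun a x => ∑ k : Fin K, mixWeight α K (k + 1) * ownWeight G h (p k) s i a x) X)
      exact wMean_wVar_le hwmem (fun k => ownWeight G h (p k) s i a) X
    have hbound : ∀ a, ∑ k : Fin K, mixWeight α K (k + 1) * wMean (ownWeight G h (p k) s i a) X ≤
        b * (∑ k : Fin K, mixWeight α K (k + 1) * wVar (ownWeight G h (p k) s i a) X) +
          (rawValue G R cb δ α η h V D i s + x / θ) := by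
      intro a
      have ho := hD.own i s a
      have hreg' := sum_qEst_le_rawValue (G := G) hR hR1 hreg hV h D i (hA i) s a
      have hle : θ * ((∑ k : Fin K, mixWeight α K (k + 1) *
            wMean (ownWeight G h (p k) s i a) X) -
          (∑ k : Fin K, mixWeight α K (k + 1) * qEst G R h V (D k) i s a) -
          b * ∑ k : Fin K, mixWeight α K (k + 1) * wVar (ownWeight G h (p k) s i a) X) ≤
          ∑ k : Fin K, ownExponent G R h V i s a (θ * mixWeight α K (k + 1)) (p k) (D k) := by
        rw [Finset.mul_sum, ← Finset.sum_sub_distrib, ← Finset.sum_sub_distrib, Finset.mul_sum]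
        refine Finset.sum_le_sum fun k _ => ?_
        rw [ownExponent, ← hX]
        have h1 := wVar_nonneg (ownWeight_mem_stdSimplex G h (p k) s i a) X
        have h2 := hwmem.1 k
        -- The quadratic weight in the exponent is linearised here, at the cost of the largest
        -- weighted step.
        have h3 : θ * mixWeight α K (k + 1) ≤ b := (hw k k.2).trans hρb
        have h4 := mul_le_mul_of_nonneg_right h3 (mul_nonneg (mul_nonneg hθ.le h2) h1)
        nlinarith
      have h5 := hle.trans ho
      rw [← le_div_iff₀' hθ] at h5
      linarith
    have hmono := wMean_mono (coe_mem_stdSimplex σ) hbound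
    rw [wMean_add, wMean_mul_left, wMean_const (coe_mem_stdSimplex σ), ← hmean] at hmono
    have h2 := mul_le_mul_of_nonneg_left hvar hb0
    rw [sub_zero, sub_le_iff_le_add, hh, nextValue_eq, ← hh]
    have hx : x / θ ≤ e := by linarith
    have he0 : 0 ≤ e := (div_nonneg hx0 hθ.le).trans hx
    -- Truncation only helps: when the estimate is capped, the bound by `n + 1` inside the
    -- certificate takes over.
    rcases le_total (rawValue G R cb δ α η h V D i s) (n + 1) with h6 | h6
    · rw [min_eq_left h6]
      refine (min_le_left _ _).trans ?_
      linarith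
    · rw [min_eq_right h6]
      exact (min_le_right _ _).trans (by linarith)

end Certificate

/-! ### The law of the output -/

section OutputLaw

variable {m S H : ℕ} {A : Fin m → ℕ} [∀ i, NeZero (A i)]

/-- Serves the game without players, where no invariant of the value estimates is available. -/
theorem backwardLaw_policy (G : Game m S H A) (R cb δ : ℝ) {K : ℕ} (hK : K ≠ 0) {c : ℝ}
    (hc : 0 < c) (η : ℕ → ℝ) (n : ℕ) (hn : n ≤ H) :
    ∀ z ∈ (backwardLaw G R cb δ K (harmStep c) η n hn).support, IsPolicyOnLast n z.2 := by
  induction n with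
  | zero =>
    intro z _ t ht
    exact absurd t.2 (by omega)
  | succ n ih =>
    intro z hz t ht s
    simp only [backwardLaw, PMF.mem_support_bind_iff, PMF.support_map, Set.mem_image] at hz
    obtain ⟨y, hy, D, _, rfl⟩ := hz
    by_cases h1 : t = stepIdx n hn
    · subst h1
      simp only [Function.update_self]
      exact mixedPolicy_mem_stdSimplex G R hc η _ _ hK D s
    · have h2 := ih (Nat.le_of_succ_le hn) y hy t (by
        have : (t : ℕ) ≠ H - (n + 1) := fun h2 => h1 (Fin.ext h2)
        omega) s
      simp only
      rw [Function.update_of_ne h1]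
      exact h2

variable [NeZero S]

/-- The backward recursion can be run together with a counter of failed steps such that the
invariant holds with slack proportional to the counter. -/
theorem exists_counted_backwardLaw {G : Game m S H A} {R cα cb δ : ℝ} {K : ℕ} (hR : 0 ≤ R)
    (hR1 : R ≤ 1) (hMR : effHorizon H R = H ∨ R * effHorizon H R = 1)
    (hreg : Regime cα cb (effHorizon H R) (logTerm S A K δ) K) {η : ℕ → ℝ} {l e e' : ℝ}
    {P : ENNReal} (hl0 : 0 ≤ l) (hl : 12 * (l * effHorizon H R) ≤ 1) (he : 0 ≤ e)
    (he' : e' = 9 * (l * effHorizon H R) + l + e)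
    (hP : ∀ (n : ℕ) (hn : n + 1 ≤ H) (V : Fin m → Fin S → ℝ), ValueRange (effHorizon H R) n V →
      (roundsLaw G R (stepα cα K) η (stepIdx n hn) V K).toOuterMeasure
        {D | ¬ StepCert G R l e n hn V (nextValue G R cb δ (stepα cα K) η (stepIdx n hn) V D)
          (mixedPolicy G R (stepα cα K) η (stepIdx n hn) V D) 0} ≤ P) (n : ℕ) (hn : n ≤ H) :
    ∃ q : PMF (((Fin m → Fin S → ℝ) × JointWeights S H A) × ℕ),
      q.map Prod.fst = backwardLaw G R cb δ K (stepα cα K) η n hn ∧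
      (∀ z ∈ q.support, BackwardInv G R (effHorizon H R) l e' n hn z.1.1 z.1.2
        (4 * effHorizon H R * z.2)) ∧
      pmfMean q (fun z => (z.2 : ENNReal)) ≤ n * P := by
  classical
  have hM := hreg.one_le_M
  induction n with
  | zero =>
    refine ⟨PMF.pure ((fun _ _ => 0, fun _ _ _ => 0), 0), by rw [PMF.pure_map]; rfl, ?_, ?_⟩
    · intro z hz
      rw [PMF.support_pure, Set.mem_singleton_iff] at hz
      subst hz
      refine ⟨fun t ht => absurd t.2 (by omega), ⟨fun i s => le_rfl, fun i s => by simp,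
        fun i s s' => by simp; linarith⟩, fun i s => ?_, fun i π' s => ?_⟩
      · simp [robustDP, excess]
      · simp [robustDP, excess]
    · rw [pmfMean_pure]
      simp
  | succ n ih =>
    obtain ⟨q, hq1, hq2, hq3⟩ := ih (Nat.le_of_succ_le hn)
    -- The counter is a function of the same samples, so forgetting it recovers the original law. A
    -- good step has slack `0`, any other step slack `4 M`.
    let good : (Fin m → Fin S → ℝ) → (Fin K → Draw S A) → Prop := fun V D =>
      StepCert G R l e n hn V (nextValue G R cb δ (stepα cα K) η (stepIdx n hn) V D)
          (mixedPolicy G R (stepα cα K) η (stepIdx n hn) V D) 0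
    refine ⟨q.bind fun z => (roundsLaw G R (stepα cα K) η (stepIdx n hn) z.1.1 K).map fun D =>
      ((nextValue G R cb δ (stepα cα K) η (stepIdx n hn) z.1.1 D,
        Function.update z.1.2 (stepIdx n hn)
          (mixedPolicy G R (stepα cα K) η (stepIdx n hn) z.1.1 D)),
        z.2 + if good z.1.1 D then 0 else 1), ?_, ?_, ?_⟩
    · rw [PMF.map_bind]
      simp only [backwardLaw, ← hq1, PMF.bind_map, PMF.map_comp]
      rfl
    · intro z hz
      simp only [PMF.mem_support_bind_iff, PMF.support_map, Set.mem_image] at hz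
      obtain ⟨y, hy, D, _, rfl⟩ := hz
      have hinv := hq2 y hy
      have hrange := (nextValue_range (G := G) hR hR1 hMR hreg η hn hinv.range D).1
      have hμ : ∀ s, mixedPolicy G R (stepα cα K) η (stepIdx n hn) y.1.1 D s ∈
          stdSimplex ℝ (JointAction A) := fun s =>
        mixedPolicy_mem_stdSimplex G R (mul_pos hreg.cα_pos hreg.log_pos) η _ _
          (by have := hreg.K_large; omega) D s
      have hx : 0 ≤ 4 * effHorizon H R * (y.2 : ℝ) := by positivity
      by_cases hg : good y.1.1 D
      · have := hinv.step hR hR1 hM hMR hl0 hl he he' hn hx hg hrange hμ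
        simpa [hg] using this
      · have := hinv.step hR hR1 hM hMR hl0 hl he he' hn hx
          (stepCert_of_large_slack hR hR1 hMR hreg η hn hinv.range D hl0 he) hrange hμ
        simpa [hg, mul_add] using this
    · rw [pmfMean_bind]
      have hstep : ∀ z ∈ q.support, pmfMean
          ((roundsLaw G R (stepα cα K) η (stepIdx n hn) z.1.1 K).map fun D =>
            ((nextValue G R cb δ (stepα cα K) η (stepIdx n hn) z.1.1 D,
              Function.update z.1.2 (stepIdx n hn)
                (mixedPolicy G R (stepα cα K) η (stepIdx n hn) z.1.1 D)),
              z.2 + if good z.1.1 D then 0 else 1)) (fun z => (z.2 : ENNReal)) ≤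
          (z.2 : ENNReal) + P := by
        intro z hz
        rw [pmfMean_map]
        have e1 : (fun D => ((z.2 + if good z.1.1 D then 0 else 1 : ℕ) : ENNReal)) =
            fun D => (z.2 : ENNReal) + {D | ¬ good z.1.1 D}.indicator 1 D := by
          funext D
          by_cases hg : good z.1.1 D <;> simp [hg]
        simp only at e1 ⊢
        rw [e1, pmfMean_add, pmfMean_const, ← toOuterMeasure_eq_pmfMean]
        gcongr
        exact hP n hn z.1.1 (hq2 z hz).range
      refine (pmfMean_mono_support q hstep).trans ?_
      rw [pmfMean_add, pmfMean_const]
      push_cast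
      rw [add_mul, one_mul]
      gcongr

/-- The regular error uses half of `ε`, so a failure forces `ε < 16 M * z` with `z` the number of
failed steps. Markov's inequality gives the factor `16 M / ε` in front of the expected count `H *
P`. -/
theorem isRobustCCE_probability {G : Game m S H A} {R cα cb δ ε : ℝ} {K : ℕ} (hR : 0 ≤ R)
    (hR1 : R ≤ 1) (hMR : effHorizon H R = H ∨ R * effHorizon H R = 1)
    (hreg : Regime cα cb (effHorizon H R) (logTerm S A K δ) K) {η : ℕ → ℝ} {l e e' P : ℝ}
    (hl0 : 0 ≤ l) (hl : 12 * (l * effHorizon H R) ≤ 1) (he : 0 ≤ e)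
    (he' : e' = 9 * (l * effHorizon H R) + l + e)
    (hP : ∀ (n : ℕ) (hn : n + 1 ≤ H) (V : Fin m → Fin S → ℝ), ValueRange (effHorizon H R) n V →
      (roundsLaw G R (stepα cα K) η (stepIdx n hn) V K).toOuterMeasure
        {D | ¬ StepCert G R l e n hn V (nextValue G R cb δ (stepα cα K) η (stepIdx n hn) V D)
          (mixedPolicy G R (stepα cα K) η (stepIdx n hn) V D) 0} ≤ ENNReal.ofReal P)
    (hε : 0 < ε) (hεe : 4 * (H * e') ≤ ε)
    (hδP : 16 * effHorizon H R / ε * (H * P) ≤ δ) (hδ0 : 0 ≤ δ) :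
    ENNReal.ofReal (1 - δ) ≤ (robustQFTRL G R cb δ K (stepα cα K) η).toOuterMeasure
      {π | IsRobustCCE G R ε π} := by
  classical
  have hM := hreg.one_le_M
  obtain ⟨q, hq1, hq2, hq3⟩ := exists_counted_backwardLaw hR hR1 hMR hreg hl0 hl he he' hP H le_rfl
  have hbad : (robustQFTRL G R cb δ K (stepα cα K) η).toOuterMeasure
      {π | IsRobustCCE G R ε π}ᶜ ≤ ENNReal.ofReal δ := by
    rw [toOuterMeasure_eq_pmfMean, robustQFTRL, pmfMean_map, ← hq1, pmfMean_map]
    have hle : ∀ z ∈ q.support,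
        ({π | IsRobustCCE G R ε π}ᶜ : Set (JointWeights S H A)).indicator
          (1 : JointWeights S H A → ENNReal) z.1.2 ≤
        ENNReal.ofReal (16 * effHorizon H R / ε) * (z.2 : ENNReal) := by
      intro z hz
      by_cases hcce : IsRobustCCE G R ε z.1.2
      · rw [Set.indicator_of_notMem (by simpa using hcce)]
        exact zero_le
      · rw [Set.indicator_of_mem (by simpa using hcce), Pi.one_apply]
        have h1 : ε < 16 * effHorizon H R * z.2 := by
          by_contra h2
          exact hcce ((hq2 z hz).gap_le hR hR1 hl0 (by linarith) hε.le)
        have h3 : 1 ≤ 16 * effHorizon H R / ε * (z.2 : ℝ) := by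
          rw [div_mul_eq_mul_div, one_le_div hε]
          exact h1.le
        calc (1 : ENNReal) = ENNReal.ofReal 1 := ENNReal.ofReal_one.symm
          _ ≤ ENNReal.ofReal (16 * effHorizon H R / ε * (z.2 : ℝ)) :=
              ENNReal.ofReal_le_ofReal h3
          _ = _ := by
              rw [ENNReal.ofReal_mul (by positivity), ENNReal.ofReal_natCast]
    refine (pmfMean_mono_support q hle).trans ?_
    rw [pmfMean_mul_left]
    calc ENNReal.ofReal (16 * effHorizon H R / ε) * pmfMean q (fun z => (z.2 : ENNReal))
        ≤ ENNReal.ofReal (16 * effHorizon H R / ε) * (H * ENNReal.ofReal P) := by gcongr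
      _ = ENNReal.ofReal (16 * effHorizon H R / ε * (H * P)) := by
          rw [ENNReal.ofReal_mul (by positivity), ENNReal.ofReal_mul (by positivity),
            ENNReal.ofReal_natCast]
      _ ≤ ENNReal.ofReal δ := ENNReal.ofReal_le_ofReal hδP
  have htot := toOuterMeasure_add_compl (robustQFTRL G R cb δ K (stepα cα K) η)
    {π | IsRobustCCE G R ε π}
  rw [ENNReal.ofReal_sub _ hδ0, ENNReal.ofReal_one, tsub_le_iff_right, ← htot]
  gcongr

end OutputLaw

/-! ### Choice of constants -/

theorem one_le_effHorizon {H : ℕ} (hH : 1 ≤ H) {R : ℝ} (hR : 0 ≤ R) (hR1 : R < 1) :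
    1 ≤ effHorizon H R := by
  have h1 : (1 : ℝ) ≤ H := by exact_mod_cast hH
  rw [effHorizon]
  split_ifs with h0
  · exact h1
  · have hpos : 0 < R := lt_of_le_of_ne hR (Ne.symm h0)
    exact le_min h1 ((one_le_div hpos).2 hR1.le)

theorem effHorizon_eq_or (H : ℕ) (R : ℝ) :
    effHorizon H R = H ∨ R * effHorizon H R = 1 := by
  rw [effHorizon]
  split_ifs with h0
  · exact Or.inl rfl
  · rcases min_choice (H : ℝ) (1 / R) with h | h
    · exact Or.inl h
    · right
      rw [h]
      field_simp

/-- A lower bound on the logarithm of the number of rounds. -/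
def logThreshold (cα cb : ℝ) : ℝ := 4 + 1 / cα + 4 * cα / cb ^ 2 * Real.exp (2 / cα)

/-- The error per step in units of `rate * M`. -/
def errConst (cα cb : ℝ) : ℝ := 10 * (2 * cb + 2) + (3 * cα + cb)

/-- The constant in the sample complexity. -/
def sampleConst (cα cb : ℝ) : ℝ :=
  4 * Real.exp (logThreshold cα cb) + 2 * cα * Real.exp (2 / cα) + (24 * (cb + 1)) ^ 2 +
    36 / cb ^ 2 + 16 * errConst cα cb ^ 2 + 1

section Constants

variable {cα cb M L : ℝ} {K : ℕ}

theorem sampleConst_bounds (hcα : 0 < cα) (hcb : 0 < cb) :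
    4 * Real.exp (logThreshold cα cb) ≤ sampleConst cα cb ∧
    2 * cα * Real.exp (2 / cα) ≤ sampleConst cα cb ∧
    (24 * (cb + 1)) ^ 2 ≤ sampleConst cα cb ∧
    36 / cb ^ 2 ≤ sampleConst cα cb ∧
    16 * errConst cα cb ^ 2 ≤ sampleConst cα cb ∧ 1 ≤ sampleConst cα cb := by
  have h1 : 0 ≤ 4 * Real.exp (logThreshold cα cb) := by positivity
  have h2 : 0 ≤ 2 * cα * Real.exp (2 / cα) := by positivity
  have h3 : 0 ≤ (24 * (cb + 1)) ^ 2 := by positivity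
  have h4 : 0 ≤ 36 / cb ^ 2 := by positivity
  have h5 : 0 ≤ 16 * errConst cα cb ^ 2 := by positivity
  rw [sampleConst]
  refine ⟨?_, ?_, ?_, ?_, ?_, ?_⟩ <;> linarith

theorem Regime.of_large (hcα : 0 < cα) (hcb : 0 < cb) (hM : 1 ≤ M) (hK : 2 ≤ K)
    (hlog : Real.log K ≤ L) (hC : sampleConst cα cb * (M * L ^ 3) ≤ K) :
    Regime cα cb M L K := by
  obtain ⟨h1, h2, h3, h4, -, h6⟩ := sampleConst_bounds hcα hcb
  set C := sampleConst cα cb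
  have hK2 : (2 : ℝ) ≤ K := by exact_mod_cast hK
  have hK0 : (0 : ℝ) < K := by linarith
  have hM0 : 0 < M := by linarith
  have hl2 : (0.69 : ℝ) ≤ Real.log K := by
    have := Real.log_two_gt_d9
    have h7 := Real.log_le_log (by norm_num) hK2
    linarith
  have hL0 : 0.69 ≤ L := hl2.trans hlog
  -- From `K ≥ 2` alone, `L ≥ log 2 > 0.69`. This crude start, compensated by the factor `4` in
  -- `sampleConst`, gives `exp (logThreshold cα cb) ≤ K` and thereby all stronger bounds on `log K`.
  have hL3 : 1 / 4 ≤ L ^ 3 := by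
    have : (0.69 : ℝ) ^ 3 ≤ L ^ 3 := pow_le_pow_left₀ (by norm_num) hL0 3
    refine le_trans ?_ this
    norm_num
  have hKexp : Real.exp (logThreshold cα cb) ≤ K := by
    have h7 : C * (1 * (1 / 4)) ≤ C * (M * L ^ 3) := by gcongr
    linarith
  have hlogK : logThreshold cα cb ≤ Real.log K := by
    rw [Real.le_log_iff_exp_le hK0]
    exact hKexp
  have e1 : 0 < 1 / cα := by positivity
  have e2 : 0 < 4 * cα / cb ^ 2 * Real.exp (2 / cα) := by positivity
  have hT4 : 4 ≤ Real.log K := by rw [logThreshold] at hlogK; linarith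
  have hL1 : 1 ≤ L := by linarith
  have hLL3 : L ≤ L ^ 3 := by nlinarith [sq_nonneg L, sq_nonneg (L - 1)]
  have hL31 : 1 ≤ L ^ 3 := hL1.trans hLL3
  have hCML : C * (M * L ^ 3) ≤ K := hC
  have hρ2 : rate M L K ^ 2 = L ^ 3 / (K * M) := Real.sq_sqrt (by positivity)
  have hρ0 : 0 ≤ rate M L K := Real.sqrt_nonneg _
  refine ⟨hcα, hcb, ?_, hM, hL1, hlog, ?_, ?_, ?_, ?_, ?_, ?_⟩
  · have h7 : Real.exp 4 ≤ K := (Real.exp_le_exp.2 hT4).trans (Real.exp_log hK0).le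
    have h8 : (2.7 : ℝ) ^ 4 ≤ Real.exp 4 := by
      have : Real.exp 4 = Real.exp 1 ^ 4 := by
        rw [← Real.exp_nat_mul]; norm_num
      rw [this]
      exact pow_le_pow_left₀ (by norm_num) (by linarith [Real.exp_one_gt_d9]) 4
    have h9 : (32 : ℝ) ≤ K := le_trans (by norm_num) (h8.trans h7)
    exact_mod_cast h9
  · have h7 : 1 / cα ≤ Real.log K := by rw [logThreshold] at hlogK; linarith
    rw [div_le_iff₀ hcα] at h7
    linarith
  · have h7 : 2 * cα * Real.exp (2 / cα) * L ≤ K := by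
      calc 2 * cα * Real.exp (2 / cα) * L ≤ C * (1 * L ^ 3) := by
            rw [one_mul]; gcongr
        _ ≤ C * (M * L ^ 3) := by gcongr
        _ ≤ K := hC
    rw [Real.exp_neg, inv_mul_eq_div, le_div_iff₀ (Real.exp_pos _)]
    have h8 : 2 * cα * Real.exp (2 / cα) * Real.log K ≤ 2 * cα * Real.exp (2 / cα) * L := by
      gcongr
    linarith
  · rw [Real.exp_neg, inv_mul_eq_div, le_div_iff₀ (Real.exp_pos _)]
    rw [logThreshold] at hlogK
    linarith
  · refine abs_le_one_iff_mul_self_le_one.2 ?_ |> (abs_le.1 · |>.2)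
    have h7 : L ^ 3 * M / K * C ≤ 1 := by
      rw [div_mul_eq_mul_div, div_le_one hK0]
      linarith
    have e : 24 * (cb + 1) * (rate M L K * M) * (24 * (cb + 1) * (rate M L K * M)) =
        L ^ 3 * M / K * (24 * (cb + 1)) ^ 2 := by
      have : 24 * (cb + 1) * (rate M L K * M) * (24 * (cb + 1) * (rate M L K * M)) =
          rate M L K ^ 2 * M ^ 2 * (24 * (cb + 1)) ^ 2 := by ring
      rw [this, hρ2]
      field_simp
    rw [e]
    refine le_trans ?_ h7
    gcongr
  · refine (pow_le_pow_iff_left₀ (by norm_num) (by positivity) two_ne_zero).1 ?_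
    have e : (cb * rate M L K * K) ^ 2 = cb ^ 2 * (L ^ 3 * (K / M)) := by
      rw [mul_pow, mul_pow, hρ2]
      field_simp
    rw [e]
    have h7 : C ≤ K / M := by
      rw [le_div_iff₀ hM0]
      refine le_trans ?_ hC
      have : C * (M * 1) ≤ C * (M * L ^ 3) := by gcongr
      linarith
    have h8 : 36 ≤ cb ^ 2 * (K / M) := by
      have h9 := h4.trans h7
      rw [div_le_iff₀ (by positivity)] at h9
      linarith
    have h10 : 0 ≤ cb ^ 2 * (K / M) := by positivity
    nlinarith
  · have : 1 * (M * 1) ≤ C * (M * L ^ 3) := by gcongr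
    linarith

theorem Regime.four_mul_errConst_le (hreg : Regime cα cb M L K) {H ε : ℝ} (hε : 0 < ε)
    (hC : sampleConst cα cb * (M * L ^ 3) * H ^ 2 ≤ K * ε ^ 2) :
    4 * (H * (errConst cα cb * (rate M L K * M))) ≤ ε := by
  refine le_of_abs_le (abs_le_of_sq_le_sq ?_ hε.le)
  have hM := hreg.one_le_M
  have hL := hreg.one_le_L
  have hK0 : (0 : ℝ) < K := by
    have : (32 : ℝ) ≤ K := by exact_mod_cast hreg.K_large
    linarith
  have hM0 : 0 < M := by linarith
  have e1 : (4 * (H * (errConst cα cb * (rate M L K * M)))) ^ 2 =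
      16 * errConst cα cb ^ 2 * (M * L ^ 3) * H ^ 2 / K := by
    have : (4 * (H * (errConst cα cb * (rate M L K * M)))) ^ 2 =
        16 * errConst cα cb ^ 2 * H ^ 2 * M ^ 2 * rate M L K ^ 2 := by ring
    rw [this, hreg.rate_sq]
    field_simp
  rw [e1, div_le_iff₀ hK0]
  have h1 := (sampleConst_bounds hreg.cα_pos hreg.cb_pos).2.2.2.2.1
  have h2 : 0 ≤ M * L ^ 3 * H ^ 2 := by positivity
  have h3 := mul_le_mul_of_nonneg_right h1 h2
  linarith

/-- The cube is `exp (-(3 L))`. Two of its three factors `1 / K` absorb `M ≤ K` and `H / ε ≤ K`, the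
third absorbs the constant `32`. No comparison of `H` itself with `K` is needed. -/
theorem Regime.failure_le (hreg : Regime cα cb M L K) {H ε δ N : ℝ} (hε : 0 < ε) (hεH : ε ≤ H)
    (hC : sampleConst cα cb * (M * L ^ 3) * H ^ 2 ≤ K * ε ^ 2) (hδ : 0 < δ) (hδ1 : δ < 1)
    (hN : 1 ≤ N) : 16 * M / ε * (H * (2 * N * (δ / (K * N)) ^ 3)) ≤ δ := by
  have hK32 : (32 : ℝ) ≤ K := by exact_mod_cast hreg.K_large
  have hK0 : (0 : ℝ) < K := by linarith
  have hN0 : 0 < N := by linarith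
  have hM := hreg.one_le_M
  have hH0 : 0 < H := hε.trans_le hεH
  have hHε : H / ε ≤ K := by
    have h1 : (H / ε) ^ 2 ≤ K := by
      rw [div_pow, div_le_iff₀ (by positivity)]
      refine le_trans ?_ hC
      exact le_mul_of_one_le_left (sq_nonneg H)
        (one_le_mul_of_one_le_of_one_le (sampleConst_bounds hreg.cα_pos hreg.cb_pos).2.2.2.2.2
          (one_le_mul_of_one_le_of_one_le hM (one_le_pow₀ hreg.one_le_L)))
    have h4 : 1 ≤ H / ε := (one_le_div hε).2 hεH
    nlinarith
  calc 16 * M / ε * (H * (2 * N * (δ / (K * N)) ^ 3))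
      = 32 * M * (H / ε) * (N * (δ / (K * N)) ^ 3) := by ring
    _ ≤ 32 * K * K * (N * (δ / (K * N)) ^ 3) := by
        have := hreg.M_le
        gcongr
    _ = 32 * δ ^ 3 / (K * N ^ 2) := by
        field_simp
    _ ≤ δ := by
        rw [div_le_iff₀ (by positivity)]
        have h5 : δ ^ 3 ≤ δ := pow_le_of_le_one hδ.le hδ1.le three_ne_zero
        have h6 : 32 * 1 ≤ K * N ^ 2 := mul_le_mul hK32 (one_le_pow₀ hN) zero_le_one hK0.le
        nlinarith

/-- This is the deviation term `x / θ` for `x = 3 L` and the scale `θ = rate * K / (cα * L)`; the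
identity `rate ^ 2 * K * M = L ^ 3` brings it to the order `rate * M` of the other errors. -/
theorem Regime.three_mul_div_le (hreg : Regime cα cb M L K) :
    3 * L / (rate M L K * K / (cα * L)) ≤ 3 * cα * (rate M L K * M) := by
  have hρ := hreg.rate_pos
  have hL := hreg.one_le_L
  have hM := hreg.one_le_M
  have hcα := hreg.cα_pos
  have hK0 : (0 : ℝ) < K := by
    have : (32 : ℝ) ≤ K := by exact_mod_cast hreg.K_large
    linarith
  have e : 3 * L / (rate M L K * K / (cα * L)) = 3 * cα * (rate M L K * M) / L := by
    have h1 : rate M L K ^ 2 * (K * M) = L ^ 3 := by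
      rw [hreg.rate_sq]; field_simp
    rw [div_div_eq_mul_div, div_eq_div_iff (by positivity) (by positivity)]
    have h2 : 3 * cα * (rate M L K * M) * (rate M L K * K) =
        3 * cα * (rate M L K ^ 2 * (K * M)) := by ring
    rw [h2, h1]
    ring
  rw [e]
  exact div_le_self (by positivity) hL

end Constants

/-! ### Sample complexity of robust Q-FTRL -/

section Main

variable {m S H : ℕ} {A : Fin m → ℕ} [∀ i, NeZero (A i)]

/-- Without players the sum of the `A i` is `0` and both sides of the sample condition vanish, so
nothing is known about `K`. The gap, however, is a supremum over an empty family, with value `0`. -/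
theorem robustQFTRL_of_isEmpty (hm : m = 0) (G : Game m S H A) {R cα cb δ ε : ℝ} {K : ℕ}
    (hcα : 0 < cα) (hε : 0 ≤ ε) (hδ : 0 ≤ δ) (hK : 2 ≤ K) (η : ℕ → ℝ) :
    ENNReal.ofReal (1 - δ) ≤ (robustQFTRL G R cb δ K (stepα cα K) η).toOuterMeasure
      {π | IsRobustCCE G R ε π} := by
  subst hm
  have hlog : 0 < Real.log K := Real.log_pos (by exact_mod_cast hK)
  have hsub : (robustQFTRL G R cb δ K (stepα cα K) η).support ⊆ {π | IsRobustCCE G R ε π} := by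
    intro π hπ
    rw [robustQFTRL, PMF.support_map] at hπ
    obtain ⟨z, hz, rfl⟩ := hπ
    refine ⟨fun t s => backwardLaw_policy G R cb δ (by omega) (mul_pos hcα hlog) η H le_rfl z hz t
      (by simp) s, ?_⟩
    exact Real.iSup_le (fun s => Real.iSup_le (fun i => i.elim0) hε) hε
  rw [(PMF.toOuterMeasure_apply_eq_one_iff _ _).2 hsub, ← ENNReal.ofReal_one]
  exact ENNReal.ofReal_le_ofReal (by linarith)

theorem Regime.toOuterMeasure_not_stepCert_le [NeZero S] (G : Game m S H A) {R cα cb δ : ℝ} {K : ℕ}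
    (hreg : Regime cα cb (effHorizon H R) (logTerm S A K δ) K) (hR : 0 ≤ R) (hR1 : R ≤ 1)
    (hA : ∀ i, Real.log (A i) ≤ logTerm S A K δ) (n : ℕ) (hn : n + 1 ≤ H)
    {V : Fin m → Fin S → ℝ} (hV : ValueRange (effHorizon H R) n V) :
    (roundsLaw G R (stepα cα K) (stepη cα H R K) (stepIdx n hn) V K).toOuterMeasure
      {D | ¬ StepCert G R ((2 * cb + 2) * rate (effHorizon H R) (logTerm S A K δ) K)
        ((3 * cα + cb) * (rate (effHorizon H R) (logTerm S A K δ) K * effHorizon H R)) n hn V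
        (nextValue G R cb δ (stepα cα K) (stepη cα H R K) (stepIdx n hn) V D)
        (mixedPolicy G R (stepα cα K) (stepη cα H R K) (stepIdx n hn) V D) 0} ≤
      ENNReal.ofReal (2 * (S * ∑ i, (A i : ℝ)) * Real.exp (-(3 * logTerm S A K δ))) := by
  have hρ := hreg.rate_pos
  have hxθ := hreg.three_mul_div_le
  have hsm1 := hreg.rate_mul_M_small
  have hsm2 := hreg.cb_rate_mul_M_small
  have hL1 := hreg.one_le_L
  have hM := hreg.one_le_M
  have hcα := hreg.cα_pos
  have hcb := hreg.cb_pos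
  have hK0 := hreg.K_pos
  have hlog := hreg.log_le
  have hsub := fun D => stepCert_of_goodEvent (G := G) (V := V)
    (e := (3 * cα + cb) * (rate (effHorizon H R) (logTerm S A K δ) K * effHorizon H R))
    (b := (2 * cb + 2) * rate (effHorizon H R) (logTerm S A K δ) K)
    (x := 3 * logTerm S A K δ) (ρ := rate (effHorizon H R) (logTerm S A K δ) K)
    (θ := rate (effHorizon H R) (logTerm S A K δ) K * K / (cα * logTerm S A K δ))
    hR hR1 hreg hA hn hV.span D
  generalize rate (effHorizon H R) (logTerm S A K δ) K = ρ at *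
  generalize logTerm S A K δ = L at *
  have hspan := hV.span
  generalize effHorizon H R = M at *
  -- The mixing weights are at most `cα * L / K`, so this scale makes the largest exponent weight `θ
  -- * mixWeight` at most `ρ`.
  obtain ⟨θ, hθ⟩ : ∃ θ, θ = ρ * K / (cα * L) := ⟨_, rfl⟩
  rw [← hθ] at hxθ hsub
  have hθ0 : 0 < θ := by rw [hθ]; positivity
  have hρM : 0 ≤ ρ * M := by positivity
  have hcρ : 0 ≤ cb * ρ := by positivity
  have hcρM : 0 ≤ cb * ρ * M := by positivity
  have hprod : 24 * (cb * ρ * M) * (24 * (ρ * M)) ≤ 1 :=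
    mul_le_one₀ hsm2 (by positivity) hsm1
  have hw0 : ∀ k < K, 0 ≤ θ * mixWeight (stepα cα K) K (k + 1) := fun k _ =>
    mul_nonneg hθ0.le (mixWeight_nonneg (mul_pos hcα hreg.log_pos) K k)
  have hw : ∀ k < K, θ * mixWeight (stepα cα K) K (k + 1) ≤ ρ := fun k hk => by
    have h1 : mixWeight (stepα cα K) K (k + 1) ≤ cα * Real.log K / K :=
      mixWeight_le hreg.one_le_c hk
    calc θ * mixWeight (stepα cα K) K (k + 1) ≤ θ * (cα * L / K) := by
          refine mul_le_mul_of_nonneg_left (h1.trans ?_) hθ0.le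
          gcongr
      _ = ρ := by rw [hθ]; field_simp
  refine le_trans ?_
    (toOuterMeasure_not_goodEvent_le (G := G) (η := stepη cα H R K) (h := stepIdx n hn)
      (θ := θ) (c := cb * ρ) (b := (2 * cb + 2) * ρ) (x := 3 * L) (ρ := ρ) hR hR1 hM hspan
      hw0 hw hcρ ?_ ?_)
  · refine MeasureTheory.OuterMeasure.mono _ fun D hD hgood => hD ?_
    exact hsub D hθ0 (by positivity) hw (by linarith) (by linarith) hgood
  · have e1 : ρ * (cb * ρ) * (3 * M) ^ 2 = 9 * ((cb * ρ * M) * (ρ * M)) := by ring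
    rw [e1]
    linarith
  -- Explains the coefficient `2 * cb + 2`: with `c = cb * ρ` the requirement is `c + 2 ρ` plus a
  -- third-order term, itself at most `cb * ρ` because `ρ M` and `cb * ρ * M` are at most `1 / 24`.
  · have e1 : 2 * ρ * (cb * ρ) ^ 2 * (3 * M) ^ 2 =
        cb * ρ * (18 * (cb * ρ * M) * (ρ * M)) := by ring
    have h2 : cb * ρ * (18 * (cb * ρ * M) * (ρ * M)) ≤ cb * ρ * 1 :=
      mul_le_mul_of_nonneg_left (by linarith) hcρ
    rw [e1]
    linarith

theorem robustQFTRL_isRobustCCE [NeZero S] (G : Game m S H A) {R cα cb δ ε : ℝ} {K : ℕ} (hm : m ≠ 0)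
    (hcα : 0 < cα) (hcb : 0 < cb) (hR : 0 ≤ R) (hR1 : R < 1) (hε : 0 < ε) (hεH : ε ≤ H)
    (hδ : 0 < δ) (hδ1 : δ < 1) (hK : 2 ≤ K)
    (hC : sampleConst cα cb * (H : ℝ) ^ 3 * S * (∑ i, (A i : ℝ)) / ε ^ 2 * effHorizon H R
        * logTerm S A K δ ^ 3 ≤ (K : ℝ) * H * S * ∑ i, (A i : ℝ)) :
    ENNReal.ofReal (1 - δ) ≤
      (robustQFTRL G R cb δ K (stepα cα K) (stepη cα H R K)).toOuterMeasure
        {π | IsRobustCCE G R ε π} := by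
  have hH0 : (0 : ℝ) < H := hε.trans_le hεH
  have hH : 1 ≤ H := by exact_mod_cast hH0
  have hM := one_le_effHorizon hH hR hR1
  have hMR := effHorizon_eq_or H R
  have hS : (1 : ℝ) ≤ S := by exact_mod_cast Nat.one_le_iff_ne_zero.2 (NeZero.ne S)
  have hAi : ∀ i, (1 : ℝ) ≤ A i := fun i => by
    exact_mod_cast Nat.one_le_iff_ne_zero.2 (NeZero.ne (A i))
  have hAle : ∀ i, (A i : ℝ) ≤ ∑ j, (A j : ℝ) := fun i =>
    Finset.single_le_sum (f := fun j => (A j : ℝ)) (fun j _ => Nat.cast_nonneg _)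
      (Finset.mem_univ i)
  have hT1 : (1 : ℝ) ≤ ∑ j, (A j : ℝ) := (hAi ⟨0, Nat.pos_of_ne_zero hm⟩).trans (hAle _)
  have hK2 : (2 : ℝ) ≤ K := by exact_mod_cast hK
  have hK0 : (0 : ℝ) < K := by linarith
  set M := effHorizon H R with hMdef
  set L := logTerm S A K δ with hLdef
  set T := ∑ j, (A j : ℝ) with hTdef
  set N : ℝ := S * T with hN
  have hN1 : 1 ≤ N := by nlinarith
  have hexpL : Real.exp (-L) = δ / (K * N) := by
    rw [hLdef, logTerm, Real.exp_neg, Real.exp_log (by positivity), inv_div, hN, mul_assoc]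
  have hlogK : Real.log K ≤ L := by
    refine Real.log_le_log hK0 ?_
    rw [le_div_iff₀ hδ]
    nlinarith [mul_le_mul_of_nonneg_left hN1 hK0.le]
  have hlogA : ∀ i, Real.log (A i) ≤ L := fun i => by
    refine Real.log_le_log (by linarith [hAi i]) ?_
    rw [le_div_iff₀ hδ]
    have h1 : (A i : ℝ) ≤ N := (hAle i).trans (by nlinarith)
    have h2 : N ≤ K * N := by nlinarith
    calc (A i : ℝ) * δ ≤ A i * 1 := by gcongr
      _ ≤ K * N := by linarith
      _ = K * S * T := by rw [hN]; ring
  have hlK0 : 0 < Real.log K := Real.log_pos (by linarith)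
  have hL0 : 0 < L := by linarith
  -- The common factor `H * S * T` of the sample count cancels; it is positive because there is at
  -- least one player.
  have hC' : sampleConst cα cb * (M * L ^ 3) * H ^ 2 ≤ K * ε ^ 2 := by
    have h1 : sampleConst cα cb * (H : ℝ) ^ 3 * S * T / ε ^ 2 * M * L ^ 3 * ε ^ 2 =
        (sampleConst cα cb * (M * L ^ 3) * H ^ 2) * (H * S * T) := by
      field_simp
    have h2 := mul_le_mul_of_nonneg_right hC (sq_nonneg ε)
    rw [h1] at h2
    have h3 : (K : ℝ) * H * S * T * ε ^ 2 = (K * ε ^ 2) * (H * S * T) := by ring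
    rw [h3] at h2
    exact le_of_mul_le_mul_right h2 (by positivity)
  have hCpos : 0 < sampleConst cα cb := by linarith [(sampleConst_bounds hcα hcb).2.2.2.2.2]
  have hreg : Regime cα cb M L K := by
    refine Regime.of_large hcα hcb hM hK hlogK ?_
    refine le_of_mul_le_mul_right (a := (H : ℝ) ^ 2) (hC'.trans ?_) (by positivity)
    gcongr
  have hρ := hreg.rate_pos
  set ρ := rate M L K with hρdef
  have hl0 : 0 ≤ (2 * cb + 2) * ρ := by positivity
  have hle : 9 * ((2 * cb + 2) * ρ * M) + (2 * cb + 2) * ρ + (3 * cα + cb) * (ρ * M) ≤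
      errConst cα cb * (ρ * M) := by
    have h1 := le_mul_of_one_le_right hl0 hM
    have h2 : errConst cα cb * (ρ * M) =
        10 * ((2 * cb + 2) * ρ * M) + (3 * cα + cb) * (ρ * M) := by
      rw [errConst]; ring
    linarith
  refine isRobustCCE_probability (P := 2 * N * Real.exp (-(3 * L))) hR hR1.le hMR hreg hl0 ?_
    (e := (3 * cα + cb) * (ρ * M)) (by positivity) rfl
    (fun n hn V hV => hreg.toOuterMeasure_not_stepCert_le G hR hR1.le hlogA n hn hV) hε ?_ ?_ hδ.le
  · linarith [hreg.small]
  · refine le_trans ?_ (hreg.four_mul_errConst_le hε hC')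
    gcongr
  · have hexp3 : Real.exp (-(3 * L)) = (δ / (K * N)) ^ 3 := by
      rw [← hexpL, ← Real.exp_nat_mul]
      congr 1
      push_cast
      ring
    rw [hexp3]
    exact hreg.failure_le hε hεH hC' hδ hδ1 hN1

end Main

end RobustMG

end

theorem theorem1 :
    ∀ cα cb : ℝ, 0 < cα → 0 < cb →
      ∃ C : ℝ, 0 < C ∧
        ∀ (m S H : ℕ) [NeZero S] (A : Fin m → ℕ) [∀ i, NeZero (A i)]
          (G : RobustMG.Game m S H A) (R ε δ : ℝ) (K : ℕ),
          0 ≤ R → R < 1 → 0 < ε → ε ≤ H → 0 < δ → δ < 1 → 2 ≤ K →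
          C * (H : ℝ) ^ 3 * S * (∑ i, (A i : ℝ)) / ε ^ 2 * RobustMG.effHorizon H R
              * RobustMG.logTerm S A K δ ^ 3
            ≤ (K : ℝ) * H * S * ∑ i, (A i : ℝ) →
          ENNReal.ofReal (1 - δ) ≤
            (RobustMG.robustQFTRL G R cb δ K (RobustMG.stepα cα K)
              (RobustMG.stepη cα H R K)).toOuterMeasure
              {π | RobustMG.IsRobustCCE G R ε π} := by
  intro cα cb hcα hcb
  refine ⟨RobustMG.sampleConst cα cb, ?_, ?_⟩
  · linarith [(RobustMG.sampleConst_bounds hcα hcb).2.2.2.2.2]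
  · intro m S H _ A _ G R ε δ K hR hR1 hε hεH hδ hδ1 hK hC
    rcases eq_or_ne m 0 with hm | hm
    · exact RobustMG.robustQFTRL_of_isEmpty hm G hcα hε.le hδ.le hK _
    · exact RobustMG.robustQFTRL_isRobustCCE G hm hcα hcb hR hR1 hε hεH hδ hδ1 hK hC
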